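/- Let $\mathbb K=\mathbb R$ (rebit–retrit) or $\mathbb K=\mathbb C$ (qubit–qutrit). Let $\mathcal D_{\mathbb K}$ be the set of $6\times 6$ density matrices $\rho$ over $\mathbb K$, i.e. symmetric (for $\mathbb K=\mathbb R$) or Hermitian (for $\mathbb K=\mathbb C$) positive semidefinite matrices with $\operatorname{Tr}\rho=1$; its dimension is $20$ for $\mathbb K=\mathbb R$ and $35$ for $\mathbb K=\mathbb C$. Index rows and columns by pairs $(a,b)$ with $a\in\{1,2\}$, $b\in\{1,2,3\}$, and let $\rho^{PT}$ be the partial transpose, $(\rho^{PT})_{(a,b),(c,d)}=\rho_{(a,d),(c,b)}$. Write $|\cdot|$ for the determinant, and $\langle\cdot\rangle_{\mathbb K}$ for the expectation with respect to the Hilbert–Schmidt probability measure on $\mathcal D_{\mathbb K}$: the normalized volume (of dimension $20$, respectively $35$) induced by the Hilbert–Schmidt (Frobenius) metric. This is a well-defined probability measure, and for every $k=0,1,2,\dots$ we have $\langle|\rho|^k\rangle_{\mathbb K}\neq 0$ and $$\left\langle |\rho|^k |\rho^{PT}| \right\rangle_{\mathbb R}=\frac{4 k^5+40 k^4+95 k^3-220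 k^2-1149 k-1170}{576 (k+4) (3 k+11) (3k+13) (6 k+23) (6 k+25)}\left\langle |\rho|^k \right\rangle_{\mathbb R},$$ $$\left\langle |\rho|^k |\rho^{PT}|^2 \right\rangle_{\mathbb R}=\frac{P(k)}{Q(k)}\left\langle |\rho|^k \right\rangle_{\mathbb R},$$ where $$P(k)=16 k^9+336 k^8+2616 k^7+8496 k^6+12069 k^5+101979 k^4+903539 k^3+3316809k^2+5620320 k+3715740,$$ $$Q(k)=331776 (k+5) (3 k+11) (3 k+13) (3 k+14) (3 k+16) (6 k+23) (6 k+25) (6k+29) (6 k+31),$$ and $$\left\langle |\rho|^k |\rho^{PT}| \right\rangle_{\mathbb C}=\frac{k^5+15 k^4+37 k^3-423 k^2-2558 k-3840}{72 (2 k+13) (3 k+19) (3k+20) (6 k+37) (6 k+41)}\left\langle |\rho|^k \right\rangle_{\mathbb C}.$$ -/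

import Mathlib

open MeasureTheory
open scoped ComplexOrder

noncomputable section

/-- The `6 × 6` density matrices of a `2 × 3` bipartite system over `𝕜`: positive semidefinite
(in particular symmetric for `𝕜 = ℝ`, Hermitian for `𝕜 = ℂ`) of unit trace. -/
def densityMatrices (𝕜 : Type*) [RCLike 𝕜] : Set (Matrix (Fin 2 × Fin 3) (Fin 2 × Fin 3) 𝕜) :=
  {ρ | ρ.PosSemidef ∧ ρ.trace = 1}

/-- The partial transpose: each of the four `3 × 3` blocks is transposed in place. -/
def partialTranspose {𝕜 : Type*} (ρ : Matrix (Fin 2 × Fin 3) (Fin 2 × Fin 3) 𝕜) :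
    Matrix (Fin 2 × Fin 3) (Fin 2 × Fin 3) 𝕜 :=
  Matrix.of fun i j => ρ (i.1, j.2) (j.1, i.2)

/-- The space of all `6 × 6` matrices with the Hilbert-Schmidt (Frobenius) metric: the Euclidean
norm of the entries satisfies `‖A‖ ^ 2 = ∑ i j, ‖A i j‖ ^ 2 = Tr (Aᴴ A)`. -/
abbrev HSSpace (𝕜 : Type*) [RCLike 𝕜] : Type _ :=
  EuclideanSpace 𝕜 ((Fin 2 × Fin 3) × (Fin 2 × Fin 3))

/-- The matrix with the given entries. -/
def HSSpace.toMatrix {𝕜 : Type*} [RCLike 𝕜] (x : HSSpace 𝕜) :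
    Matrix (Fin 2 × Fin 3) (Fin 2 × Fin 3) 𝕜 :=
  Matrix.of fun i j => x (i, j)

/-- The normalized `d`-dimensional volume that the Hilbert-Schmidt metric induces on the density
matrices: the `d`-dimensional Hausdorff measure of that metric, conditioned on the set of density
matrices. The dimension of that set is `d = 20` for `𝕜 = ℝ` and `d = 35` for `𝕜 = ℂ`. A constant
factor in the metric does not change the normalized measure. -/
def hsMeasure (𝕜 : Type*) [RCLike 𝕜] (d : ℝ) : Measure (HSSpace 𝕜) :=
  ProbabilityTheory.cond (Measure.hausdorffMeasure d) {x | x.toMatrix ∈ densityMatrices 𝕜}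

/-- The moment `⟨|ρ| ^ k |ρ^PT| ^ n⟩` with respect to a measure `μ`. -/
def moment {𝕜 : Type*} [RCLike 𝕜] (μ : Measure (HSSpace 𝕜)) (k n : ℕ) : 𝕜 :=
  ∫ x, x.toMatrix.det ^ k * (partialTranspose x.toMatrix).det ^ n ∂μ

end

/-! Let β be the real dimension of 𝕜, and write a 6×6 matrix in blocks [[A, B], [Bᴴ, C]]. Up to a
full transposition, which does not affect the determinant, partial transposition exchanges B and Bᴴ.

Both determinants are homogeneous, so averages over the matrices of unit trace can be read off from
integrals over the whole cone of positive definite matrices with weight exp(-tr). The radial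
variable is Gamma distributed and contributes only a rising factorial (`exists_hasInt_parVol`,
`rawMoment_eq`). On the section itself the Hausdorff measure is a Haar measure of the traceless
subspace, and singular states form a null set.

For fixed A and C put C = R², A = R F R, F = G² and B = R G X R. The block matrix is then congruent
to [[1, X], [Xᴴ, 1]], so X is a strict contraction with density det(1 - XᴴX)^k, and the partially
transposed determinant is det(C)² det(F - XᴴFX). Jacobian and determinants together leave the weight
(det A det C)^κ with κ = k + 3β/2, so A and C become independent Wishart matrices
(`exists_integral_blk`, `integral_parVol`). By unitary invariance the X-average is symmetric in the
eigenvalues of F; after scaling by det C it is a polynomial in det A, det C, tr(adj C · A) and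
tr(adj A · C).

The moments of X come from Gaussian ones: if L is the Cholesky factor of an independent Wishart
matrix of parameter κ, then X Lᴴ is Gaussian (`map_cholAct`). After averaging over signs of columns,
each Gaussian moment is a combination, with explicit positive coefficients, of a few moments of X.
These triangular relations are solved one after the other (`integral_muX_of_gauEnt`), giving
`integral_cDet` and, over ℝ, `integral_cDet_sq`.

To average over A, unitary invariance makes C diagonal (`hasInt_wish_mix`). What remains are
products of diagonal entries of A and of adj A, which Bartlett's decomposition (`map_cholCoord_chi`)
expresses through independent Gamma and Gaussian variables. The outcome is a polynomial in the
symmetric functions of C; its average over C is the same computation with the identity in place of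
C. The final formulas are then identities of rational functions of k. -/

open Matrix Module
open scoped ENNReal

/-! ### Cholesky coordinates on Hermitian 3×3 matrices -/

section Cholesky

variable {𝕜 : Type*} [RCLike 𝕜]

/-- Coordinates `(c₁₁, c₂₁, c₃₁, c₂₂, c₃₂, c₃₃)` of Hermitian `3 × 3` matrices. -/
abbrev HermCoord (𝕜 : Type*) : Type _ := ℝ × 𝕜 × 𝕜 × ℝ × 𝕜 × ℝ

/-- The Hermitian matrix with the given coordinates. -/
def hmat (p : HermCoord 𝕜) : Matrix (Fin 3) (Fin 3) 𝕜 :=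
  !![(p.1 : 𝕜), star p.2.1, star p.2.2.1;
     p.2.1, (p.2.2.2.1 : 𝕜), star p.2.2.2.2.1;
     p.2.2.1, p.2.2.2.2.1, (p.2.2.2.2.2 : 𝕜)]

/-- The lower triangular matrix with squared diagonal `(a₁, a₂, a₃)`. -/
noncomputable def cholMat (p : HermCoord 𝕜) : Matrix (Fin 3) (Fin 3) 𝕜 :=
  !![(√p.1 : 𝕜), 0, 0;
     p.2.1, (√p.2.2.2.1 : 𝕜), 0;
     p.2.2.1, p.2.2.2.2.1, (√p.2.2.2.2.2 : 𝕜)]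

/-- The coordinates of `L * Lᴴ` for `L = cholMat p`. -/
noncomputable def cholCoord (p : HermCoord 𝕜) : HermCoord 𝕜 :=
  (p.1, √p.1 • p.2.1, √p.1 • p.2.2.1, p.2.2.2.1 + ‖p.2.1‖ ^ 2,
    p.2.2.1 * star p.2.1 + √p.2.2.2.1 • p.2.2.2.2.1,
    p.2.2.2.2.2 + (‖p.2.2.1‖ ^ 2 + ‖p.2.2.2.2.1‖ ^ 2))

/-- The measure on the coordinates of Hermitian matrices. -/
noncomputable abbrev hermVol (𝕜 : Type*) [RCLike 𝕜] : Measure (HermCoord 𝕜) :=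
  (volume : Measure ℝ).prod ((Measure.addHaar : Measure 𝕜).prod ((Measure.addHaar : Measure 𝕜).prod
    ((volume : Measure ℝ).prod ((Measure.addHaar : Measure 𝕜).prod (volume : Measure ℝ)))))

theorem hmat_isHermitian (p : HermCoord 𝕜) : (hmat p).IsHermitian := by
  ext i j
  fin_cases i <;> fin_cases j <;> simp [hmat, conjTranspose_apply]

theorem hmat_cholCoord {p : HermCoord 𝕜} (h1 : 0 ≤ p.1) (h2 : 0 ≤ p.2.2.2.1)
    (h3 : 0 ≤ p.2.2.2.2.2) : hmat (cholCoord p) = cholMat p * (cholMat p)ᴴ := by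
  have e1 : ((√p.1 : ℝ) : 𝕜) * ((√p.1 : ℝ) : 𝕜) = p.1 := by
    rw [← RCLike.ofReal_mul, Real.mul_self_sqrt h1]
  have e2 : ((√p.2.2.2.1 : ℝ) : 𝕜) * ((√p.2.2.2.1 : ℝ) : 𝕜) = p.2.2.2.1 := by
    rw [← RCLike.ofReal_mul, Real.mul_self_sqrt h2]
  have e3 : ((√p.2.2.2.2.2 : ℝ) : 𝕜) * ((√p.2.2.2.2.2 : ℝ) : 𝕜) = p.2.2.2.2.2 := by
    rw [← RCLike.ofReal_mul, Real.mul_self_sqrt h3]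
  ext i j
  fin_cases i <;> fin_cases j <;>
    simp [hmat, cholCoord, cholMat, mul_apply, Fin.sum_univ_three, conjTranspose_apply,
      RCLike.real_smul_eq_coe_mul, e1, e2, e3, ← RCLike.mul_conj,
      RCLike.algebraMap_eq_ofReal] <;> ring

theorem det_cholMat (p : HermCoord 𝕜) :
    (cholMat p).det = ((√p.1 * √p.2.2.2.1 * √p.2.2.2.2.2 : ℝ) : 𝕜) := by
  simp [cholMat, det_fin_three]

theorem det_hmat_cholCoord {p : HermCoord 𝕜} (h1 : 0 ≤ p.1) (h2 : 0 ≤ p.2.2.2.1) :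
    (hmat (cholCoord p)).det = ((p.1 * p.2.2.2.1 * p.2.2.2.2.2 : ℝ) : 𝕜) := by
  have e1 : ((√p.1 : ℝ) : 𝕜) * ((√p.1 : ℝ) : 𝕜) = p.1 := by
    rw [← RCLike.ofReal_mul, Real.mul_self_sqrt h1]
  have e2 : ((√p.2.2.2.1 : ℝ) : 𝕜) * ((√p.2.2.2.1 : ℝ) : 𝕜) = p.2.2.2.1 := by
    rw [← RCLike.ofReal_mul, Real.mul_self_sqrt h2]
  simp only [hmat, cholCoord, det_fin_three, RCLike.real_smul_eq_coe_mul]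
  simp [← RCLike.mul_conj, RCLike.algebraMap_eq_ofReal]
  set u := p.2.1
  set v := p.2.2.1
  set w := p.2.2.2.2.1
  set s : 𝕜 := ((√p.2.2.2.1 : ℝ) : 𝕜)
  set c := starRingEnd 𝕜
  linear_combination (-((p.2.2.2.1 : 𝕜) * v * c v + u * c u * (p.2.2.2.2.2 : 𝕜)
    + u * c u * w * c w - u * c v * w * s - c u * v * c w * s)) * e1 - (p.1 : 𝕜) * w * c w * e2

theorem trace_hmat_cholCoord (p : HermCoord 𝕜) :
    (hmat (cholCoord p)).trace = ((p.1 + p.2.2.2.1 + p.2.2.2.2.2 + ‖p.2.1‖ ^ 2 + ‖p.2.2.1‖ ^ 2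
      + ‖p.2.2.2.2.1‖ ^ 2 : ℝ) : 𝕜) := by
  simp [hmat, cholCoord, trace_fin_three]
  ring

theorem posDef_hmat_cholCoord {p : HermCoord 𝕜} (h1 : 0 < p.1) (h2 : 0 < p.2.2.2.1)
    (h3 : 0 < p.2.2.2.2.2) : (hmat (cholCoord p)).PosDef := by
  rw [hmat_cholCoord h1.le h2.le h3.le]
  refine PosDef.mul_conjTranspose_self _ (vecMul_injective_of_isUnit ?_)
  rw [isUnit_iff_isUnit_det, det_cholMat, isUnit_iff_ne_zero]
  norm_cast
  positivity

theorem fst_pos_of_posDef {p : HermCoord 𝕜} (h : (hmat p).PosDef) : 0 < p.1 := by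
  have := h.diag_pos (i := 0)
  simpa [hmat] using this

theorem trd_pos_of_posDef {p : HermCoord 𝕜} (h1 : 0 < p.1) (h2 : 0 < p.2.2.2.1)
    (h : (hmat (cholCoord p)).PosDef) : 0 < p.2.2.2.2.2 := by
  have := h.det_pos
  rw [det_hmat_cholCoord h1.le h2.le, RCLike.ofReal_pos] at this
  exact pos_of_mul_pos_right this (by positivity)

theorem measurable_cholCoord : Measurable (cholCoord (𝕜 := 𝕜)) := by
  unfold cholCoord
  apply Continuous.measurable
  fun_prop

theorem continuous_hmat : Continuous (hmat (𝕜 := 𝕜)) := by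
  refine continuous_matrix fun i j => ?_
  fin_cases i <;> fin_cases j <;> simp only [hmat] <;> simp <;>
    first | fun_prop | exact RCLike.continuous_conj.comp (by fun_prop)

theorem lintegral_eq_smul {r : ℝ} (hr : 0 < r) (H : 𝕜 → ℝ≥0∞) :
    ∫⁻ z, H z ∂Measure.addHaar
      = ENNReal.ofReal (r ^ finrank ℝ 𝕜) * ∫⁻ z, H (r • z) ∂Measure.addHaar := by
  have h := Measure.map_addHaar_smul (Measure.addHaar : Measure 𝕜) hr.ne'
  have h2 : ∫⁻ z, H (r • z) ∂Measure.addHaar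
      = ∫⁻ z, H z ∂(Measure.map (r • ·) (Measure.addHaar : Measure 𝕜)) :=
    ((Homeomorph.smulOfNeZero r hr.ne').toMeasurableEquiv.measurableEmbedding.lintegral_map
      H).symm
  rw [h2, h, lintegral_smul_measure, smul_eq_mul, ← mul_assoc,
    ← ENNReal.ofReal_mul (by positivity), abs_of_pos (by positivity), mul_inv_cancel₀ (by positivity)]
  simp

end Cholesky

open Matrix Module
open scoped ENNReal

/-! ### Measurability of the cone of positive definite matrices -/

section PosDefTopology

variable {𝕜 : Type*} [RCLike 𝕜] {n : Type*} [Fintype n] [DecidableEq n]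

theorem isClosed_posSemidef : IsClosed {M : Matrix n n 𝕜 | M.PosSemidef} := by
  have : {M : Matrix n n 𝕜 | M.PosSemidef}
      = {M | Mᴴ = M} ∩ ⋂ x : n → 𝕜, {M | 0 ≤ star x ⬝ᵥ (M *ᵥ x)} := by
    ext M
    simp [posSemidef_iff_dotProduct_mulVec, IsHermitian]
  rw [this]
  refine (isClosed_eq (by fun_prop) (by fun_prop)).inter (isClosed_iInter fun x => ?_)
  refine isClosed_le (by fun_prop) ?_
  exact Continuous.dotProduct (by fun_prop) (Continuous.matrix_mulVec (by fun_prop) (by fun_prop))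

theorem posDef_iff_posSemidef_det_ne {M : Matrix n n 𝕜} :
    M.PosDef ↔ M.PosSemidef ∧ M.det ≠ 0 := by
  constructor
  · exact fun h => ⟨h.posSemidef, h.det_pos.ne'⟩
  · rintro ⟨h, h0⟩
    exact h.posDef_iff_isUnit.2 (by rwa [isUnit_iff_isUnit_det, isUnit_iff_ne_zero])

theorem measurableSet_posSemidef {α : Type*} [TopologicalSpace α] [MeasurableSpace α]
    [OpensMeasurableSpace α] {f : α → Matrix n n 𝕜} (hf : Continuous f) :
    MeasurableSet {x | (f x).PosSemidef} :=
  (isClosed_posSemidef.preimage hf).measurableSet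

theorem measurableSet_posDef {α : Type*} [TopologicalSpace α] [MeasurableSpace α]
    [OpensMeasurableSpace α] {f : α → Matrix n n 𝕜} (hf : Continuous f) :
    MeasurableSet {x | (f x).PosDef} := by
  have : {x | (f x).PosDef} = {x | (f x).PosSemidef} ∩ {x | (f x).det = 0}ᶜ := by
    ext x
    simp [posDef_iff_posSemidef_det_ne]
  rw [this]
  exact (measurableSet_posSemidef hf).inter
    (isClosed_eq (hf.matrix_det) continuous_const).measurableSet.compl

end PosDefTopology

/-! ### Wishart measures and the Bartlett decomposition -/

section Wishart

variable {𝕜 : Type*} [RCLike 𝕜]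

/-- The unnormalised Gamma distribution. -/
noncomputable def gam (s : ℝ) : Measure ℝ :=
  (volume.restrict (Set.Ioi 0)).withDensity fun x => ENNReal.ofReal (x ^ (s - 1) * Real.exp (-x))

variable (𝕜) in
/-- The unnormalised standard Gaussian distribution `exp (-‖z‖ ^ 2)`. -/
noncomputable def gau : Measure 𝕜 :=
  Measure.addHaar.withDensity fun z => ENNReal.ofReal (Real.exp (-‖z‖ ^ 2))

variable (𝕜) in
/-- The joint distribution of the squared diagonal and the lower entries of the Cholesky factor of
a Wishart matrix. -/
noncomputable def chi (κ : ℝ) : Measure (HermCoord 𝕜) :=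
  (gam (κ + 1 + finrank ℝ 𝕜)).prod ((gau 𝕜).prod ((gau 𝕜).prod
    ((gam (κ + 1 + finrank ℝ 𝕜 / 2)).prod ((gau 𝕜).prod (gam (κ + 1))))))

variable (𝕜) in
/-- The unnormalised Wishart distribution with density `exp (-tr A) * det A ^ κ` on positive
definite matrices. -/
noncomputable def wish (κ : ℝ) : Measure (HermCoord 𝕜) :=
  (hermVol 𝕜).withDensity ({p | (hmat p).PosDef}.indicator fun p =>
    ENNReal.ofReal (Real.exp (-RCLike.re (hmat p).trace) * RCLike.re (hmat p).det ^ κ))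

instance (s : ℝ) : SFinite (gam s) := by unfold gam; infer_instance
instance : SFinite (gau 𝕜) := by unfold gau; infer_instance
instance (κ : ℝ) : SFinite (chi 𝕜 κ) := by unfold chi; infer_instance

theorem lintegral_gam (s : ℝ) (f : ℝ → ℝ≥0∞) : ∫⁻ x, f x ∂gam s
    = ∫⁻ x in Set.Ioi 0, ENNReal.ofReal (x ^ (s - 1) * Real.exp (-x)) * f x := by
  unfold gam
  rw [lintegral_withDensity_eq_lintegral_mul_non_measurable _ (by fun_prop) (by simp)]
  rfl

theorem lintegral_gau (f : 𝕜 → ℝ≥0∞) : ∫⁻ z, f z ∂gau 𝕜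
    = ∫⁻ z, ENNReal.ofReal (Real.exp (-‖z‖ ^ 2)) * f z ∂Measure.addHaar := by
  unfold gau
  rw [lintegral_withDensity_eq_lintegral_mul_non_measurable _ (by fun_prop) (by simp)]
  rfl

theorem lintegral_prod_six {α₁ α₂ α₃ α₄ α₅ α₆ : Type*} [MeasurableSpace α₁] [MeasurableSpace α₂]
    [MeasurableSpace α₃] [MeasurableSpace α₄] [MeasurableSpace α₅] [MeasurableSpace α₆]
    (μ₁ : Measure α₁) (μ₂ : Measure α₂) (μ₃ : Measure α₃) (μ₄ : Measure α₄) (μ₅ : Measure α₅)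
    (μ₆ : Measure α₆) [SFinite μ₂] [SFinite μ₃] [SFinite μ₄] [SFinite μ₅] [SFinite μ₆]
    {F : α₁ × α₂ × α₃ × α₄ × α₅ × α₆ → ℝ≥0∞} (hF : Measurable F) :
    ∫⁻ p, F p ∂(μ₁.prod (μ₂.prod (μ₃.prod (μ₄.prod (μ₅.prod μ₆)))))
      = ∫⁻ a, ∫⁻ b, ∫⁻ c, ∫⁻ d, ∫⁻ e, ∫⁻ f, F (a, b, c, d, e, f) ∂μ₆ ∂μ₅ ∂μ₄ ∂μ₃ ∂μ₂ ∂μ₁ := by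
  rw [lintegral_prod _ hF.aemeasurable]
  refine lintegral_congr fun a => ?_
  rw [lintegral_prod (fun x => F (a, x)) (hF.comp (by fun_prop)).aemeasurable]
  refine lintegral_congr fun b => ?_
  rw [lintegral_prod (fun x => F (a, b, x)) (hF.comp (by fun_prop)).aemeasurable]
  refine lintegral_congr fun c => ?_
  rw [lintegral_prod (fun x => F (a, b, c, x)) (hF.comp (by fun_prop)).aemeasurable]
  refine lintegral_congr fun d => ?_
  rw [lintegral_prod (fun x => F (a, b, c, d, x)) (hF.comp (by fun_prop)).aemeasurable]

theorem lintegral_eq_Ioi {f : ℝ → ℝ≥0∞} (hf : ∀ x, x ≤ 0 → f x = 0) :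
    ∫⁻ x, f x = ∫⁻ x in Set.Ioi 0, f x := by
  rw [← lintegral_indicator measurableSet_Ioi]
  refine lintegral_congr fun x => ?_
  by_cases hx : 0 < x
  · simp [hx]
  · simp [hx, hf x (not_lt.1 hx)]

/-- With the first column fixed, the remaining coordinates are changed one at a time: the second
pivot and the third diagonal entry by translations, the entry between them by a translation and a
scaling by √b. Only the scaling contributes a Jacobian. The support of G confines both pivots to the
positive half-line. -/
theorem lintegral_chol_inner {G : HermCoord 𝕜 → ℝ≥0∞}
    (h0 : ∀ p, ¬ (hmat p).PosDef → G p = 0) {a : ℝ} (ha : 0 < a) (x y : 𝕜) :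
    ∫⁻ d, ∫⁻ e, ∫⁻ f, G (a, √a • x, √a • y, d, e, f) ∂volume ∂Measure.addHaar ∂volume
      = ∫⁻ b in Set.Ioi 0, ENNReal.ofReal (√b ^ finrank ℝ 𝕜) * ∫⁻ z, ∫⁻ c in Set.Ioi 0,
        G (cholCoord (a, x, y, b, z, c)) ∂volume ∂Measure.addHaar ∂volume := by
  have key : ∀ b : ℝ, ∫⁻ e, ∫⁻ f, G (a, √a • x, √a • y, b + ‖x‖ ^ 2, e, f) ∂volume
        ∂Measure.addHaar = ∫⁻ e, ∫⁻ c, G (a, √a • x, √a • y, b + ‖x‖ ^ 2, y * star x + e,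
          c + (‖y‖ ^ 2 + ‖(√b)⁻¹ • e‖ ^ 2)) ∂volume ∂Measure.addHaar := by
    intro b
    rw [← lintegral_add_left_eq_self _ (y * star x)]
    refine lintegral_congr fun e => ?_
    rw [← lintegral_add_right_eq_self _ (‖y‖ ^ 2 + ‖(√b)⁻¹ • e‖ ^ 2)]
  rw [← lintegral_add_right_eq_self _ (‖x‖ ^ 2)]
  have hb : ∀ b : ℝ, 0 < b → ∫⁻ e, ∫⁻ f, G (a, √a • x, √a • y, b + ‖x‖ ^ 2, e, f) ∂volume
        ∂Measure.addHaar = ENNReal.ofReal (√b ^ finrank ℝ 𝕜) * ∫⁻ z, ∫⁻ c,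
        G (cholCoord (a, x, y, b, z, c)) ∂volume ∂Measure.addHaar := by
    intro b hb
    have : 0 < √b := Real.sqrt_pos.2 hb
    rw [key, lintegral_eq_smul this]
    congr 1
    refine lintegral_congr fun z => lintegral_congr fun c => ?_
    rw [smul_smul, inv_mul_cancel₀ this.ne', one_smul]
    rfl
  rw [lintegral_eq_Ioi]
  · refine setLIntegral_congr_fun measurableSet_Ioi fun b hb' => ?_
    rw [hb b hb']
    congr 1
    refine lintegral_congr fun z => lintegral_eq_Ioi fun c hc => h0 _ fun h => ?_
    exact absurd (trd_pos_of_posDef (p := (a, x, y, b, z, c)) ha hb' h) (not_lt.2 hc)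
  · intro b hb'
    rw [← nonpos_iff_eq_zero]
    refine (lintegral_mono fun e => lintegral_mono fun f => (h0 _ fun h => ?_).le).trans_eq
      (by simp : ∫⁻ (_ : 𝕜), ∫⁻ _ : ℝ, (0 : ℝ≥0∞) ∂volume ∂Measure.addHaar = 0)
    -- The leading 2×2 minor equals a b, so positive definiteness is impossible for b ≤ 0.
    have h2 := (h.submatrix (e := ![0, 1]) (by decide)).det_pos
    have e1 : ((√a : ℝ) : 𝕜) * ((√a : ℝ) : 𝕜) = a := by
      rw [← RCLike.ofReal_mul, Real.mul_self_sqrt ha.le]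
    have e2 : ((hmat (a, √a • x, √a • y, b + ‖x‖ ^ 2, e, f)).submatrix ![0, 1] ![0, 1]).det
        = ((a * b : ℝ) : 𝕜) := by
      simp only [hmat, det_fin_two, RCLike.real_smul_eq_coe_mul]
      simp [← RCLike.mul_conj, RCLike.algebraMap_eq_ofReal]
      linear_combination (-(x * (starRingEnd 𝕜) x)) * e1
    rw [e2, RCLike.ofReal_pos] at h2
    exact absurd (pos_of_mul_pos_right h2 ha.le) (not_lt.2 hb')

/-- The map to Cholesky coordinates is triangular, so iterated one-variable substitutions replace a
Jacobian determinant; the two scalings by √a come from the first column. -/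
theorem lintegral_chol {G : HermCoord 𝕜 → ℝ≥0∞} (hG : Measurable G)
    (h0 : ∀ p, ¬ (hmat p).PosDef → G p = 0) :
    ∫⁻ p, G p ∂hermVol 𝕜 = ∫⁻ a in Set.Ioi 0, ENNReal.ofReal (√a ^ finrank ℝ 𝕜) *
      ∫⁻ x, ENNReal.ofReal (√a ^ finrank ℝ 𝕜) * ∫⁻ y, ∫⁻ b in Set.Ioi 0,
      ENNReal.ofReal (√b ^ finrank ℝ 𝕜) * ∫⁻ z, ∫⁻ c in Set.Ioi 0,
      G (cholCoord (a, x, y, b, z, c)) ∂volume ∂Measure.addHaar ∂volume ∂Measure.addHaar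
        ∂Measure.addHaar ∂volume := by
  rw [lintegral_prod_six _ _ _ _ _ _ hG, lintegral_eq_Ioi]
  · refine setLIntegral_congr_fun measurableSet_Ioi fun a ha => ?_
    have : 0 < √a := Real.sqrt_pos.2 ha
    rw [lintegral_eq_smul this]
    congr 1
    refine lintegral_congr fun x => ?_
    rw [lintegral_eq_smul this]
    congr 1
    exact lintegral_congr fun y => lintegral_chol_inner h0 ha x y
  · intro a ha
    have h0' : ∀ b c d e f, G (a, b, c, d, e, f) = 0 := fun b c d e f => h0 _ fun h =>
      absurd (fst_pos_of_posDef h) (not_lt.2 ha)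
    simp [h0']

theorem measurable_re_trace_hmat : Measurable fun p : HermCoord 𝕜 => RCLike.re (hmat p).trace :=
  (RCLike.continuous_re.comp continuous_hmat.matrix_trace).measurable

theorem measurable_re_det_hmat : Measurable fun p : HermCoord 𝕜 => RCLike.re (hmat p).det :=
  (RCLike.continuous_re.comp continuous_hmat.matrix_det).measurable

/-- Bartlett decomposition. -/
theorem map_cholCoord_chi (κ : ℝ) : (chi 𝕜 κ).map cholCoord = wish 𝕜 κ := by
  have hS : MeasurableSet {p : HermCoord 𝕜 | (hmat p).PosDef} :=
    measurableSet_posDef continuous_hmat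
  have hm : Measurable fun p : HermCoord 𝕜 =>
      ENNReal.ofReal (Real.exp (-RCLike.re (hmat p).trace) * RCLike.re (hmat p).det ^ κ) :=
    ((Real.measurable_exp.comp measurable_re_trace_hmat.neg).mul
      (measurable_re_det_hmat.pow_const κ)).ennreal_ofReal
  refine Measure.ext_of_lintegral _ fun F hF => ?_
  rw [lintegral_map hF measurable_cholCoord, wish,
    lintegral_withDensity_eq_lintegral_mul _ (hm.indicator hS) hF, lintegral_chol, chi,
    lintegral_prod_six (F := fun p => F (cholCoord p)) _ _ _ _ _ _ (hF.comp measurable_cholCoord)]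
  · simp only [lintegral_gam, lintegral_gau, ← lintegral_const_mul' _ _ ENNReal.ofReal_ne_top]
    refine setLIntegral_congr_fun measurableSet_Ioi fun a ha => lintegral_congr fun x =>
      lintegral_congr fun y => setLIntegral_congr_fun measurableSet_Ioi fun b hb =>
      lintegral_congr fun z => setLIntegral_congr_fun measurableSet_Ioi fun c hc => ?_
    simp only [Set.mem_Ioi] at ha hb hc
    have hpd := posDef_hmat_cholCoord (p := (a, x, y, b, z, c)) ha hb hc
    simp only [Pi.mul_apply]
    rw [Set.indicator_of_mem (by exact hpd), trace_hmat_cholCoord,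
      det_hmat_cholCoord ha.le hb.le]
    simp only [← mul_assoc]
    congr 1
    simp (discharger := positivity) only [← ENNReal.ofReal_mul, RCLike.ofReal_re]
    congr 1
    -- The Jacobian is a^β b^(β/2) and the density contributes (a b c)^κ, whence the Gamma
    -- parameters κ + 1 + β, κ + 1 + β/2 and κ + 1.
    have s1 : √a ^ finrank ℝ 𝕜 = a ^ ((finrank ℝ 𝕜 : ℝ) / 2) := by
      rw [Real.sqrt_eq_rpow, ← Real.rpow_natCast, ← Real.rpow_mul ha.le]; ring_nf
    have s2 : √b ^ finrank ℝ 𝕜 = b ^ ((finrank ℝ 𝕜 : ℝ) / 2) := by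
      rw [Real.sqrt_eq_rpow, ← Real.rpow_natCast, ← Real.rpow_mul hb.le]; ring_nf
    rw [s1, s2, Real.mul_rpow (by positivity) hc.le, Real.mul_rpow ha.le hb.le,
      show κ + 1 + (finrank ℝ 𝕜 : ℝ) - 1 = κ + (finrank ℝ 𝕜 : ℝ) / 2 + (finrank ℝ 𝕜 : ℝ) / 2 by ring,
      Real.rpow_add ha, Real.rpow_add ha,
      show κ + 1 + (finrank ℝ 𝕜 : ℝ) / 2 - 1 = κ + (finrank ℝ 𝕜 : ℝ) / 2 by ring,
      Real.rpow_add hb, add_sub_cancel_right,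
      show -(a + b + c + ‖x‖ ^ 2 + ‖y‖ ^ 2 + ‖z‖ ^ 2)
        = -a + -‖x‖ ^ 2 + -‖y‖ ^ 2 + -b + -‖z‖ ^ 2 + -c by ring]
    simp only [Real.exp_add]
    ring
  · exact (hm.indicator hS).mul hF
  · intro p hp
    simp [hp]

end Wishart

open Matrix Module
open scoped ENNReal

/-! ### Calculus of integrable functions with known integral -/

section HasInt

/-- `f` is integrable with integral `v`. -/
def HasInt {α : Type*} [MeasurableSpace α] (μ : Measure α) (f : α → ℝ) (v : ℝ) : Prop :=
  Integrable f μ ∧ ∫ x, f x ∂μ = v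

variable {α α' : Type*} [MeasurableSpace α] [MeasurableSpace α'] {μ : Measure α}
  {μ' : Measure α'}

theorem HasInt.add {f g : α → ℝ} {v w : ℝ} (hf : HasInt μ f v) (hg : HasInt μ g w) :
    HasInt μ (fun x => f x + g x) (v + w) :=
  ⟨hf.1.add hg.1, by rw [integral_add hf.1 hg.1, hf.2, hg.2]⟩

theorem HasInt.sub {f g : α → ℝ} {v w : ℝ} (hf : HasInt μ f v) (hg : HasInt μ g w) :
    HasInt μ (fun x => f x - g x) (v - w) :=
  ⟨hf.1.sub hg.1, by rw [integral_sub hf.1 hg.1, hf.2, hg.2]⟩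

theorem HasInt.const_mul {f : α → ℝ} {v : ℝ} (hf : HasInt μ f v) (c : ℝ) :
    HasInt μ (fun x => c * f x) (c * v) :=
  ⟨hf.1.const_mul c, by rw [integral_const_mul, hf.2]⟩

theorem HasInt.zero : HasInt μ (fun _ => 0) 0 := ⟨integrable_zero _ _ _, by simp⟩

theorem HasInt.sum {ι : Type*} (s : Finset ι) {f : ι → α → ℝ} {v : ι → ℝ}
    (h : ∀ i ∈ s, HasInt μ (f i) (v i)) : HasInt μ (fun x => ∑ i ∈ s, f i x) (∑ i ∈ s, v i) :=
  ⟨integrable_finsetSum s fun i hi => (h i hi).1, by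
    rw [integral_finsetSum s fun i hi => (h i hi).1]
    exact Finset.sum_congr rfl fun i hi => (h i hi).2⟩

theorem HasInt.listSum {ι : Type*} (l : List ι) {f : ι → α → ℝ} {v : ι → ℝ}
    (h : ∀ i ∈ l, HasInt μ (f i) (v i)) :
    HasInt μ (fun x => (l.map fun i => f i x).sum) (l.map v).sum := by
  induction l with
  | nil => simpa using HasInt.zero
  | cons a l ih =>
    simp only [List.map_cons, List.sum_cons]
    exact (h a (by simp)).add (ih fun i hi => h i (by simp [hi]))

theorem HasInt.mul_prod [SFinite μ] [SFinite μ'] {f : α → ℝ} {g : α' → ℝ} {v w : ℝ}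
    (hf : HasInt μ f v) (hg : HasInt μ' g w) :
    HasInt (μ.prod μ') (fun x => f x.1 * g x.2) (v * w) :=
  ⟨hf.1.mul_prod hg.1, by rw [integral_prod_mul, hf.2, hg.2]⟩

theorem HasInt.congr_ae {f g : α → ℝ} {v : ℝ} (hf : HasInt μ f v) (h : f =ᵐ[μ] g) :
    HasInt μ g v :=
  ⟨hf.1.congr h, by rw [← integral_congr_ae h, hf.2]⟩

theorem HasInt.congr {f g : α → ℝ} {v w : ℝ} (hf : HasInt μ f v) (h : ∀ x, f x = g x)
    (hv : v = w) : HasInt μ g w := by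
  have : f = g := funext h
  rwa [← this, ← hv]

theorem HasInt.unique {f : α → ℝ} {v w : ℝ} (h : HasInt μ f v) (h' : HasInt μ f w) : v = w :=
  h.2.symm.trans h'.2

theorem MeasureTheory.Integrable.hasInt {f : α → ℝ} (h : Integrable f μ) :
    HasInt μ f (∫ x, f x ∂μ) := ⟨h, rfl⟩

theorem hasInt_map {T : α → α'} (hT : Measurable T) {f : α' → ℝ} (hf : Measurable f) {v : ℝ} :
    HasInt (μ.map T) f v ↔ HasInt μ (fun x => f (T x)) v := by
  unfold HasInt
  rw [integrable_map_measure hf.aestronglyMeasurable hT.aemeasurable,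
    integral_map hT.aemeasurable hf.aestronglyMeasurable]
  rfl

end HasInt

/-! ### Moments of the Gamma and Gaussian variables -/

section Moments

variable {𝕜 : Type*} [RCLike 𝕜]

/-- The rising factorial. -/
def rising (s : ℝ) (j : ℕ) : ℝ := ∏ i ∈ Finset.range j, (s + i)

theorem Gamma_add_nat {s : ℝ} (hs : 0 < s) (j : ℕ) :
    Real.Gamma (s + j) = Real.Gamma s * rising s j := by
  induction j with
  | zero => simp [rising]
  | succ j ih =>
    rw [rising, Finset.prod_range_succ, ← rising, ← mul_assoc, ← ih, Nat.cast_succ, ← add_assoc,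
      Real.Gamma_add_one (by positivity)]
    ring

/-- Real exponents are allowed because odd terms such as those in `hasInt_chi_odd` carry a
half-integer power of a pivot. -/
theorem hasInt_gam_rpow {s r : ℝ} (hr : 0 < s + r) :
    HasInt (gam s) (fun x => x ^ r) (Real.Gamma (s + r)) := by
  have e : ∀ x ∈ Set.Ioi (0 : ℝ), (ENNReal.ofReal (x ^ (s - 1) * Real.exp (-x))).toReal • x ^ r
      = Real.exp (-x) * x ^ (s + r - 1) := by
    intro x hx
    have hx : 0 < x := hx
    rw [ENNReal.toReal_ofReal (by positivity), smul_eq_mul,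
      show s + r - 1 = s - 1 + r by ring, Real.rpow_add hx]
    ring
  constructor
  · unfold gam
    rw [integrable_withDensity_iff_integrable_smul' (by fun_prop) (by simp)]
    exact (integrableOn_congr_fun e measurableSet_Ioi).2 (Real.GammaIntegral_convergent hr)
  · unfold gam
    rw [integral_withDensity_eq_integral_toReal_smul (by fun_prop) (by simp),
      setIntegral_congr_fun measurableSet_Ioi e, Real.Gamma_eq_integral hr]

theorem hasInt_gam {s : ℝ} (hs : 0 < s) (j : ℕ) :
    HasInt (gam s) (fun x => x ^ j) (Real.Gamma s * rising s j) := by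
  rw [← Gamma_add_nat hs]
  simpa using hasInt_gam_rpow (s := s) (r := j) (by positivity)

variable (𝕜) in
/-- The total mass of `gau`. -/
noncomputable def gauMass : ℝ := ∫ z : 𝕜, Real.exp (-‖z‖ ^ 2) ∂Measure.addHaar

/-- Radial integration in a real space of dimension β reduces this to a Gamma integral, for both
fields at once. The ball volume in the constant later disappears into `gauMass`. -/
theorem hasInt_haar (j : ℕ) : HasInt (Measure.addHaar : Measure 𝕜)
    (fun z => Real.exp (-‖z‖ ^ 2) * (‖z‖ ^ 2) ^ j)
    (finrank ℝ 𝕜 * (Measure.addHaar : Measure 𝕜).real (Metric.ball 0 1) *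
      (1 / 2 * Real.Gamma (finrank ℝ 𝕜 / 2 + j))) := by
  have hβ : 0 < finrank ℝ 𝕜 := finrank_pos
  have hβ' : (1 : ℝ) ≤ finrank ℝ 𝕜 := by exact_mod_cast hβ
  have e : ∀ y ∈ Set.Ioi (0 : ℝ), y ^ (finrank ℝ 𝕜 - 1) • (Real.exp (-y ^ 2) * (y ^ 2) ^ j)
      = y ^ ((finrank ℝ 𝕜 : ℝ) - 1 + 2 * j) * Real.exp (-y ^ (2 : ℝ)) := by
    intro y hy
    have hy : 0 < y := hy
    rw [Real.rpow_add hy, ← Nat.cast_pred hβ, Real.rpow_natCast,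
      show (2 * j : ℝ) = ((2 * j : ℕ) : ℝ) by push_cast; ring, Real.rpow_natCast,
      Real.rpow_two, pow_mul, smul_eq_mul]
    ring
  have hq : (-1 : ℝ) < (finrank ℝ 𝕜 : ℝ) - 1 + 2 * j := by
    have : (0 : ℝ) ≤ j := by positivity
    linarith
  constructor
  · rw [integrable_fun_norm_addHaar Measure.addHaar (f := fun y => Real.exp (-y ^ 2) * (y ^ 2) ^ j)]
    exact (integrableOn_congr_fun e measurableSet_Ioi).2
      (integrableOn_rpow_mul_exp_neg_rpow hq (by norm_num))
  · rw [integral_fun_norm_addHaar _ (fun y => Real.exp (-y ^ 2) * (y ^ 2) ^ j),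
      setIntegral_congr_fun measurableSet_Ioi e, integral_rpow_mul_exp_neg_rpow (by norm_num) hq]
    simp only [nsmul_eq_mul, smul_eq_mul]
    rw [← mul_assoc]
    congr 3
    ring

theorem gauMass_eq : gauMass 𝕜 = finrank ℝ 𝕜 * (Measure.addHaar : Measure 𝕜).real
    (Metric.ball 0 1) * (1 / 2 * Real.Gamma (finrank ℝ 𝕜 / 2)) := by
  have := (hasInt_haar (𝕜 := 𝕜) 0).2
  simpa [gauMass] using this

theorem gauMass_pos : 0 < gauMass 𝕜 := by
  have hβ : 0 < finrank ℝ 𝕜 := finrank_pos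
  have : 0 < (Measure.addHaar : Measure 𝕜).real (Metric.ball 0 1) :=
    ENNReal.toReal_pos (Metric.measure_ball_pos _ _ one_pos).ne' Metric.isBounded_ball.measure_lt_top.ne
  rw [gauMass_eq]
  positivity

theorem hasInt_gau_iff {f : 𝕜 → ℝ} {v : ℝ} : HasInt (gau 𝕜) f v ↔
    HasInt Measure.addHaar (fun z => Real.exp (-‖z‖ ^ 2) * f z) v := by
  have e : ∀ z : 𝕜, (ENNReal.ofReal (Real.exp (-‖z‖ ^ 2))).toReal • f z
      = Real.exp (-‖z‖ ^ 2) * f z := fun z => by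
    rw [ENNReal.toReal_ofReal (by positivity), smul_eq_mul]
  unfold HasInt gau
  rw [integrable_withDensity_iff_integrable_smul' (by fun_prop) (by simp),
    integral_withDensity_eq_integral_toReal_smul (by fun_prop) (by simp)]
  simp only [e]

theorem hasInt_gau (j : ℕ) : HasInt (gau 𝕜) (fun z => (‖z‖ ^ 2) ^ j)
    (gauMass 𝕜 * rising (finrank ℝ 𝕜 / 2) j) := by
  have hβ : 0 < finrank ℝ 𝕜 := finrank_pos
  rw [hasInt_gau_iff]
  convert hasInt_haar (𝕜 := 𝕜) j using 1
  rw [gauMass_eq, Gamma_add_nat (by positivity)]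
  ring

theorem hasInt_chi_prod {κ : ℝ} {f₁ f₂ f₃ : ℝ → ℝ} {g₁ g₂ g₃ : 𝕜 → ℝ} {v₁ v₂ v₃ w₁ w₂ w₃ : ℝ}
    (h₁ : HasInt (gam (κ + 1 + finrank ℝ 𝕜)) f₁ v₁)
    (h₂ : HasInt (gam (κ + 1 + finrank ℝ 𝕜 / 2)) f₂ v₂) (h₃ : HasInt (gam (κ + 1)) f₃ v₃)
    (k₁ : HasInt (gau 𝕜) g₁ w₁) (k₂ : HasInt (gau 𝕜) g₂ w₂) (k₃ : HasInt (gau 𝕜) g₃ w₃) :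
    HasInt (chi 𝕜 κ) (fun p => f₁ p.1 * (g₁ p.2.1 * (g₂ p.2.2.1 * (f₂ p.2.2.2.1 *
      (g₃ p.2.2.2.2.1 * f₃ p.2.2.2.2.2))))) (v₁ * (w₁ * (w₂ * (v₂ * (w₃ * v₃))))) :=
  h₁.mul_prod (k₁.mul_prod (k₂.mul_prod (h₂.mul_prod (k₃.mul_prod h₃))))

variable (𝕜) in
/-- The total mass of `chi`. -/
noncomputable def chiMass (κ : ℝ) : ℝ :=
  Real.Gamma (κ + 1 + finrank ℝ 𝕜) * Real.Gamma (κ + 1 + finrank ℝ 𝕜 / 2) * Real.Gamma (κ + 1)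
    * gauMass 𝕜 ^ 3

theorem chiMass_pos {κ : ℝ} (hκ : -1 < κ) : 0 < chiMass 𝕜 κ := by
  have h : 0 < κ + 1 := by linarith
  have := gauMass_pos (𝕜 := 𝕜)
  unfold chiMass
  have h1 : 0 < Real.Gamma (κ + 1 + finrank ℝ 𝕜) := Real.Gamma_pos_of_pos (by positivity)
  have h2 : 0 < Real.Gamma (κ + 1 + finrank ℝ 𝕜 / 2) := Real.Gamma_pos_of_pos (by positivity)
  have h3 := Real.Gamma_pos_of_pos h
  positivity

/-- Monomials in the squared diagonal and the squared absolute values of the lower entries. -/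
def chiMono (t : ℕ × ℕ × ℕ × ℕ × ℕ × ℕ) (p : HermCoord 𝕜) : ℝ :=
  p.1 ^ t.1 * ((‖p.2.1‖ ^ 2) ^ t.2.1 * ((‖p.2.2.1‖ ^ 2) ^ t.2.2.1 * (p.2.2.2.1 ^ t.2.2.2.1 *
    ((‖p.2.2.2.2.1‖ ^ 2) ^ t.2.2.2.2.1 * p.2.2.2.2.2 ^ t.2.2.2.2.2))))

variable (𝕜) in
/-- The normalised moment of `chiMono t`. -/
noncomputable def chiVal (κ : ℝ) (t : ℕ × ℕ × ℕ × ℕ × ℕ × ℕ) : ℝ :=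
  rising (κ + 1 + finrank ℝ 𝕜) t.1 * rising (finrank ℝ 𝕜 / 2) t.2.1 *
    rising (finrank ℝ 𝕜 / 2) t.2.2.1 * rising (κ + 1 + finrank ℝ 𝕜 / 2) t.2.2.2.1 *
    rising (finrank ℝ 𝕜 / 2) t.2.2.2.2.1 * rising (κ + 1) t.2.2.2.2.2

theorem hasInt_chiMono {κ : ℝ} (hκ : -1 < κ) (t : ℕ × ℕ × ℕ × ℕ × ℕ × ℕ) :
    HasInt (chi 𝕜 κ) (chiMono t) (chiMass 𝕜 κ * chiVal 𝕜 κ t) := by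
  have h : 0 < κ + 1 := by linarith
  have := hasInt_chi_prod (𝕜 := 𝕜) (κ := κ) (hasInt_gam (by positivity) t.1)
    (hasInt_gam (by positivity) t.2.2.2.1) (hasInt_gam h t.2.2.2.2.2)
    (hasInt_gau t.2.1) (hasInt_gau t.2.2.1) (hasInt_gau t.2.2.2.2.1)
  refine this.congr (fun p => rfl) ?_
  unfold chiMass chiVal
  ring

/-- Polynomials in the squared diagonal and the squared absolute values of the lower entries. -/
theorem hasInt_chi_list {κ : ℝ} (hκ : -1 < κ) (l : List (ℝ × ℕ × ℕ × ℕ × ℕ × ℕ × ℕ)) :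
    HasInt (chi 𝕜 κ) (fun p => (l.map fun t => t.1 * chiMono t.2 p).sum)
      (chiMass 𝕜 κ * (l.map fun t => t.1 * chiVal 𝕜 κ t.2).sum) := by
  refine (HasInt.listSum l fun t _ => (hasInt_chiMono hκ t.2).const_mul t.1).congr
    (fun _ => rfl) ?_
  rw [← List.sum_map_mul_left]
  congr 1
  refine List.map_congr_left fun t _ => ?_
  ring

end Moments

open Matrix Module
open scoped ENNReal

/-! ### Unitary invariance of Wishart measures -/

section Invariance

variable {𝕜 : Type*} [RCLike 𝕜]

/-- `hmat` as a linear map. -/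
def hmatLin : HermCoord 𝕜 →ₗ[ℝ] Matrix (Fin 3) (Fin 3) 𝕜 where
  toFun := hmat
  map_add' p q := by
    ext i j
    fin_cases i <;> fin_cases j <;> simp [hmat, RCLike.algebraMap_eq_ofReal]
  map_smul' r p := by
    ext i j
    fin_cases i <;> fin_cases j <;>
      simp [hmat, RCLike.real_smul_eq_coe_mul, RCLike.algebraMap_eq_ofReal]

/-- The coordinates of a Hermitian matrix. -/
def coordLin : Matrix (Fin 3) (Fin 3) 𝕜 →ₗ[ℝ] HermCoord 𝕜 where
  toFun M := (RCLike.re (M 0 0), M 1 0, M 2 0, RCLike.re (M 1 1), M 2 1, RCLike.re (M 2 2))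
  map_add' M N := by simp
  map_smul' r M := by simp [RCLike.smul_re]

theorem coordLin_hmat (p : HermCoord 𝕜) : coordLin (hmat p) = p := by
  simp [coordLin, hmat]

theorem hmat_coordLin {M : Matrix (Fin 3) (Fin 3) 𝕜} (hM : M.IsHermitian) :
    hmat (coordLin M) = M := by
  have h := fun i j => congrFun (congrFun hM i) j
  simp only [conjTranspose_apply] at h
  have hd : ∀ i, ((RCLike.re (M i i) : ℝ) : 𝕜) = M i i := fun i =>
    RCLike.conj_eq_iff_re.1 (h i i)
  ext i j
  fin_cases i <;> fin_cases j <;> simp [hmat, coordLin, hd] <;> exact h _ _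

/-- The action of a matrix on Hermitian matrices by conjugation. -/
noncomputable def conjCoord (U : Matrix (Fin 3) (Fin 3) 𝕜) : HermCoord 𝕜 →ₗ[ℝ] HermCoord 𝕜 :=
  coordLin ∘ₗ ((LinearMap.mulLeft ℝ U) ∘ₗ (LinearMap.mulRight ℝ Uᴴ)) ∘ₗ hmatLin

theorem hmat_conjCoord (U : Matrix (Fin 3) (Fin 3) 𝕜) (p : HermCoord 𝕜) :
    hmat (conjCoord U p) = U * hmat p * Uᴴ := by
  have : (U * hmat p * Uᴴ).IsHermitian := isHermitian_mul_mul_conjTranspose _ (hmat_isHermitian p)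
  rw [← hmat_coordLin this]
  simp [conjCoord, hmatLin, mul_assoc]

theorem hmat_injective : Function.Injective (hmat (𝕜 := 𝕜)) :=
  Function.LeftInverse.injective coordLin_hmat

theorem conjCoord_conjCoord {U V : Matrix (Fin 3) (Fin 3) 𝕜} (h : U * V = 1) (p : HermCoord 𝕜) :
    conjCoord U (conjCoord V p) = p := by
  apply hmat_injective
  rw [hmat_conjCoord, hmat_conjCoord]
  calc U * (V * hmat p * Vᴴ) * Uᴴ = (U * V) * hmat p * (U * V)ᴴ := by
        simp [conjTranspose_mul, mul_assoc]
    _ = hmat p := by simp [h]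

/-- A linear automorphism preserving an integrable nonzero density preserves Haar measure. -/
theorem map_haar_eq_of_comp_eq {E : Type*} [NormedAddCommGroup E] [NormedSpace ℝ E]
    [FiniteDimensional ℝ E] [MeasurableSpace E] [BorelSpace E] (μ : Measure E)
    [μ.IsAddHaarMeasure] (T : E →ₗ[ℝ] E) (hT : LinearMap.det T ≠ 0) {w : E → ℝ≥0∞}
    (hw : Measurable w) (hTw : ∀ x, w (T x) = w x) (h0 : ∫⁻ x, w x ∂μ ≠ 0)
    (h1 : ∫⁻ x, w x ∂μ ≠ ⊤) : μ.map T = μ := by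
  have hTm : Measurable T := (LinearMap.continuous_of_finiteDimensional T).measurable
  have hmap := Measure.map_linearMap_addHaar_eq_smul_addHaar μ hT
  have h2 := lintegral_map (μ := μ) hw hTm
  rw [hmap, lintegral_smul_measure] at h2
  simp only [hTw] at h2
  -- The transformation multiplies the integral of w by the Haar scaling factor, yet invariance of w
  -- leaves that integral unchanged. As it is finite and nonzero, the factor is 1.
  rw [hmap, (ENNReal.mul_eq_right h0 h1).1 h2, one_smul]

theorem map_withDensity_of_comp_eq {E : Type*} [MeasurableSpace E] {μ : Measure E} {T : E → E}
    (hTm : Measurable T) (hT : μ.map T = μ) {w : E → ℝ≥0∞} (hw : Measurable w)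
    (hTw : ∀ x, w (T x) = w x) : (μ.withDensity w).map T = μ.withDensity w := by
  refine Measure.ext_of_lintegral _ fun F hF => ?_
  rw [lintegral_map hF hTm, lintegral_withDensity_eq_lintegral_mul _ hw (g := fun x => F (T x))
    (hF.comp hTm), lintegral_withDensity_eq_lintegral_mul _ hw hF]
  conv_rhs => rw [← hT]
  rw [lintegral_map (hw.mul hF) hTm]
  simp [hTw]

instance : (hermVol 𝕜).IsAddHaarMeasure := by
  have h1 : ((Measure.addHaar : Measure 𝕜).prod (volume : Measure ℝ)).IsAddHaarMeasure :=
    Measure.prod.instIsAddHaarMeasure _ _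
  have h2 : ((volume : Measure ℝ).prod ((Measure.addHaar : Measure 𝕜).prod
    (volume : Measure ℝ))).IsAddHaarMeasure :=
    Measure.prod.instIsAddHaarMeasure _ _
  have h3 : ((Measure.addHaar : Measure 𝕜).prod ((volume : Measure ℝ).prod
    ((Measure.addHaar : Measure 𝕜).prod (volume : Measure ℝ)))).IsAddHaarMeasure :=
    Measure.prod.instIsAddHaarMeasure _ _
  have h4 : ((Measure.addHaar : Measure 𝕜).prod ((Measure.addHaar : Measure 𝕜).prod
    ((volume : Measure ℝ).prod ((Measure.addHaar : Measure 𝕜).prod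
    (volume : Measure ℝ))))).IsAddHaarMeasure :=
    Measure.prod.instIsAddHaarMeasure _ _
  exact Measure.prod.instIsAddHaarMeasure _ _

theorem isUnit_of_mem_unitary {U : Matrix (Fin 3) (Fin 3) 𝕜} (hU : Uᴴ * U = 1) : IsUnit U :=
  IsUnit.of_mul_eq_one_right _ hU

theorem lintegral_one_wish {κ : ℝ} (hκ : -1 < κ) :
    ∫⁻ _, 1 ∂wish 𝕜 κ = ENNReal.ofReal (chiMass 𝕜 κ) := by
  rw [← map_cholCoord_chi, lintegral_map measurable_const measurable_cholCoord]
  have h := hasInt_chiMono (𝕜 := 𝕜) hκ 0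
  have e : chiMono (𝕜 := 𝕜) 0 = fun _ => 1 := by
    funext p
    simp [chiMono]
  have e2 : chiVal 𝕜 κ 0 = 1 := by simp [chiVal, rising]
  rw [e, e2, mul_one] at h
  have := ofReal_integral_eq_lintegral_ofReal h.1 (by simp [Filter.EventuallyLE])
  rw [h.2] at this
  simpa using this.symm

/-- The density depends only on trace, determinant and positive definiteness, all invariant under
unitary conjugation. Since its total mass is finite and positive, Haar measure is preserved as well,
with no need to compute the determinant of the conjugation. -/
theorem map_conjCoord_wish {κ : ℝ} (hκ : -1 < κ) {U : Matrix (Fin 3) (Fin 3) 𝕜}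
    (hU : Uᴴ * U = 1) : (wish 𝕜 κ).map (conjCoord U) = wish 𝕜 κ := by
  have hU' : U * Uᴴ = 1 := mul_eq_one_comm.1 hU
  have hS : MeasurableSet {p : HermCoord 𝕜 | (hmat p).PosDef} :=
    measurableSet_posDef continuous_hmat
  have hm : Measurable fun p : HermCoord 𝕜 =>
      ENNReal.ofReal (Real.exp (-RCLike.re (hmat p).trace) * RCLike.re (hmat p).det ^ κ) :=
    ((Real.measurable_exp.comp measurable_re_trace_hmat.neg).mul
      (measurable_re_det_hmat.pow_const κ)).ennreal_ofReal
  have hmass := lintegral_one_wish (𝕜 := 𝕜) hκ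
  rw [wish, lintegral_withDensity_eq_lintegral_mul _ (hm.indicator hS) measurable_const] at hmass
  simp only [Pi.mul_apply, mul_one] at hmass
  have hinv : ∀ p, ({p : HermCoord 𝕜 | (hmat p).PosDef}.indicator fun p => ENNReal.ofReal
      (Real.exp (-RCLike.re (hmat p).trace) * RCLike.re (hmat p).det ^ κ)) (conjCoord U p)
      = ({p : HermCoord 𝕜 | (hmat p).PosDef}.indicator fun p => ENNReal.ofReal
      (Real.exp (-RCLike.re (hmat p).trace) * RCLike.re (hmat p).det ^ κ)) p := by
    intro p
    have h1 : (hmat (conjCoord U p)).trace = (hmat p).trace := by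
      rw [hmat_conjCoord, trace_mul_comm, ← mul_assoc, hU, one_mul]
    have h2 : (hmat (conjCoord U p)).det = (hmat p).det := by
      rw [hmat_conjCoord, det_mul_comm, ← mul_assoc, hU, one_mul]
    have h3 : conjCoord U p ∈ {p : HermCoord 𝕜 | (hmat p).PosDef}
        ↔ p ∈ {p : HermCoord 𝕜 | (hmat p).PosDef} := by
      simp only [Set.mem_ofPred_eq, hmat_conjCoord]
      exact (isUnit_of_mem_unitary hU).posDef_star_right_conjugate_iff
    by_cases hp : p ∈ {p : HermCoord 𝕜 | (hmat p).PosDef}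
    · rw [Set.indicator_of_mem hp, Set.indicator_of_mem (h3.2 hp), h1, h2]
    · rw [Set.indicator_of_notMem hp, Set.indicator_of_notMem (mt h3.1 hp)]
  refine map_withDensity_of_comp_eq (LinearMap.continuous_of_finiteDimensional _).measurable
    (map_haar_eq_of_comp_eq _ _ ?_ (hm.indicator hS) hinv ?_ ?_) (hm.indicator hS) hinv
  · have : conjCoord U ∘ₗ conjCoord Uᴴ = LinearMap.id :=
      LinearMap.ext fun p => conjCoord_conjCoord hU' p
    have h := congrArg LinearMap.det this
    rw [LinearMap.det_comp, LinearMap.det_id] at h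
    exact left_ne_zero_of_mul_eq_one h
  · rw [hmass]
    simpa using chiMass_pos hκ
  · rw [hmass]
    exact ENNReal.ofReal_ne_top

theorem hasInt_wish_conj {κ : ℝ} (hκ : -1 < κ) {U : Matrix (Fin 3) (Fin 3) 𝕜}
    (hU : Uᴴ * U = 1) {f : Matrix (Fin 3) (Fin 3) 𝕜 → ℝ} (hf : Continuous f) {v : ℝ} :
    HasInt (wish 𝕜 κ) (fun p => f (U * hmat p * Uᴴ)) v
      ↔ HasInt (wish 𝕜 κ) (fun p => f (hmat p)) v := by
  conv_rhs => rw [← map_conjCoord_wish hκ hU]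
  rw [hasInt_map (f := fun p => f (hmat p))
    (LinearMap.continuous_of_finiteDimensional _).measurable (hf.comp continuous_hmat).measurable]
  simp only [hmat_conjCoord]

theorem ae_chi_pos (κ : ℝ) :
    ∀ᵐ p ∂chi 𝕜 κ, 0 < p.1 ∧ 0 < p.2.2.2.1 ∧ 0 < p.2.2.2.2.2 := by
  have hg : ∀ s, ∀ᵐ x ∂gam s, 0 < x := fun s =>
    (withDensity_absolutelyContinuous _ _).ae_le (ae_restrict_mem measurableSet_Ioi)
  unfold chi
  have h1 := Measure.quasiMeasurePreserving_fst
    (μ := gam (κ + 1 + finrank ℝ 𝕜)) (ν := ((gau 𝕜).prod ((gau 𝕜).prod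
    ((gam (κ + 1 + finrank ℝ 𝕜 / 2)).prod ((gau 𝕜).prod (gam (κ + 1))))))) |>.ae (hg _)
  have hs1 := Measure.quasiMeasurePreserving_snd
    (μ := gam (κ + 1 + finrank ℝ 𝕜)) (ν := ((gau 𝕜).prod ((gau 𝕜).prod
    ((gam (κ + 1 + finrank ℝ 𝕜 / 2)).prod ((gau 𝕜).prod (gam (κ + 1)))))))
  have hs2 := Measure.quasiMeasurePreserving_snd
    (μ := gau 𝕜) (ν := ((gau 𝕜).prod
    ((gam (κ + 1 + finrank ℝ 𝕜 / 2)).prod ((gau 𝕜).prod (gam (κ + 1))))))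
  have hs3 := Measure.quasiMeasurePreserving_snd
    (μ := gau 𝕜) (ν := ((gam (κ + 1 + finrank ℝ 𝕜 / 2)).prod ((gau 𝕜).prod (gam (κ + 1)))))
  have hs4 := Measure.quasiMeasurePreserving_snd
    (μ := gam (κ + 1 + finrank ℝ 𝕜 / 2)) (ν := (gau 𝕜).prod (gam (κ + 1)))
  have h2 := Measure.quasiMeasurePreserving_fst
    (μ := gam (κ + 1 + finrank ℝ 𝕜 / 2)) (ν := (gau 𝕜).prod (gam (κ + 1))) |>.ae (hg _)
  have h3 := Measure.quasiMeasurePreserving_snd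
    (μ := gau 𝕜) (ν := gam (κ + 1)) |>.ae (hg _)
  filter_upwards [h1, hs1.ae (hs2.ae (hs3.ae h2)), hs1.ae (hs2.ae (hs3.ae (hs4.ae h3)))]
    with p a b c using ⟨a, b, c⟩

theorem hasInt_wish_of_chi {κ : ℝ} {f : Matrix (Fin 3) (Fin 3) 𝕜 → ℝ} (hf : Continuous f)
    {g : HermCoord 𝕜 → ℝ} {v : ℝ} (hg : HasInt (chi 𝕜 κ) g v)
    (h : ∀ p : HermCoord 𝕜, 0 < p.1 → 0 < p.2.2.2.1 → 0 < p.2.2.2.2.2 →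
      g p = f (hmat (cholCoord p))) : HasInt (wish 𝕜 κ) (fun p => f (hmat p)) v := by
  rw [← map_cholCoord_chi, hasInt_map (f := fun p => f (hmat p)) measurable_cholCoord
    (hf.comp continuous_hmat).measurable]
  refine hg.congr_ae ?_
  filter_upwards [ae_chi_pos κ] with p hp using h p hp.1 hp.2.1 hp.2.2

end Invariance

open Matrix Module
open scoped ENNReal

/-! ### Mixed invariants of two Hermitian matrices and their Wishart averages -/

section ClassMoments

variable {𝕜 : Type*} [RCLike 𝕜]

/-- The real part of a diagonal entry. -/
def dg (M : Matrix (Fin 3) (Fin 3) 𝕜) (i : Fin 3) : ℝ := RCLike.re (M i i)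

/-- The real part of a diagonal entry of the adjugate. -/
noncomputable def ad (M : Matrix (Fin 3) (Fin 3) 𝕜) (i : Fin 3) : ℝ := RCLike.re (M.adjugate i i)

/-- The real part of the determinant. -/
noncomputable def rdet {n : Type*} [Fintype n] [DecidableEq n] (M : Matrix n n 𝕜) : ℝ :=
  RCLike.re M.det

theorem continuous_dg : Continuous (dg (𝕜 := 𝕜)) :=
  continuous_pi fun _ => RCLike.continuous_re.comp (by fun_prop)

theorem continuous_ad : Continuous (ad (𝕜 := 𝕜)) :=
  continuous_pi fun i => RCLike.continuous_re.comp
    ((continuous_id.matrix_adjugate).matrix_elem i i)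

theorem continuous_rdet {n : Type*} [Fintype n] [DecidableEq n] :
    Continuous (rdet (𝕜 := 𝕜) (n := n)) :=
  RCLike.continuous_re.comp continuous_id.matrix_det

/-- Permutation matrices are unitary, and conjugation by them permutes the diagonals of A and adj A
simultaneously. Moments therefore need to be computed only for one representative of each orbit of
indices. -/
theorem hasInt_wish_perm {κ : ℝ} (hκ : -1 < κ) (σ : Equiv.Perm (Fin 3))
    {f : (Fin 3 → ℝ) → (Fin 3 → ℝ) → ℝ → ℝ} (hf : Continuous fun q : (Fin 3 → ℝ) × (Fin 3 → ℝ) × ℝ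
      => f q.1 q.2.1 q.2.2) {v : ℝ}
    (h : HasInt (wish 𝕜 κ) (fun p => f (dg (hmat p)) (ad (hmat p)) (rdet (hmat p))) v) :
    HasInt (wish 𝕜 κ) (fun p => f (dg (hmat p) ∘ σ) (ad (hmat p) ∘ σ) (rdet (hmat p))) v := by
  set U : Matrix (Fin 3) (Fin 3) 𝕜 := (1 : Matrix (Fin 3) (Fin 3) 𝕜).submatrix σ id with hUdef
  have hconj : ∀ M : Matrix (Fin 3) (Fin 3) 𝕜, U * M * Uᴴ = M.submatrix σ σ := by
    intro M
    ext i j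
    simp [hUdef, mul_apply, one_apply]
  have hU : Uᴴ * U = 1 := by
    rw [mul_eq_one_comm]
    have := hconj 1
    rw [mul_one] at this
    rw [this]
    exact submatrix_one_equiv σ
  have hc : Continuous fun M : Matrix (Fin 3) (Fin 3) 𝕜 => f (dg M) (ad M) (rdet M) :=
    hf.comp (continuous_dg.prodMk (continuous_ad.prodMk continuous_rdet))
  have h2 := (hasInt_wish_conj hκ hU hc).2 h
  refine h2.congr (fun p => ?_) rfl
  rw [hconj]
  have e1 : dg ((hmat p).submatrix σ σ) = dg (hmat p) ∘ σ := rfl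
  have e2 : ad ((hmat p).submatrix σ σ) = ad (hmat p) ∘ σ := by
    funext i
    rw [ad, adjugate_submatrix_equiv_self]
    rfl
  have e3 : rdet ((hmat p).submatrix σ σ) = rdet (hmat p) := by
    rw [rdet, det_submatrix_equiv_self, rdet]
  rw [e1, e2, e3]

theorem dg_chol (p : HermCoord 𝕜) : dg (hmat (cholCoord p)) 0 = p.1 ∧
    dg (hmat (cholCoord p)) 1 = p.2.2.2.1 + ‖p.2.1‖ ^ 2 ∧
    dg (hmat (cholCoord p)) 2 = p.2.2.2.2.2 + (‖p.2.2.1‖ ^ 2 + ‖p.2.2.2.2.1‖ ^ 2) := by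
  refine ⟨?_, ?_, ?_⟩ <;> simp [dg, hmat, cholCoord]

/-- This is the leading 2×2 minor. It and `ad_one_chol` involve only pivots and squared absolute
values, so orbit representatives are chosen with adjugate indices 2 and 1 where possible. -/
theorem ad_two_chol {p : HermCoord 𝕜} (h1 : 0 < p.1) :
    ad (hmat (cholCoord p)) 2 = p.1 * p.2.2.2.1 := by
  have e1 : ((√p.1 : ℝ) : 𝕜) * ((√p.1 : ℝ) : 𝕜) = p.1 := by
    rw [← RCLike.ofReal_mul, Real.mul_self_sqrt h1.le]
  have : (hmat (cholCoord p)).adjugate 2 2 = ((p.1 * p.2.2.2.1 : ℝ) : 𝕜) := by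
    rw [adjugate_fin_three]
    simp only [hmat, cholCoord, RCLike.real_smul_eq_coe_mul]
    simp [← RCLike.mul_conj, RCLike.algebraMap_eq_ofReal]
    linear_combination (-(p.2.1 * (starRingEnd 𝕜) p.2.1)) * e1
  rw [ad, this, RCLike.ofReal_re]

theorem ad_one_chol {p : HermCoord 𝕜} (h1 : 0 < p.1) :
    ad (hmat (cholCoord p)) 1 = p.1 * (p.2.2.2.2.2 + ‖p.2.2.2.2.1‖ ^ 2) := by
  have e1 : ((√p.1 : ℝ) : 𝕜) * ((√p.1 : ℝ) : 𝕜) = p.1 := by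
    rw [← RCLike.ofReal_mul, Real.mul_self_sqrt h1.le]
  have : (hmat (cholCoord p)).adjugate 1 1
      = ((p.1 * (p.2.2.2.2.2 + ‖p.2.2.2.2.1‖ ^ 2) : ℝ) : 𝕜) := by
    rw [adjugate_fin_three]
    simp only [hmat, cholCoord, RCLike.real_smul_eq_coe_mul]
    simp [← RCLike.mul_conj, RCLike.algebraMap_eq_ofReal]
    linear_combination (-(p.2.2.1 * (starRingEnd 𝕜) p.2.2.1)) * e1
  rw [ad, this, RCLike.ofReal_re]

theorem rdet_chol {p : HermCoord 𝕜} (h1 : 0 < p.1) (h2 : 0 < p.2.2.2.1) :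
    rdet (hmat (cholCoord p)) = p.1 * p.2.2.2.1 * p.2.2.2.2.2 := by
  rw [rdet, det_hmat_cholCoord h1.le h2.le, RCLike.ofReal_re]

theorem hasInt_wish_list {κ : ℝ} (hκ : -1 < κ) {f : Matrix (Fin 3) (Fin 3) 𝕜 → ℝ}
    (hf : Continuous f) (l : List (ℝ × ℕ × ℕ × ℕ × ℕ × ℕ × ℕ))
    (h : ∀ p : HermCoord 𝕜, 0 < p.1 → 0 < p.2.2.2.1 → 0 < p.2.2.2.2.2 →
      f (hmat (cholCoord p)) = (l.map fun t => t.1 * chiMono t.2 p).sum) :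
    HasInt (wish 𝕜 κ) (fun p => f (hmat p))
      (chiMass 𝕜 κ * (l.map fun t => t.1 * chiVal 𝕜 κ t.2).sum) :=
  hasInt_wish_of_chi hf (hasInt_chi_list hκ l) fun p a b c => (h p a b c).symm

variable (𝕜) in
/-- The normalised moment of `det ^ e`. -/
noncomputable def detVal (κ : ℝ) (e : ℕ) : ℝ := chiVal 𝕜 κ (e, 0, 0, e, 0, e)

variable (𝕜) in
/-- The normalised moment of `A i i * (adj A) j j * det A ^ e`. -/
noncomputable def pairVal (κ : ℝ) (e : ℕ) (i j : Fin 3) : ℝ :=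
  if i = j then chiVal 𝕜 κ (e + 1, 0, 0, e + 1, 0, e + 1) + chiVal 𝕜 κ (e + 1, 0, 1, e + 1, 0, e)
    + chiVal 𝕜 κ (e + 1, 0, 0, e + 1, 1, e)
  else chiVal 𝕜 κ (e + 2, 0, 0, e + 1, 0, e)

theorem hasInt_wish_det {κ : ℝ} (hκ : -1 < κ) (e : ℕ) :
    HasInt (wish 𝕜 κ) (fun p => rdet (hmat p) ^ e) (chiMass 𝕜 κ * detVal 𝕜 κ e) := by
  refine (hasInt_wish_list hκ (f := fun M => rdet M ^ e) (continuous_rdet.pow e)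
    [(1, e, 0, 0, e, 0, e)] fun p h1 h2 h3 => ?_).congr (fun _ => rfl) (by simp [detVal])
  simp [rdet_chol h1 h2, chiMono]
  ring

theorem exists_perm_pair (i j : Fin 3) : ∃ σ : Equiv.Perm (Fin 3),
    (i = j ∧ σ 2 = i) ∨ (i ≠ j ∧ σ 0 = i ∧ σ 2 = j) := by
  revert i j; decide

/-- Index pairs have two orbits, represented by (2, 2) and (0, 2); for both, the integrand is a
polynomial in the pivots and squared absolute values. -/
theorem hasInt_wish_pair {κ : ℝ} (hκ : -1 < κ) (e : ℕ) (i j : Fin 3) :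
    HasInt (wish 𝕜 κ) (fun p => dg (hmat p) i * ad (hmat p) j * rdet (hmat p) ^ e)
      (chiMass 𝕜 κ * pairVal 𝕜 κ e i j) := by
  obtain ⟨σ, ⟨rfl, rfl⟩ | ⟨hij, rfl, rfl⟩⟩ := exists_perm_pair i j
  · refine hasInt_wish_perm hκ σ (f := fun d a t => d 2 * a 2 * t ^ e) (by fun_prop) ?_
    refine (hasInt_wish_list hκ (f := fun M => dg M 2 * ad M 2 * rdet M ^ e)
      (((continuous_apply 2).comp continuous_dg).mul ((continuous_apply 2).comp continuous_ad)
        |>.mul (continuous_rdet.pow e))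
      [(1, e + 1, 0, 0, e + 1, 0, e + 1), (1, e + 1, 0, 1, e + 1, 0, e),
        (1, e + 1, 0, 0, e + 1, 1, e)] fun p h1 h2 h3 => ?_).congr (fun _ => rfl)
      (by simp [pairVal, add_assoc])
    simp only [rdet_chol h1 h2, ad_two_chol h1, (dg_chol p).2.2, chiMono, List.map_cons,
      List.map_nil, List.sum_cons, List.sum_nil]
    ring
  · refine hasInt_wish_perm hκ σ (f := fun d a t => d 0 * a 2 * t ^ e) (by fun_prop) ?_
    refine (hasInt_wish_list hκ (f := fun M => dg M 0 * ad M 2 * rdet M ^ e)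
      (((continuous_apply 0).comp continuous_dg).mul ((continuous_apply 2).comp continuous_ad)
        |>.mul (continuous_rdet.pow e))
      [(1, e + 2, 0, 0, e + 1, 0, e)] fun p h1 h2 h3 => ?_).congr (fun _ => rfl)
      (by simp [pairVal, hij])
    simp only [rdet_chol h1 h2, ad_two_chol h1, (dg_chol p).1, chiMono, List.map_cons,
      List.map_nil, List.sum_cons, List.sum_nil]
    ring

/-- `tr (adj C * A)`. -/
noncomputable def mixOne (A C : Matrix (Fin 3) (Fin 3) 𝕜) : ℝ := RCLike.re (C.adjugate * A).trace

/-- `tr (adj A * C)`. -/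
noncomputable def mixTwo (A C : Matrix (Fin 3) (Fin 3) 𝕜) : ℝ := RCLike.re (A.adjugate * C).trace

/-- The sum of the principal `2 × 2` minors. -/
noncomputable def etwo (C : Matrix (Fin 3) (Fin 3) 𝕜) : ℝ := RCLike.re C.adjugate.trace

/-- The real part of the trace. -/
def rtr (C : Matrix (Fin 3) (Fin 3) 𝕜) : ℝ := RCLike.re C.trace

theorem adjugate_conj {U M : Matrix (Fin 3) (Fin 3) 𝕜} (hU : Uᴴ * U = 1) :
    (U * M * Uᴴ).adjugate = U * M.adjugate * Uᴴ := by
  have hU' : U * Uᴴ = 1 := mul_eq_one_comm.1 hU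
  have h1 : U.adjugate = U.det • Uᴴ := by
    calc U.adjugate = U.adjugate * (U * Uᴴ) := by rw [hU', mul_one]
      _ = U.det • Uᴴ := by rw [← mul_assoc, adjugate_mul, smul_mul, one_mul]
  have h2 : Uᴴ.adjugate = Uᴴ.det • U := by
    calc Uᴴ.adjugate = Uᴴ.adjugate * (Uᴴ * U) := by rw [hU, mul_one]
      _ = Uᴴ.det • U := by rw [← mul_assoc, adjugate_mul, smul_mul, one_mul]
  have h3 : U.det * Uᴴ.det = 1 := by rw [← det_mul, hU', det_one]
  rw [adjugate_mul_distrib, adjugate_mul_distrib, h1, h2]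
  simp only [Matrix.smul_mul, Matrix.mul_smul, smul_smul, mul_assoc, h3, one_smul]

theorem trace_conj {U M : Matrix (Fin 3) (Fin 3) 𝕜} (hU : Uᴴ * U = 1) :
    (U * M * Uᴴ).trace = M.trace := by
  rw [trace_mul_comm, ← mul_assoc, hU, one_mul]

theorem det_conj {U M : Matrix (Fin 3) (Fin 3) 𝕜} (hU : Uᴴ * U = 1) :
    (U * M * Uᴴ).det = M.det := by
  rw [det_mul_comm, ← mul_assoc, hU, one_mul]

theorem mul_conj {U M N : Matrix (Fin 3) (Fin 3) 𝕜} (hU : Uᴴ * U = 1) :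
    (U * M * Uᴴ) * (U * N * Uᴴ) = U * (M * N) * Uᴴ := by
  calc (U * M * Uᴴ) * (U * N * Uᴴ) = U * M * (Uᴴ * U) * N * Uᴴ := by simp only [mul_assoc]
    _ = _ := by rw [hU]; simp only [mul_one, mul_assoc]

/-- Unitary diagonalisation of a Hermitian matrix, with the elementary symmetric functions of the
eigenvalues. -/
theorem exists_diag {C : Matrix (Fin 3) (Fin 3) 𝕜} (hC : C.IsHermitian) :
    ∃ (U : Matrix (Fin 3) (Fin 3) 𝕜) (c : Fin 3 → ℝ), Uᴴ * U = 1 ∧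
      C = U * diagonal (fun i => (c i : 𝕜)) * Uᴴ := by
  refine ⟨hC.eigenvectorUnitary, hC.eigenvalues, ?_, ?_⟩
  · exact (mem_unitaryGroup_iff'.1 hC.eigenvectorUnitary.2)
  · have := hC.spectral_theorem
    rw [Unitary.conjStarAlgAut_apply] at this
    exact this

theorem symm_diag (c : Fin 3 → ℝ) :
    rtr (diagonal (fun i => (c i : 𝕜))) = c 0 + c 1 + c 2 ∧
    etwo (diagonal (fun i => (c i : 𝕜))) = c 1 * c 2 + c 0 * c 2 + c 0 * c 1 ∧
    rdet (diagonal (fun i => (c i : 𝕜))) = c 0 * c 1 * c 2 := by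
  refine ⟨?_, ?_, ?_⟩
  · simp [rtr, Fin.sum_univ_three]
  · simp only [etwo, adjugate_fin_three, trace_fin_three, diagonal]
    simp
  · simp [rdet, Fin.prod_univ_three]

theorem mix_diag (A : Matrix (Fin 3) (Fin 3) 𝕜) (c : Fin 3 → ℝ) :
    mixOne A (diagonal (fun i => (c i : 𝕜))) =
      (c 1 * c 2) * dg A 0 + (c 0 * c 2) * dg A 1 + (c 0 * c 1) * dg A 2 ∧
    mixTwo A (diagonal (fun i => (c i : 𝕜))) = c 0 * ad A 0 + c 1 * ad A 1 + c 2 * ad A 2 := by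
  constructor
  · simp only [mixOne, adjugate_fin_three, trace_fin_three, diagonal, dg]
    simp [mul_apply, Fin.sum_univ_three, RCLike.mul_re]
  · simp only [mixTwo, trace_fin_three, ad]
    simp [mul_diagonal]
    ring

theorem symm_conj {U M : Matrix (Fin 3) (Fin 3) 𝕜} (hU : Uᴴ * U = 1) :
    rtr (U * M * Uᴴ) = rtr M ∧ etwo (U * M * Uᴴ) = etwo M ∧ rdet (U * M * Uᴴ) = rdet M := by
  simp only [rtr, etwo, rdet, trace_conj hU, adjugate_conj hU, det_conj hU, and_self]

theorem mix_conj {U M N : Matrix (Fin 3) (Fin 3) 𝕜} (hU : Uᴴ * U = 1) :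
    mixOne (U * M * Uᴴ) (U * N * Uᴴ) = mixOne M N ∧
    mixTwo (U * M * Uᴴ) (U * N * Uᴴ) = mixTwo M N := by
  simp only [mixOne, mixTwo, adjugate_conj hU, mul_conj hU, trace_conj hU, and_self]

theorem continuous_mixOne (C : Matrix (Fin 3) (Fin 3) 𝕜) : Continuous fun A => mixOne A C :=
  RCLike.continuous_re.comp (Continuous.matrix_trace (by fun_prop))

theorem continuous_mixTwo (C : Matrix (Fin 3) (Fin 3) 𝕜) : Continuous fun A => mixTwo A C :=
  RCLike.continuous_re.comp (Continuous.matrix_trace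
    (continuous_id.matrix_adjugate.matrix_mul continuous_const))

/-- To integrate a function of the mixed invariants of `A` and `C` over `A` it suffices to do so
for diagonal `C`. -/
theorem hasInt_wish_mix {κ : ℝ} (hκ : -1 < κ) {F : ℝ → ℝ → ℝ → ℝ}
    (hF : Continuous fun q : ℝ × ℝ × ℝ => F q.1 q.2.1 q.2.2) {V : ℝ → ℝ → ℝ → ℝ}
    (h : ∀ c : Fin 3 → ℝ, HasInt (wish 𝕜 κ) (fun p =>
      F ((c 1 * c 2) * dg (hmat p) 0 + (c 0 * c 2) * dg (hmat p) 1 + (c 0 * c 1) * dg (hmat p) 2)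
        (c 0 * ad (hmat p) 0 + c 1 * ad (hmat p) 1 + c 2 * ad (hmat p) 2) (rdet (hmat p)))
      (V (c 0 + c 1 + c 2) (c 1 * c 2 + c 0 * c 2 + c 0 * c 1) (c 0 * c 1 * c 2)))
    {C : Matrix (Fin 3) (Fin 3) 𝕜} (hC : C.IsHermitian) :
    HasInt (wish 𝕜 κ) (fun p => F (mixOne (hmat p) C) (mixTwo (hmat p) C) (rdet (hmat p)))
      (V (rtr C) (etwo C) (rdet C)) := by
  obtain ⟨U, c, hU, rfl⟩ := exists_diag hC
  rw [(symm_conj hU).1, (symm_conj hU).2.1, (symm_conj hU).2.2, (symm_diag c).1,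
    (symm_diag c).2.1, (symm_diag c).2.2]
  have hc : Continuous fun A : Matrix (Fin 3) (Fin 3) 𝕜 =>
      F (mixOne A (U * diagonal (fun i => (c i : 𝕜)) * Uᴴ))
        (mixTwo A (U * diagonal (fun i => (c i : 𝕜)) * Uᴴ)) (rdet A) :=
    hF.comp ((continuous_mixOne _).prodMk ((continuous_mixTwo _).prodMk continuous_rdet))
  -- Conjugating A by U as well removes U from C = U diag(c) Uᴴ, since the mixed invariants are
  -- unchanged by simultaneous conjugation.
  rw [← hasInt_wish_conj hκ hU hc]
  refine (h c).congr (fun p => ?_) rfl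
  rw [(mix_conj hU).1, (mix_conj hU).2, (mix_diag _ c).1, (mix_diag _ c).2, (symm_conj hU).2.2]

/-- For C = diag(c) the product is a sum over pairs (i, j) weighted by (e₃ / cᵢ) cⱼ, read as a
polynomial. The diagonal pairs have total weight 3 e₃ and the others e₁ e₂ - 3 e₃, and the moment
depends only on whether i = j. -/
theorem hasInt_wish_mix_pair {κ : ℝ} (hκ : -1 < κ) (e : ℕ) {C : Matrix (Fin 3) (Fin 3) 𝕜}
    (hC : C.IsHermitian) :
    HasInt (wish 𝕜 κ) (fun p => mixOne (hmat p) C * mixTwo (hmat p) C * rdet (hmat p) ^ e)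
      (chiMass 𝕜 κ * (pairVal 𝕜 κ e 0 0 * (3 * rdet C)
        + pairVal 𝕜 κ e 0 1 * (rtr C * etwo C - 3 * rdet C))) := by
  refine hasInt_wish_mix hκ (F := fun x y z => x * y * z ^ e) (V := fun a b c =>
    chiMass 𝕜 κ * (pairVal 𝕜 κ e 0 0 * (3 * c) + pairVal 𝕜 κ e 0 1 * (a * b - 3 * c)))
    (by fun_prop) (fun c => ?_) hC
  set w : Fin 3 → ℝ := ![c 1 * c 2, c 0 * c 2, c 0 * c 1] with hw
  refine (HasInt.sum Finset.univ fun (ij : Fin 3 × Fin 3) _ =>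
    (hasInt_wish_pair (𝕜 := 𝕜) hκ e ij.1 ij.2).const_mul (w ij.1 * c ij.2)).congr (fun p => ?_) ?_
  · simp only [Fintype.sum_prod_type, Fin.sum_univ_three, hw]
    simp
    ring
  · simp only [Fintype.sum_prod_type, Fin.sum_univ_three, hw, pairVal]
    simp
    ring

/-- For C = 1 the mixed invariants become the trace and the second symmetric function of A alone. -/
theorem hasInt_wish_tr_etwo {κ : ℝ} (hκ : -1 < κ) (e : ℕ) :
    HasInt (wish 𝕜 κ) (fun p => rtr (hmat p) * etwo (hmat p) * rdet (hmat p) ^ e)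
      (chiMass 𝕜 κ * (3 * pairVal 𝕜 κ e 0 0 + 6 * pairVal 𝕜 κ e 0 1)) := by
  refine (hasInt_wish_mix_pair (𝕜 := 𝕜) hκ e isHermitian_one).congr (fun p => ?_) ?_
  · simp [mixOne, mixTwo, rtr, etwo]
  · have h := symm_diag (𝕜 := 𝕜) (fun _ => 1)
    simp only [RCLike.ofReal_one, diagonal_one] at h
    rw [h.1, h.2.1, h.2.2]
    ring

end ClassMoments

open Matrix Module
open scoped ENNReal Kronecker

/-! ### Gaussian matrices and random contractions -/

section Contractions

variable {𝕜 : Type*} [RCLike 𝕜]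

/-- The entries of a `3 × 3` matrix. -/
abbrev Ent (𝕜 : Type*) : Type _ := Fin 3 × Fin 3 → 𝕜

/-- The matrix with the given entries. -/
def vmat (x : Ent 𝕜) : Matrix (Fin 3) (Fin 3) 𝕜 := of fun i j => x (i, j)

/-- The entries of a matrix. -/
def entries (M : Matrix (Fin 3) (Fin 3) 𝕜) : Ent 𝕜 := fun q => M q.1 q.2

variable (𝕜) in
/-- Haar measure on the entries. -/
noncomputable abbrev entVol : Measure (Ent 𝕜) := Measure.pi fun _ => Measure.addHaar

/-- The map `X ↦ M * X * N` on entries. -/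
noncomputable def sandwich (M N : Matrix (Fin 3) (Fin 3) 𝕜) : Ent 𝕜 →ₗ[𝕜] Ent 𝕜 :=
  toLin' (M ⊗ₖ Nᵀ)

theorem vmat_sandwich (M N : Matrix (Fin 3) (Fin 3) 𝕜) (x : Ent 𝕜) :
    vmat (sandwich M N x) = M * vmat x * N := by
  ext i j
  simp only [vmat, sandwich, toLin'_apply, mulVec, dotProduct, of_apply, kroneckerMap_apply,
    Fintype.sum_prod_type, transpose_apply, mul_apply, Finset.sum_mul]
  rw [Finset.sum_comm]
  refine Finset.sum_congr rfl fun a _ => Finset.sum_congr rfl fun b _ => ?_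
  ring

theorem det_sandwich (M N : Matrix (Fin 3) (Fin 3) 𝕜) :
    LinearMap.det (sandwich M N) = M.det ^ 3 * N.det ^ 3 := by
  rw [sandwich, LinearMap.det_toLin', det_kronecker, det_transpose]
  simp

theorem continuous_vmat : Continuous (vmat (𝕜 := 𝕜)) :=
  continuous_matrix fun i j => continuous_apply (i, j)

/-- The squared Hilbert-Schmidt norm. -/
noncomputable def hs (x : Ent 𝕜) : ℝ := ∑ q, ‖x q‖ ^ 2

theorem trace_mul_conjTranspose_vmat (x : Ent 𝕜) :
    (vmat x * (vmat x)ᴴ).trace = ((hs x : ℝ) : 𝕜) := by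
  simp [trace, mul_apply, conjTranspose_apply, vmat, hs, Fintype.sum_prod_type, RCLike.mul_conj]

theorem trace_conjTranspose_mul_vmat (x : Ent 𝕜) :
    ((vmat x)ᴴ * vmat x).trace = ((hs x : ℝ) : 𝕜) := by
  rw [trace_mul_comm, trace_mul_conjTranspose_vmat]

theorem continuous_hs : Continuous (hs (𝕜 := 𝕜)) := by
  unfold hs
  fun_prop

theorem hasInt_entVol {f : Fin 3 × Fin 3 → 𝕜 → ℝ} {v : Fin 3 × Fin 3 → ℝ}
    (h : ∀ q, HasInt Measure.addHaar (f q) (v q)) :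
    HasInt (entVol 𝕜) (fun x => ∏ q, f q (x q)) (∏ q, v q) := by
  constructor
  · exact Integrable.fintype_prod fun q => (h q).1
  · rw [integral_fintype_prod_eq_prod]
    exact Finset.prod_congr rfl fun q _ => (h q).2

variable (𝕜) in
/-- The unnormalised Gaussian distribution on matrices. -/
noncomputable def gauEnt : Measure (Ent 𝕜) :=
  (entVol 𝕜).withDensity fun x => ENNReal.ofReal (Real.exp (-hs x))

theorem hasInt_gauEnt_iff {f : Ent 𝕜 → ℝ} {v : ℝ} : HasInt (gauEnt 𝕜) f v ↔
    HasInt (entVol 𝕜) (fun x => Real.exp (-hs x) * f x) v := by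
  have hm : Measurable fun x : Ent 𝕜 => ENNReal.ofReal (Real.exp (-hs x)) :=
    (Real.measurable_exp.comp continuous_hs.measurable.neg).ennreal_ofReal
  have e : ∀ x : Ent 𝕜, (ENNReal.ofReal (Real.exp (-hs x))).toReal • f x
      = Real.exp (-hs x) * f x := fun z => by
    rw [ENNReal.toReal_ofReal (by positivity), smul_eq_mul]
  unfold HasInt gauEnt
  rw [integrable_withDensity_iff_integrable_smul' hm (by simp),
    integral_withDensity_eq_integral_toReal_smul hm (by simp)]
  simp only [e]

theorem hasInt_gauEnt {f : Fin 3 × Fin 3 → 𝕜 → ℝ} {v : Fin 3 × Fin 3 → ℝ}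
    (h : ∀ q, HasInt (gau 𝕜) (f q) (v q)) :
    HasInt (gauEnt 𝕜) (fun x => ∏ q, f q (x q)) (∏ q, v q) := by
  rw [hasInt_gauEnt_iff]
  refine (hasInt_entVol fun q => hasInt_gau_iff.1 (h q)).congr (fun x => ?_) rfl
  rw [Finset.prod_mul_distrib, ← Real.exp_sum, Finset.sum_neg_distrib, hs]

/-- The Hilbert-Schmidt norm, hence the Gaussian density, is invariant, so the argument of
`map_haar_eq_of_comp_eq` applies. -/
theorem map_sandwich_unitary {U V : Matrix (Fin 3) (Fin 3) 𝕜} (hU : Uᴴ * U = 1)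
    (hV : V * Vᴴ = 1) : (entVol 𝕜).map (sandwich U V) = entVol 𝕜 := by
  have hm : Measurable fun x : Ent 𝕜 => ENNReal.ofReal (Real.exp (-hs x)) :=
    (Real.measurable_exp.comp continuous_hs.measurable.neg).ennreal_ofReal
  have hinv : ∀ x, hs (sandwich U V x) = hs x := by
    intro x
    have h := trace_mul_conjTranspose_vmat (sandwich U V x)
    rw [vmat_sandwich, conjTranspose_mul, conjTranspose_mul] at h
    have h2 : (U * vmat x * V * (Vᴴ * ((vmat x)ᴴ * Uᴴ))).trace = (vmat x * (vmat x)ᴴ).trace := by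
      calc (U * vmat x * V * (Vᴴ * ((vmat x)ᴴ * Uᴴ))).trace
          = (U * (vmat x * (V * Vᴴ) * (vmat x)ᴴ) * Uᴴ).trace := by simp only [mul_assoc]
        _ = (vmat x * (vmat x)ᴴ).trace := by rw [hV, mul_one, trace_conj hU]
    rw [h2, trace_mul_conjTranspose_vmat] at h
    exact_mod_cast h.symm
  have h1 := hasInt_gauEnt (𝕜 := 𝕜) fun _ => hasInt_gau 0
  rw [hasInt_gauEnt_iff] at h1
  simp only [pow_zero, Finset.prod_const_one, mul_one, rising, Finset.range_zero,
    Finset.prod_empty] at h1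
  have h2 := ofReal_integral_eq_lintegral_ofReal h1.1
    (Filter.Eventually.of_forall fun x => (Real.exp_pos _).le)
  rw [h1.2] at h2
  refine map_haar_eq_of_comp_eq (entVol 𝕜) ((sandwich U V).restrictScalars ℝ) ?_ hm
    (fun x => by rw [LinearMap.coe_restrictScalars, hinv]) ?_ ?_
  · rw [LinearMap.det_restrictScalars, det_sandwich]
    have hUV : U.det ^ 3 * V.det ^ 3 ≠ 0 := by
      have := congrArg det hU
      have h' := congrArg det hV
      rw [det_mul, det_one] at this h'
      exact mul_ne_zero (pow_ne_zero _ (right_ne_zero_of_mul_eq_one this))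
        (pow_ne_zero _ (left_ne_zero_of_mul_eq_one h'))
    exact Algebra.norm_ne_zero_iff.2 hUV
  · rw [← h2]
    have := gauMass_pos (𝕜 := 𝕜)
    simp only [ne_eq, ENNReal.ofReal_eq_zero, not_le]
    positivity
  · rw [← h2]
    exact ENNReal.ofReal_ne_top

/-- The determinant over 𝕜 is (m n)³; the real determinant is its field norm, which for a real
number is its β-th power. -/
theorem map_sandwich_pos {M N : Matrix (Fin 3) (Fin 3) 𝕜} {m n : ℝ} (hm : 0 < m) (hn : 0 < n)
    (hM : M.det = m) (hN : N.det = n) : (entVol 𝕜).map (sandwich M N)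
      = ENNReal.ofReal (((m * n) ^ (3 * finrank ℝ 𝕜))⁻¹) • entVol 𝕜 := by
  have hdet : LinearMap.det ((sandwich M N).restrictScalars ℝ) = (m * n) ^ (3 * finrank ℝ 𝕜) := by
    rw [LinearMap.det_restrictScalars, det_sandwich, hM, hN, ← mul_pow, ← RCLike.ofReal_mul,
      ← RCLike.ofReal_pow, ← RCLike.algebraMap_eq_ofReal, Algebra.norm_algebraMap, pow_mul]
  have h := Measure.map_linearMap_addHaar_eq_smul_addHaar (entVol 𝕜)
    (f := (sandwich M N).restrictScalars ℝ) (by rw [hdet]; positivity)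
  rw [hdet, abs_of_pos (by positivity)] at h
  exact h

theorem measurable_sandwich (M N : Matrix (Fin 3) (Fin 3) 𝕜) : Measurable (sandwich M N) :=
  (LinearMap.continuous_of_finiteDimensional (sandwich M N)).measurable

/-- The Hermitian block matrix `[[A, B], [Bᴴ, C]]`. -/
def blk (A B C : Matrix (Fin 3) (Fin 3) 𝕜) : Matrix (Fin 3 ⊕ Fin 3) (Fin 3 ⊕ Fin 3) 𝕜 :=
  fromBlocks A B Bᴴ C

theorem blk_conj (M N A B C : Matrix (Fin 3) (Fin 3) 𝕜) :
    blk (M * A * Mᴴ) (M * B * Nᴴ) (N * C * Nᴴ)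
      = fromBlocks M 0 0 N * blk A B C * (fromBlocks M 0 0 N)ᴴ := by
  simp [blk, fromBlocks_multiply, fromBlocks_conjTranspose, conjTranspose_mul, mul_assoc]

theorem posDef_blk_conj {M N : Matrix (Fin 3) (Fin 3) 𝕜} (hM : IsUnit M) (hN : IsUnit N)
    (A B C : Matrix (Fin 3) (Fin 3) 𝕜) :
    (blk (M * A * Mᴴ) (M * B * Nᴴ) (N * C * Nᴴ)).PosDef ↔ (blk A B C).PosDef := by
  rw [blk_conj]
  refine IsUnit.posDef_star_right_conjugate_iff ?_
  rw [isUnit_iff_isUnit_det, det_fromBlocks_zero₂₁]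
  exact ((isUnit_iff_isUnit_det M).1 hM).mul ((isUnit_iff_isUnit_det N).1 hN)

theorem det_blk_conj (M N A B C : Matrix (Fin 3) (Fin 3) 𝕜) :
    (blk (M * A * Mᴴ) (M * B * Nᴴ) (N * C * Nᴴ)).det
      = (M * Mᴴ).det * (N * Nᴴ).det * (blk A B C).det := by
  rw [blk_conj, det_mul, det_mul, det_conjTranspose, det_fromBlocks_zero₂₁, det_mul, det_mul,
    det_conjTranspose, det_conjTranspose, star_mul]
  ring

theorem continuous_blk_one : Continuous fun x : Ent 𝕜 => blk 1 (vmat x) 1 :=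
  Continuous.matrix_fromBlocks continuous_const continuous_vmat
    continuous_vmat.matrix_conjTranspose continuous_const

/-- The set of strict contractions. -/
def contr (𝕜 : Type*) [RCLike 𝕜] : Set (Ent 𝕜) := {x | (blk 1 (vmat x) 1).PosDef}

theorem measurableSet_contr : MeasurableSet (contr 𝕜) := measurableSet_posDef continuous_blk_one

/-- The principal minor on row q.1 and column q.2 is 1 - |x q|². Boundedness of the contractions
makes all continuous functions integrable. -/
theorem norm_lt_one_of_mem_contr {x : Ent 𝕜} (hx : x ∈ contr 𝕜) (q : Fin 3 × Fin 3) :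
    ‖x q‖ < 1 := by
  have h := (PosDef.submatrix hx (e := ![Sum.inl q.1, Sum.inr q.2])
    (by intro a b; fin_cases a <;> fin_cases b <;> simp)).det_pos
  have e : ((blk 1 (vmat x) 1).submatrix ![Sum.inl q.1, Sum.inr q.2]
      ![Sum.inl q.1, Sum.inr q.2]).det = ((1 - ‖x q‖ ^ 2 : ℝ) : 𝕜) := by
    rw [det_fin_two]
    simp [blk, vmat, RCLike.mul_conj]
  rw [e, RCLike.ofReal_pos] at h
  nlinarith [norm_nonneg (x q)]

/-- The density of the off-diagonal contraction. -/
noncomputable def contrDens (k : ℕ) : Ent 𝕜 → ℝ≥0∞ :=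
  (contr 𝕜).indicator fun x => ENNReal.ofReal (rdet (blk 1 (vmat x) 1) ^ k)

theorem measurable_contrDens (k : ℕ) : Measurable (contrDens (𝕜 := 𝕜) k) :=
  (((continuous_rdet.comp continuous_blk_one).pow k).measurable.ennreal_ofReal).indicator
    measurableSet_contr

variable (𝕜) in
/-- The unnormalised distribution of the off-diagonal contraction. -/
noncomputable def muX (k : ℕ) : Measure (Ent 𝕜) := (entVol 𝕜).withDensity (contrDens k)

theorem contr_subset_closedBall : contr 𝕜 ⊆ Metric.closedBall 0 1 := by
  intro x hx
  rw [mem_closedBall_zero_iff, pi_norm_le_iff_of_nonneg zero_le_one]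
  exact fun q => (norm_lt_one_of_mem_contr hx q).le

theorem contrDens_lt_top (k : ℕ) (x : Ent 𝕜) : contrDens k x < ⊤ := by
  unfold contrDens Set.indicator
  split_ifs <;> simp

theorem contrDens_toReal (k : ℕ) (x : Ent 𝕜) : (contrDens k x).toReal
    = (contr 𝕜).indicator (fun x => rdet (blk 1 (vmat x) 1) ^ k) x := by
  unfold contrDens
  by_cases hx : x ∈ contr 𝕜
  · rw [Set.indicator_of_mem hx, Set.indicator_of_mem hx, ENNReal.toReal_ofReal]
    have := PosDef.det_pos hx
    exact pow_nonneg (RCLike.pos_iff.1 this).1.le k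
  · simp [hx]

theorem integrable_muX (k : ℕ) {f : Ent 𝕜 → ℝ} (hf : Continuous f) : Integrable f (muX 𝕜 k) := by
  unfold muX
  rw [integrable_withDensity_iff_integrable_smul' (measurable_contrDens k)
    (Filter.Eventually.of_forall (contrDens_lt_top k))]
  have : (fun x => (contrDens k x).toReal • f x)
      = (contr 𝕜).indicator fun x => rdet (blk 1 (vmat x) 1) ^ k * f x := by
    funext x
    rw [contrDens_toReal]
    by_cases hx : x ∈ contr 𝕜 <;> simp [hx]
  rw [this, integrable_indicator_iff measurableSet_contr]
  refine IntegrableOn.mono_set ?_ contr_subset_closedBall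
  exact (((continuous_rdet.comp continuous_blk_one).pow k).mul hf).continuousOn.integrableOn_compact
    (isCompact_closedBall 0 1)

theorem integral_muX (k : ℕ) (f : Ent 𝕜 → ℝ) : ∫ x, f x ∂muX 𝕜 k
    = ∫ x, (contr 𝕜).indicator (fun x => rdet (blk 1 (vmat x) 1) ^ k * f x) x ∂entVol 𝕜 := by
  unfold muX
  rw [integral_withDensity_eq_integral_toReal_smul (measurable_contrDens k)
    (Filter.Eventually.of_forall (contrDens_lt_top k))]
  refine integral_congr_ae (Filter.Eventually.of_forall fun x => ?_)
  simp only [contrDens_toReal]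
  by_cases hx : x ∈ contr 𝕜 <;> simp [hx]

instance (k : ℕ) : SFinite (muX 𝕜 k) := by unfold muX; infer_instance

/-- Replacing X by U X V conjugates [[1, X], [Xᴴ, 1]] by the unitary U ⊕ Vᴴ, so both the domain and
the density are invariant. -/
theorem map_sandwich_muX (k : ℕ) {U V : Matrix (Fin 3) (Fin 3) 𝕜} (hU : Uᴴ * U = 1)
    (hV : V * Vᴴ = 1) : (muX 𝕜 k).map (sandwich U V) = muX 𝕜 k := by
  have hU' : U * Uᴴ = 1 := mul_eq_one_comm.1 hU
  have hV' : Vᴴ * V = 1 := mul_eq_one_comm.1 hV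
  have e : ∀ x : Ent 𝕜, blk 1 (vmat (sandwich U V x)) 1
      = blk (U * 1 * Uᴴ) (U * vmat x * (Vᴴ)ᴴ) (Vᴴ * 1 * (Vᴴ)ᴴ) := by
    intro x
    simp [vmat_sandwich, hU', hV']
  have h1 : ∀ x : Ent 𝕜, sandwich U V x ∈ contr 𝕜 ↔ x ∈ contr 𝕜 := by
    intro x
    simp only [contr, Set.mem_ofPred_eq]
    rw [e, posDef_blk_conj (isUnit_of_mem_unitary hU) (isUnit_of_mem_unitary (by simpa using hV))]
  refine map_withDensity_of_comp_eq (measurable_sandwich U V) (map_sandwich_unitary hU hV)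
    (measurable_contrDens k) fun x => ?_
  have h2 : rdet (blk 1 (vmat (sandwich U V x)) 1) = rdet (blk 1 (vmat x) 1) := by
    rw [rdet, rdet, e, det_blk_conj]
    simp [hU', hV']
  unfold contrDens
  by_cases hx : x ∈ contr 𝕜
  · rw [Set.indicator_of_mem hx, Set.indicator_of_mem ((h1 x).2 hx), h2]
  · rw [Set.indicator_of_notMem hx, Set.indicator_of_notMem (mt (h1 x).1 hx)]

theorem integral_muX_sandwich (k : ℕ) {U V : Matrix (Fin 3) (Fin 3) 𝕜} (hU : Uᴴ * U = 1)
    (hV : V * Vᴴ = 1) {f : Matrix (Fin 3) (Fin 3) 𝕜 → ℝ} (hf : Continuous f) :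
    ∫ x, f (U * vmat x * V) ∂muX 𝕜 k = ∫ x, f (vmat x) ∂muX 𝕜 k := by
  conv_rhs => rw [← map_sandwich_muX k hU hV]
  rw [integral_map (f := fun x => f (vmat x)) (measurable_sandwich U V).aemeasurable
    (hf.comp continuous_vmat).aestronglyMeasurable]
  simp only [vmat_sandwich]

end Contractions

open Matrix Module
open scoped ENNReal Kronecker

/-! ### Contraction times Cholesky factor is Gaussian -/

section GaussianFactorisation

variable {𝕜 : Type*} [RCLike 𝕜]

theorem lintegral_sandwich {M N : Matrix (Fin 3) (Fin 3) 𝕜} {m n : ℝ} (hm : 0 < m) (hn : 0 < n)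
    (hM : M.det = m) (hN : N.det = n) {F : Ent 𝕜 → ℝ≥0∞} (hF : Measurable F) :
    ∫⁻ x, F (sandwich M N x) ∂entVol 𝕜
      = ENNReal.ofReal (((m * n) ^ (3 * finrank ℝ 𝕜))⁻¹) * ∫⁻ x, F x ∂entVol 𝕜 := by
  rw [← lintegral_map hF (measurable_sandwich M N), map_sandwich_pos hm hn hM hN,
    lintegral_smul_measure, smul_eq_mul]

theorem posDef_of_posDef_blk {B C : Matrix (Fin 3) (Fin 3) 𝕜} {A : Matrix (Fin 3) (Fin 3) 𝕜}
    (h : (blk A B C).PosDef) : A.PosDef ∧ C.PosDef :=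
  ⟨h.submatrix (e := Sum.inl) Sum.inl_injective, h.submatrix (e := Sum.inr) Sum.inr_injective⟩

/-- This is block elimination: S is the Schur complement of the identity block. -/
theorem blk_one_left (B S : Matrix (Fin 3) (Fin 3) 𝕜) :
    blk 1 B (S + Bᴴ * B) = fromBlocks 1 0 Bᴴ 1 * blk 1 0 S * (fromBlocks 1 0 Bᴴ 1)ᴴ := by
  simp [blk, fromBlocks_multiply, fromBlocks_conjTranspose, add_comm]

theorem posDef_blk_one_left (B S : Matrix (Fin 3) (Fin 3) 𝕜) :
    (blk 1 B (S + Bᴴ * B)).PosDef ↔ S.PosDef := by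
  have h1 : IsUnit (fromBlocks 1 0 Bᴴ 1 : Matrix (Fin 3 ⊕ Fin 3) (Fin 3 ⊕ Fin 3) 𝕜) := by
    rw [isUnit_iff_isUnit_det, det_fromBlocks_zero₁₂]
    simp
  rw [blk_one_left]
  refine (IsUnit.posDef_star_right_conjugate_iff h1).trans ⟨fun h => (posDef_of_posDef_blk h).2,
    fun h => ?_⟩
  refine PosDef.of_dotProduct_mulVec_pos ?_ fun x hx => ?_
  · simpa [blk] using IsHermitian.fromBlocks isHermitian_one (by simp) h.1
  · have e : star x ⬝ᵥ (blk 1 0 S *ᵥ x) = star (x ∘ Sum.inl) ⬝ᵥ (x ∘ Sum.inl)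
        + star (x ∘ Sum.inr) ⬝ᵥ (S *ᵥ (x ∘ Sum.inr)) := by
      simp [blk, fromBlocks_mulVec, dotProduct, Fintype.sum_sum_type]
    rw [e]
    by_cases hr : x ∘ Sum.inr = 0
    · have hl : x ∘ Sum.inl ≠ 0 := by
        rintro hl
        apply hx
        funext i
        rcases i with i | i
        · exact congrFun hl i
        · exact congrFun hr i
      rw [hr]
      simpa using dotProduct_star_self_pos_iff.2 hl
    · exact add_pos_of_nonneg_of_pos (dotProduct_star_self_nonneg _) (h.dotProduct_mulVec_pos hr)

theorem det_blk_one_left (B S : Matrix (Fin 3) (Fin 3) 𝕜) :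
    (blk 1 B (S + Bᴴ * B)).det = S.det := by
  rw [blk, det_fromBlocks_one₁₁, add_sub_cancel_right]

theorem continuous_blk_hmat :
    Continuous fun q : HermCoord 𝕜 × Ent 𝕜 => blk 1 (vmat q.2) (hmat q.1) :=
  Continuous.matrix_fromBlocks continuous_const (continuous_vmat.comp continuous_snd)
    (continuous_vmat.comp continuous_snd).matrix_conjTranspose (continuous_hmat.comp continuous_fst)

/-- The density of the block matrix `[[1, B], [Bᴴ, C]]`. -/
noncomputable def blkDens (k : ℕ) (q : HermCoord 𝕜 × Ent 𝕜) : ℝ≥0∞ :=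
  {q : HermCoord 𝕜 × Ent 𝕜 | (blk 1 (vmat q.2) (hmat q.1)).PosDef}.indicator
    (fun q => ENNReal.ofReal (rdet (blk 1 (vmat q.2) (hmat q.1)) ^ k)) q

theorem measurable_blkDens (k : ℕ) : Measurable (blkDens (𝕜 := 𝕜) k) :=
  (((continuous_rdet.comp continuous_blk_hmat).pow k).measurable.ennreal_ofReal).indicator
    (measurableSet_posDef continuous_blk_hmat)

theorem PosDef.rdet_pos {n : Type*} [Fintype n] [DecidableEq n] {M : Matrix n n 𝕜}
    (h : M.PosDef) : 0 < rdet M :=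
  (RCLike.pos_iff.1 h.det_pos).1

theorem PosDef.det_eq {n : Type*} [Fintype n] [DecidableEq n] {M : Matrix n n 𝕜}
    (h : M.PosDef) : M.det = (rdet M : 𝕜) := by
  have := (RCLike.pos_iff.1 h.det_pos).2
  exact ((RCLike.ext_iff).2 ⟨by simp [rdet], by simp [this]⟩)

theorem continuous_cholMat : Continuous (cholMat (𝕜 := 𝕜)) := by
  refine continuous_matrix fun i j => ?_
  fin_cases i <;> fin_cases j <;> simp only [cholMat] <;> simp <;> fun_prop

/-- The map `(p, X) ↦ X * Lᴴ` with `L = cholMat p`. -/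
noncomputable def cholAct (q : HermCoord 𝕜 × Ent 𝕜) : Ent 𝕜 :=
  entries (vmat q.2 * (cholMat q.1)ᴴ)

theorem measurable_cholAct : Measurable (cholAct (𝕜 := 𝕜)) := by
  refine Continuous.measurable (continuous_pi fun q => ?_)
  exact ((continuous_vmat.comp continuous_snd).matrix_mul
    (continuous_cholMat.comp continuous_fst).matrix_conjTranspose).matrix_elem q.1 q.2

theorem cholAct_eq (p : HermCoord 𝕜) (x : Ent 𝕜) :
    cholAct (p, x) = sandwich 1 (cholMat p)ᴴ x := by
  funext q
  have := congrFun (congrFun (vmat_sandwich 1 (cholMat p)ᴴ x) q.1) q.2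
  rw [one_mul] at this
  exact this.symm

/-- Conjugation by 1 ⊕ L carries [[1, X], [Xᴴ, 1]] to [[1, Y], [Yᴴ, C]] with Y = X Lᴴ and C = L Lᴴ.
The determinant to the power k costs det(C)^(-k), and the change of variables costs det(C)^(-3β/2).
-/
theorem lintegral_contrDens_chol (k : ℕ) {F : Ent 𝕜 → ℝ≥0∞} (hF : Measurable F) {p : HermCoord 𝕜}
    (h1 : 0 < p.1) (h2 : 0 < p.2.2.2.1) (h3 : 0 < p.2.2.2.2.2) :
    ∫⁻ x, F (cholAct (p, x)) ∂muX 𝕜 k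
      = ENNReal.ofReal (rdet (hmat (cholCoord p)) ^ (-(k + 3 * finrank ℝ 𝕜 / 2 : ℝ))) *
        ∫⁻ y, blkDens k (cholCoord p, y) * F y ∂entVol 𝕜 := by
  set C := hmat (cholCoord p) with hC
  have hCpd : C.PosDef := posDef_hmat_cholCoord h1 h2 h3
  set d : ℝ := √p.1 * √p.2.2.2.1 * √p.2.2.2.2.2 with hd
  have hd0 : 0 < d := by positivity
  have hLdet : (cholMat p)ᴴ.det = ((d : ℝ) : 𝕜) := by
    rw [det_conjTranspose, det_cholMat, ← hd]
    simp
  have hCL : C = cholMat p * (cholMat p)ᴴ := hmat_cholCoord h1.le h2.le h3.le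
  have hCd : rdet C = d ^ 2 := by
    rw [rdet, hCL, det_mul, hLdet, det_cholMat, ← hd, ← RCLike.ofReal_mul, RCLike.ofReal_re, sq]
  have hLu : IsUnit (cholMat p) := by
    rw [isUnit_iff_isUnit_det, det_cholMat, isUnit_iff_ne_zero]
    exact_mod_cast hd0.ne'
  have key : ∀ x, contrDens k x * F (cholAct (p, x)) = ENNReal.ofReal ((d ^ 2) ^ k)⁻¹ *
      (blkDens k (cholCoord p, sandwich 1 (cholMat p)ᴴ x) * F (sandwich 1 (cholMat p)ᴴ x)) := by
    intro x
    have e : blk 1 (vmat (sandwich 1 (cholMat p)ᴴ x)) C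
        = blk (1 * 1 * 1ᴴ) (1 * vmat x * (cholMat p)ᴴ) (cholMat p * 1 * (cholMat p)ᴴ) := by
      rw [vmat_sandwich, hCL]
      simp
    rw [cholAct_eq, ← mul_assoc]
    congr 1
    unfold contrDens blkDens
    by_cases hx : x ∈ contr 𝕜
    · rw [Set.indicator_of_mem hx, Set.indicator_of_mem]
      · simp only [← hC]
        rw [e, rdet, rdet, det_blk_conj, ← hCL, PosDef.det_eq hCpd, hCd]
        rw [← ENNReal.ofReal_mul (by positivity)]
        congr 1
        simp only [conjTranspose_one, mul_one, det_one, one_mul, RCLike.re_ofReal_mul, mul_pow]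
        field_simp
      · simp only [Set.mem_ofPred_eq, ← hC]
        rw [e, posDef_blk_conj isUnit_one hLu]
        exact hx
    · rw [Set.indicator_of_notMem hx, Set.indicator_of_notMem, mul_zero]
      simp only [Set.mem_ofPred_eq, ← hC]
      rw [e, posDef_blk_conj isUnit_one hLu]
      exact hx
  have hFm : Measurable fun x => F (cholAct (p, x)) :=
    hF.comp (measurable_cholAct.comp (by fun_prop))
  have hbm : Measurable fun y => blkDens k (cholCoord p, y) * F y :=
    ((measurable_blkDens k).comp (by fun_prop)).mul hF
  rw [muX, lintegral_withDensity_eq_lintegral_mul _ (measurable_contrDens k) hFm]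
  simp only [Pi.mul_apply, key]
  rw [lintegral_const_mul' _ _ ENNReal.ofReal_ne_top,
    lintegral_sandwich (M := 1) (N := (cholMat p)ᴴ) one_pos hd0 (by simp) hLdet hbm, ← mul_assoc,
    ← ENNReal.ofReal_mul (by positivity), hCd]
  congr 2
  rw [one_mul, Real.rpow_neg (by positivity), Real.rpow_add (by positivity), mul_inv,
    Real.rpow_natCast]
  congr 2
  rw [← Real.rpow_natCast d 2, ← Real.rpow_mul hd0.le, ← Real.rpow_natCast]
  congr 1
  push_cast
  ring

theorem hmat_add (p q : HermCoord 𝕜) : hmat (p + q) = hmat p + hmat q := hmatLin.map_add p q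

/-- Translating to the Schur complement S = C - YᴴY separates the variables: the trace gives
exp(-|Y|²), and the rest is the mass of the Wishart measure of parameter k. -/
theorem lintegral_blkDens (k : ℕ) (y : Ent 𝕜) :
    ∫⁻ c, ENNReal.ofReal (Real.exp (-rtr (hmat c))) * blkDens k (c, y) ∂hermVol 𝕜
      = ENNReal.ofReal (Real.exp (-hs y)) * ENNReal.ofReal (chiMass 𝕜 k) := by
  have hm : Measurable fun p : HermCoord 𝕜 =>
      ENNReal.ofReal (Real.exp (-RCLike.re (hmat p).trace) * RCLike.re (hmat p).det ^ (k : ℝ)) :=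
    ((Real.measurable_exp.comp measurable_re_trace_hmat.neg).mul
      (measurable_re_det_hmat.pow_const _)).ennreal_ofReal
  have hmass := lintegral_one_wish (𝕜 := 𝕜) (κ := k) (by
    have : (0 : ℝ) ≤ k := by positivity
    linarith)
  rw [wish, lintegral_withDensity_eq_lintegral_mul _
    (hm.indicator (measurableSet_posDef continuous_hmat)) measurable_const] at hmass
  have hadd : MeasurableAdd (HermCoord 𝕜) :=
    ⟨fun c => (continuous_const.add continuous_id).measurable,
      fun c => (continuous_id.add continuous_const).measurable⟩
  rw [← hmass, ← lintegral_const_mul' _ _ ENNReal.ofReal_ne_top,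
    ← lintegral_add_right_eq_self _ (coordLin ((vmat y)ᴴ * vmat y))]
  refine lintegral_congr fun s => ?_
  have e : hmat (s + coordLin ((vmat y)ᴴ * vmat y)) = hmat s + (vmat y)ᴴ * vmat y := by
    rw [hmat_add, hmat_coordLin (isHermitian_conjTranspose_mul_self _)]
  have et : rtr (hmat (s + coordLin ((vmat y)ᴴ * vmat y))) = rtr (hmat s) + hs y := by
    rw [e, rtr, trace_add, trace_conjTranspose_mul_vmat, map_add, RCLike.ofReal_re, rtr]
  rw [et]
  unfold blkDens
  simp only [Pi.mul_apply, mul_one]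
  by_cases hs' : (hmat s).PosDef
  · rw [Set.indicator_of_mem, Set.indicator_of_mem (by exact hs')]
    · simp only [e]
      rw [rdet, det_blk_one_left]
      have := PosDef.rdet_pos hs'
      rw [← ENNReal.ofReal_mul (by positivity), ← ENNReal.ofReal_mul (by positivity)]
      congr 1
      rw [Real.rpow_natCast, neg_add, Real.exp_add, rtr]
      ring
    · simp only [Set.mem_ofPred_eq, e]
      exact (posDef_blk_one_left _ _).2 hs'
  · rw [Set.indicator_of_notMem, Set.indicator_of_notMem (by exact hs')]
    · simp
    · simp only [Set.mem_ofPred_eq, e]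
      exact fun h => hs' ((posDef_blk_one_left _ _).1 h)

/-- If `X` is distributed as the off-diagonal contraction and `L` is the Cholesky factor of an
independent Wishart matrix, then `X * Lᴴ` is Gaussian. -/
theorem map_cholAct (k : ℕ) :
    ((chi 𝕜 (k + 3 * finrank ℝ 𝕜 / 2)).prod (muX 𝕜 k)).map cholAct
      = ENNReal.ofReal (chiMass 𝕜 k) • gauEnt 𝕜 := by
  refine Measure.ext_of_lintegral _ fun F hF => ?_
  set κ : ℝ := k + 3 * finrank ℝ 𝕜 / 2 with hκ
  have hHm : Measurable fun c : HermCoord 𝕜 => ENNReal.ofReal (rdet (hmat c) ^ (-κ)) *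
      ∫⁻ y, blkDens k (c, y) * F y ∂entVol 𝕜 := by
    refine (measurable_re_det_hmat.pow_const _).ennreal_ofReal.mul ?_
    exact Measurable.lintegral_prod_right' (f := fun q : HermCoord 𝕜 × Ent 𝕜 =>
      blkDens k q * F q.2) ((measurable_blkDens k).mul (hF.comp measurable_snd))
  have hm : Measurable fun p : HermCoord 𝕜 =>
      ENNReal.ofReal (Real.exp (-RCLike.re (hmat p).trace) * RCLike.re (hmat p).det ^ κ) :=
    ((Real.measurable_exp.comp measurable_re_trace_hmat.neg).mul
      (measurable_re_det_hmat.pow_const κ)).ennreal_ofReal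
  have hFc : Measurable fun q : HermCoord 𝕜 × Ent 𝕜 => F (cholAct q) := hF.comp measurable_cholAct
  have hem : Measurable fun c : HermCoord 𝕜 => ENNReal.ofReal (Real.exp (-rtr (hmat c))) :=
    (Real.measurable_exp.comp measurable_re_trace_hmat.neg).ennreal_ofReal
  calc ∫⁻ y, F y ∂(((chi 𝕜 κ).prod (muX 𝕜 k)).map cholAct)
      = ∫⁻ p, ∫⁻ x, F (cholAct (p, x)) ∂muX 𝕜 k ∂chi 𝕜 κ := by
        rw [lintegral_map hF measurable_cholAct, lintegral_prod _ hFc.aemeasurable]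
    _ = ∫⁻ p, ENNReal.ofReal (rdet (hmat (cholCoord p)) ^ (-κ)) *
          ∫⁻ y, blkDens k (cholCoord p, y) * F y ∂entVol 𝕜 ∂chi 𝕜 κ := by
        refine lintegral_congr_ae ?_
        filter_upwards [ae_chi_pos κ] with p hp
        exact lintegral_contrDens_chol k hF hp.1 hp.2.1 hp.2.2
    _ = ∫⁻ c, ENNReal.ofReal (rdet (hmat c) ^ (-κ)) *
          ∫⁻ y, blkDens k (c, y) * F y ∂entVol 𝕜 ∂wish 𝕜 κ := by
        rw [← map_cholCoord_chi, lintegral_map hHm measurable_cholCoord]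
    _ = ∫⁻ c, ∫⁻ y, ENNReal.ofReal (Real.exp (-rtr (hmat c))) * blkDens k (c, y) * F y
          ∂entVol 𝕜 ∂hermVol 𝕜 := by
        -- The parameter κ is chosen so that its determinant power cancels the factor produced by
        -- the substitution.
        rw [wish, lintegral_withDensity_eq_lintegral_mul _
          (hm.indicator (measurableSet_posDef continuous_hmat)) hHm]
        refine lintegral_congr fun c => ?_
        simp only [Pi.mul_apply, mul_assoc]
        rw [lintegral_const_mul' _ _ ENNReal.ofReal_ne_top]
        by_cases hc : (hmat c).PosDef
        · rw [Set.indicator_of_mem (by exact hc), ← mul_assoc]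
          congr 1
          have := PosDef.rdet_pos hc
          rw [← rtr, ← rdet, ← ENNReal.ofReal_mul (by positivity)]
          congr 1
          rw [mul_assoc, ← Real.rpow_add this]
          simp
        · rw [Set.indicator_of_notMem (by exact hc), zero_mul]
          have h0 : ∀ y, blkDens k (c, y) = 0 := by
            intro y
            unfold blkDens
            rw [Set.indicator_of_notMem]
            exact fun h => hc (posDef_of_posDef_blk h).2
          simp [h0]
    _ = ∫⁻ y, ∫⁻ c, ENNReal.ofReal (Real.exp (-rtr (hmat c))) * blkDens k (c, y) * F y
          ∂hermVol 𝕜 ∂entVol 𝕜 := by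
        refine lintegral_lintegral_swap (Measurable.aemeasurable ?_)
        exact ((hem.comp measurable_fst).mul (measurable_blkDens k)).mul (hF.comp measurable_snd)
    _ = ∫⁻ y, ENNReal.ofReal (chiMass 𝕜 k) * (ENNReal.ofReal (Real.exp (-hs y)) * F y)
          ∂entVol 𝕜 := by
        refine lintegral_congr fun y => ?_
        have hb : Measurable fun c => ENNReal.ofReal (Real.exp (-rtr (hmat c))) * blkDens k (c, y) :=
          hem.mul ((measurable_blkDens k).comp (by fun_prop))
        rw [lintegral_mul_const _ hb, lintegral_blkDens]
        ring
    _ = ∫⁻ y, F y ∂(ENNReal.ofReal (chiMass 𝕜 k) • gauEnt 𝕜) := by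
        have hg : Measurable fun x : Ent 𝕜 => ENNReal.ofReal (Real.exp (-hs x)) :=
          (Real.measurable_exp.comp continuous_hs.measurable.neg).ennreal_ofReal
        rw [lintegral_smul_measure, lintegral_const_mul' _ _ ENNReal.ofReal_ne_top, gauEnt,
          lintegral_withDensity_eq_lintegral_mul _ hg hF]
        rfl

end GaussianFactorisation

open Matrix Module
open scoped ENNReal Kronecker

/-! ### Integration over the off-diagonal block -/

section OffDiagonal

variable {𝕜 : Type*} [RCLike 𝕜]

theorem exists_posDef_diag {C : Matrix (Fin 3) (Fin 3) 𝕜} (hC : C.PosDef) :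
    ∃ (U : Matrix (Fin 3) (Fin 3) 𝕜) (c : Fin 3 → ℝ), Uᴴ * U = 1 ∧ (∀ i, 0 < c i) ∧
      C = U * diagonal (fun i => (c i : 𝕜)) * Uᴴ := by
  obtain ⟨U, c, hU, rfl⟩ := exists_diag hC.1
  refine ⟨U, c, hU, fun i => ?_, rfl⟩
  have := (IsUnit.posDef_star_right_conjugate_iff (isUnit_of_mem_unitary hU)).1 hC
  exact RCLike.ofReal_pos.1 (posDef_diagonal_iff.1 this i)

theorem posDef_conj_diag {U : Matrix (Fin 3) (Fin 3) 𝕜} (hU : Uᴴ * U = 1) {c : Fin 3 → ℝ}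
    (hc : ∀ i, 0 < c i) : (U * diagonal (fun i => (c i : 𝕜)) * Uᴴ).PosDef :=
  (IsUnit.posDef_star_right_conjugate_iff (isUnit_of_mem_unitary hU)).2
    (posDef_diagonal_iff.2 fun i => RCLike.ofReal_pos.2 (hc i))

theorem sqrt_conj_diag {U : Matrix (Fin 3) (Fin 3) 𝕜} (hU : Uᴴ * U = 1) {c : Fin 3 → ℝ}
    (hc : ∀ i, 0 < c i) : (U * diagonal (fun i => ((√(c i) : ℝ) : 𝕜)) * Uᴴ) *
      (U * diagonal (fun i => ((√(c i) : ℝ) : 𝕜)) * Uᴴ)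
        = U * diagonal (fun i => (c i : 𝕜)) * Uᴴ := by
  rw [mul_conj hU, diagonal_mul_diagonal]
  simp only [← RCLike.ofReal_mul, Real.mul_self_sqrt (hc _).le]

theorem exists_sqrt {C : Matrix (Fin 3) (Fin 3) 𝕜} (hC : C.PosDef) :
    ∃ R : Matrix (Fin 3) (Fin 3) 𝕜, R.PosDef ∧ R * R = C := by
  obtain ⟨U, c, hU, hc, rfl⟩ := exists_posDef_diag hC
  exact ⟨_, posDef_conj_diag hU fun i => Real.sqrt_pos.2 (hc i), sqrt_conj_diag hU hc⟩

/-- The partial transpose of `blk A B C`, up to a global transpose. -/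
def ptBlk (A B C : Matrix (Fin 3) (Fin 3) 𝕜) : Matrix (Fin 3 ⊕ Fin 3) (Fin 3 ⊕ Fin 3) 𝕜 :=
  fromBlocks A Bᴴ B C

/-- The partially transposed determinant in normal form. -/
noncomputable def cDet (f : Fin 3 → ℝ) (X : Matrix (Fin 3) (Fin 3) 𝕜) : ℝ :=
  rdet (diagonal (fun i => (f i : 𝕜)) - Xᴴ * diagonal (fun i => (f i : 𝕜)) * X)

theorem continuous_cDet (f : Fin 3 → ℝ) : Continuous (cDet (𝕜 := 𝕜) f) := by
  refine continuous_rdet.comp ?_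
  fun_prop

/-- Removing R on both sides leaves [[F, XᴴG], [GX, 1]], and elimination of the identity block gives
F - XᴴFX. Without the exchange of blocks one would obtain G(1 - XXᴴ)G instead. -/
theorem det_ptBlk {R F G X : Matrix (Fin 3) (Fin 3) 𝕜} (hR : Rᴴ = R) (hG : Gᴴ = G)
    (hGF : G * G = F) : (ptBlk (R * F * R) (R * G * X * R) (R * R)).det
      = (R * R).det ^ 2 * (F - Xᴴ * F * X).det := by
  have e : ptBlk (R * F * R) (R * G * X * R) (R * R)
      = fromBlocks R 0 0 R * fromBlocks F (Xᴴ * G) (G * X) 1 * fromBlocks R 0 0 R := by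
    simp [ptBlk, fromBlocks_multiply, conjTranspose_mul, hR, hG, mul_assoc]
  have e2 : Xᴴ * G * (G * X) = Xᴴ * F * X := by rw [← hGF]; simp only [mul_assoc]
  rw [e, det_mul, det_mul, det_fromBlocks_zero₂₁, det_fromBlocks_one₂₂, det_mul, e2]
  ring

/-- The integral over the off-diagonal block for fixed diagonal blocks. -/
theorem exists_integral_blk {A C : Matrix (Fin 3) (Fin 3) 𝕜} (hA : A.PosDef) (hC : C.PosDef) :
    ∃ f : Fin 3 → ℝ, (f 0 + f 1 + f 2) * rdet C = mixOne A C ∧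
      (f 1 * f 2 + f 0 * f 2 + f 0 * f 1) * rdet C = mixTwo A C ∧
      f 0 * f 1 * f 2 * rdet C = rdet A ∧ ∀ k n : ℕ,
      ∫ y, {y : Ent 𝕜 | (blk A (vmat y) C).PosDef}.indicator (fun y =>
          rdet (blk A (vmat y) C) ^ k * rdet (ptBlk A (vmat y) C) ^ n) y ∂entVol 𝕜
        = (rdet A * rdet C) ^ (k + 3 * finrank ℝ 𝕜 / 2 : ℝ) * (rdet C ^ (2 * n) *
          ∫ x, cDet f (vmat x) ^ n ∂muX 𝕜 k) := by
  -- The plan is C = R R, A = R F R and F = G G, so that y = R G x R makes the block matrix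
  -- congruent to the one with identity diagonal blocks. The numbers f are the eigenvalues of F.
  obtain ⟨R, hR, rfl⟩ := exists_sqrt hC
  have hRh : Rᴴ = R := hR.1
  have hRu : IsUnit R := hR.isUnit
  obtain ⟨F, hFA, hF⟩ : ∃ F, R * F * R = A ∧ F.PosDef := by
    have h1 : R * (R⁻¹ * A * R⁻¹) * R = A := by
      rw [isUnit_iff_isUnit_det] at hRu
      calc R * (R⁻¹ * A * R⁻¹) * R = (R * R⁻¹) * A * (R⁻¹ * R) := by simp only [mul_assoc]
        _ = A := by rw [mul_nonsing_inv _ hRu, nonsing_inv_mul _ hRu, one_mul, mul_one]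
    refine ⟨_, h1, ?_⟩
    refine (IsUnit.posDef_star_right_conjugate_iff (U := R) hRu).1 ?_
    rw [star_eq_conjTranspose, hRh, h1]
    exact hA
  obtain ⟨U, f, hU, hf, rfl⟩ := exists_posDef_diag hF
  subst hFA
  set f' : Matrix (Fin 3) (Fin 3) 𝕜 := diagonal fun i => (f i : 𝕜) with hf'
  set F := U * f' * Uᴴ with hFdef
  set G := U * diagonal (fun i => ((√(f i) : ℝ) : 𝕜)) * Uᴴ with hG
  have hGG : G * G = F := sqrt_conj_diag hU hf
  have hGpd : G.PosDef := posDef_conj_diag hU fun i => Real.sqrt_pos.2 (hf i)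
  have hGh : Gᴴ = G := hGpd.1
  set r := rdet R with hr
  have hr0 : 0 < r := PosDef.rdet_pos hR
  have hRd : R.det = (r : 𝕜) := PosDef.det_eq hR
  set g := rdet G with hg
  have hg0 : 0 < g := PosDef.rdet_pos hGpd
  have hGd : G.det = (g : 𝕜) := PosDef.det_eq hGpd
  have hC' : (R * R).det = ((r ^ 2 : ℝ) : 𝕜) := by
    rw [det_mul, hRd]; push_cast; ring
  have hCd : rdet (R * R) = r ^ 2 := by rw [rdet, hC', RCLike.ofReal_re]
  have hFd' : F.det = ((g ^ 2 : ℝ) : 𝕜) := by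
    rw [← hGG, det_mul, hGd]; push_cast; ring
  have hFd : f 0 * f 1 * f 2 = g ^ 2 := by
    rw [← (symm_diag (𝕜 := 𝕜) f).2.2, ← (symm_conj hU).2.2, ← hf', ← hFdef, rdet, hFd',
      RCLike.ofReal_re]
  have hAd' : (R * F * R).det = ((r ^ 2 * g ^ 2 : ℝ) : 𝕜) := by
    rw [det_mul, det_mul, hRd, hFd']; push_cast; ring
  have hAd : rdet (R * F * R) = r ^ 2 * g ^ 2 := by rw [rdet, hAd', RCLike.ofReal_re]
  have hRadj : R.adjugate * R = (r : 𝕜) • 1 := by rw [adjugate_mul, hRd]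
  have hRadj' : R * R.adjugate = (r : 𝕜) • 1 := by rw [mul_adjugate, hRd]
  refine ⟨f, ?_, ?_, ?_, fun k n => ?_⟩
  · have h1 : ((R * R).adjugate * (R * F * R)).trace = ((r ^ 2 : ℝ) : 𝕜) * F.trace := by
      calc ((R * R).adjugate * (R * F * R)).trace
          = (R.adjugate * (R.adjugate * R) * F * R).trace := by
            rw [adjugate_mul_distrib]; simp only [mul_assoc]
        _ = ((r : 𝕜) • (R.adjugate * F * R)).trace := by
            rw [hRadj]; simp [mul_assoc]
        _ = (r : 𝕜) * ((R * R.adjugate) * F).trace := by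
            rw [trace_smul, trace_mul_comm, smul_eq_mul, mul_assoc]
        _ = _ := by rw [hRadj']; simp [RCLike.real_smul_eq_coe_mul]; ring
    rw [mixOne, h1, RCLike.re_ofReal_mul, hCd, ← (symm_diag (𝕜 := 𝕜) f).1, ← (symm_conj hU).1,
      rtr, mul_comm]
  · have h1 : ((R * F * R).adjugate * (R * R)).trace = ((r ^ 2 : ℝ) : 𝕜) * F.adjugate.trace := by
      calc ((R * F * R).adjugate * (R * R)).trace
          = (R.adjugate * F.adjugate * (R.adjugate * R) * R).trace := by
            rw [adjugate_mul_distrib, adjugate_mul_distrib]; simp only [mul_assoc]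
        _ = ((r : 𝕜) • (R.adjugate * F.adjugate * R)).trace := by
            rw [hRadj]; simp [mul_assoc]
        _ = (r : 𝕜) * ((R * R.adjugate) * F.adjugate).trace := by
            rw [trace_smul, trace_mul_comm, smul_eq_mul, mul_assoc]
        _ = _ := by rw [hRadj']; simp [RCLike.real_smul_eq_coe_mul]; ring
    rw [mixTwo, h1, RCLike.re_ofReal_mul, hCd, ← (symm_diag (𝕜 := 𝕜) f).2.1,
      ← (symm_conj hU).2.1, etwo, mul_comm]
  · rw [hFd, hCd, hAd]; ring
  · set Ψ : Ent 𝕜 → ℝ := {y : Ent 𝕜 | (blk (R * F * R) (vmat y) (R * R)).PosDef}.indicator (fun y =>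
          rdet (blk (R * F * R) (vmat y) (R * R)) ^ k * rdet (ptBlk (R * F * R) (vmat y) (R * R)) ^ n)
      with hΨ
    have hb : Continuous fun y : Ent 𝕜 => blk (R * F * R) (vmat y) (R * R) :=
      Continuous.matrix_fromBlocks continuous_const continuous_vmat
        continuous_vmat.matrix_conjTranspose continuous_const
    have hp : Continuous fun y : Ent 𝕜 => ptBlk (R * F * R) (vmat y) (R * R) :=
      Continuous.matrix_fromBlocks continuous_const continuous_vmat.matrix_conjTranspose
        continuous_vmat continuous_const
    have hΨm : Measurable Ψ :=
      (((continuous_rdet.comp hb).pow k).mul ((continuous_rdet.comp hp).pow n)).measurable.indicator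
        (measurableSet_posDef hb)
    have hM : (R * G).det = ((r * g : ℝ) : 𝕜) := by rw [det_mul, hRd, hGd]; push_cast; ring
    have hmap := map_sandwich_pos (M := R * G) (N := R) (mul_pos hr0 hg0) hr0 hM hRd
    have h1 : ∫ x, Ψ (sandwich (R * G) R x) ∂entVol 𝕜
        = ((r * g * r) ^ (3 * finrank ℝ 𝕜))⁻¹ * ∫ y, Ψ y ∂entVol 𝕜 := by
      rw [← integral_map (measurable_sandwich _ _).aemeasurable hΨm.aestronglyMeasurable, hmap,
        integral_smul_measure, ENNReal.toReal_ofReal (by positivity), smul_eq_mul]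
    have h2 : ∀ x, Ψ (sandwich (R * G) R x) = (r ^ 2 * g ^ 2 * r ^ 2) ^ k * (r ^ 2) ^ (2 * n) *
        (contr 𝕜).indicator (fun x => rdet (blk 1 (vmat x) 1) ^ k *
          cDet f (Uᴴ * vmat x * U) ^ n) x := by
      intro x
      have e : blk (R * F * R) (vmat (sandwich (R * G) R x)) (R * R)
          = blk ((R * G) * 1 * (R * G)ᴴ) ((R * G) * vmat x * Rᴴ) (R * 1 * Rᴴ) := by
        rw [vmat_sandwich, conjTranspose_mul, hRh, hGh, ← hGG]
        simp only [mul_one, mul_assoc]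
      have e1 : (blk (R * F * R) (vmat (sandwich (R * G) R x)) (R * R)).PosDef
          ↔ (blk 1 (vmat x) 1).PosDef := by
        rw [e]
        exact posDef_blk_conj (hRu.mul hGpd.isUnit) hRu _ _ _
      have e2 : rdet (blk (R * F * R) (vmat (sandwich (R * G) R x)) (R * R))
          = r ^ 2 * g ^ 2 * r ^ 2 * rdet (blk 1 (vmat x) 1) := by
        rw [rdet, e, det_blk_conj, det_mul, hM, det_conjTranspose, hM, hRh, hC', rdet]
        have : ((r * g : ℝ) : 𝕜) * star ((r * g : ℝ) : 𝕜) * ((r ^ 2 : ℝ) : 𝕜)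
            = ((r ^ 2 * g ^ 2 * r ^ 2 : ℝ) : 𝕜) := by
          rw [RCLike.star_def, RCLike.conj_ofReal]
          push_cast
          ring
        rw [this, RCLike.re_ofReal_mul]
      have e3 : rdet (ptBlk (R * F * R) (vmat (sandwich (R * G) R x)) (R * R))
          = (r ^ 2) ^ 2 * cDet f (Uᴴ * vmat x * U) := by
        -- The eigenvectors of F can be absorbed into x; the bi-unitary invariance of `muX` then
        -- removes them from the integral.
        have hU' : U * Uᴴ = 1 := mul_eq_one_comm.1 hU
        have e4 : F - (vmat x)ᴴ * F * vmat x
            = U * (f' - (Uᴴ * vmat x * U)ᴴ * f' * (Uᴴ * vmat x * U)) * Uᴴ := by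
          have : (vmat x)ᴴ * F * vmat x = (U * Uᴴ) * (vmat x)ᴴ * F * vmat x * (U * Uᴴ) := by
            rw [hU', one_mul, mul_one]
          rw [this]
          simp only [hFdef, mul_sub, sub_mul, conjTranspose_mul, conjTranspose_conjTranspose,
            mul_assoc]
        rw [rdet, vmat_sandwich, det_ptBlk hRh hGh hGG, hC', e4, det_conj hU, cDet, rdet,
          ← RCLike.ofReal_pow, RCLike.re_ofReal_mul]
      by_cases hx : x ∈ contr 𝕜
      · rw [hΨ, Set.indicator_of_mem hx, Set.indicator_of_mem (by exact e1.2 hx), e2, e3]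
        ring
      · rw [hΨ, Set.indicator_of_notMem hx, Set.indicator_of_notMem (by exact mt e1.1 hx), mul_zero]
    simp only [h2] at h1
    rw [integral_const_mul, ← integral_muX k (fun x => cDet f (Uᴴ * vmat x * U) ^ n),
      integral_muX_sandwich (U := Uᴴ) (V := U) (f := fun M => cDet f M ^ n) k
        (by simpa using mul_eq_one_comm.1 hU) (mul_eq_one_comm.1 hU)
        ((continuous_cDet f).pow n)] at h1
    have hrg : ((r * g * r) ^ (3 * finrank ℝ 𝕜)) ≠ 0 := by positivity
    rw [eq_comm, inv_mul_eq_iff_eq_mul₀ hrg] at h1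
    rw [h1, hAd, hCd, Real.rpow_add (by positivity), Real.rpow_natCast]
    -- Since det A · det C = (r g r)², its power 3β/2 is exactly the Jacobian of x ↦ R G x R.
    have e5 : (r ^ 2 * g ^ 2 * r ^ 2) ^ (3 * finrank ℝ 𝕜 / 2 : ℝ)
        = (r * g * r) ^ (3 * finrank ℝ 𝕜) := by
      rw [show r ^ 2 * g ^ 2 * r ^ 2 = (r * g * r) ^ (2 : ℝ) by rw [Real.rpow_two]; ring,
        ← Real.rpow_mul (by positivity), ← Real.rpow_natCast]
      congr 1
      push_cast
      ring
    rw [e5]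
    ring

end OffDiagonal

open Matrix Module
open scoped ENNReal Kronecker

/-! ### From Gaussian moments to moments of contractions -/

section Transfer

variable {𝕜 : Type*} [RCLike 𝕜]

variable (𝕜) in
/-- The total mass of `muX`. -/
noncomputable def muMass (k : ℕ) : ℝ :=
  chiMass 𝕜 k * gauMass 𝕜 ^ 9 / chiMass 𝕜 (k + 3 * finrank ℝ 𝕜 / 2)

theorem neg_one_lt_kappa (k : ℕ) : (-1 : ℝ) < k + 3 * finrank ℝ 𝕜 / 2 := by
  have h1 : (0 : ℝ) ≤ k := by positivity
  have h2 : (0 : ℝ) ≤ finrank ℝ 𝕜 := by positivity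
  linarith

theorem muMass_pos (k : ℕ) : 0 < muMass 𝕜 k := by
  have h0 : (-1 : ℝ) < k := by
    have : (0 : ℝ) ≤ k := by positivity
    linarith
  have h1 := chiMass_pos (𝕜 := 𝕜) h0
  have h2 := chiMass_pos (𝕜 := 𝕜) (neg_one_lt_kappa (𝕜 := 𝕜) k)
  have h3 := gauMass_pos (𝕜 := 𝕜)
  unfold muMass
  positivity

/-- Inserting a unitary D costs nothing because the law of X is invariant. This freedom permits
averaging over diagonal signs, which removes cross terms. -/
theorem hasInt_cholAct (k : ℕ) {f : Matrix (Fin 3) (Fin 3) 𝕜 → ℝ} (hf : Continuous f) {v : ℝ}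
    (hg : HasInt (gauEnt 𝕜) (fun x => f (vmat x)) v) {D : Matrix (Fin 3) (Fin 3) 𝕜}
    (hD : D * Dᴴ = 1) :
    HasInt ((chi 𝕜 (k + 3 * finrank ℝ 𝕜 / 2)).prod (muX 𝕜 k))
      (fun q => f (vmat q.2 * D * (cholMat q.1)ᴴ)) (chiMass 𝕜 k * v) := by
  have hk : (-1 : ℝ) < k := by
    have : (0 : ℝ) ≤ k := by positivity
    linarith
  have h0 := chiMass_pos (𝕜 := 𝕜) hk
  have h1 : HasInt (ENNReal.ofReal (chiMass 𝕜 k) • gauEnt 𝕜) (fun x => f (vmat x))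
      (chiMass 𝕜 k * v) :=
    ⟨hg.1.smul_measure ENNReal.ofReal_ne_top, by
      rw [integral_smul_measure, hg.2, ENNReal.toReal_ofReal h0.le, smul_eq_mul]⟩
  rw [← map_cholAct, hasInt_map (f := fun x => f (vmat x)) measurable_cholAct
    (hf.comp continuous_vmat).measurable] at h1
  have h2 : ((chi 𝕜 (k + 3 * finrank ℝ 𝕜 / 2)).prod (muX 𝕜 k)).map
      (Prod.map id (sandwich 1 D)) = (chi 𝕜 (k + 3 * finrank ℝ 𝕜 / 2)).prod (muX 𝕜 k) := by
    rw [← Measure.map_prod_map _ _ measurable_id (measurable_sandwich 1 D), Measure.map_id,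
      map_sandwich_muX k (by simp) hD]
  rw [← h2, hasInt_map (f := fun q => f (vmat (cholAct q)))
    (measurable_id.prodMap (measurable_sandwich 1 D))
    ((hf.comp continuous_vmat).measurable.comp measurable_cholAct)] at h1
  refine h1.congr (fun q => ?_) rfl
  have : vmat (cholAct (Prod.map id (sandwich 1 D) q))
      = vmat (sandwich 1 D q.2) * (cholMat q.1)ᴴ := rfl
  rw [this, vmat_sandwich, one_mul]

/-- Moments of the contraction are determined by Gaussian moments. -/
theorem integral_muX_of_gauEnt (k : ℕ) {f : Matrix (Fin 3) (Fin 3) 𝕜 → ℝ} (hf : Continuous f)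
    {v : ℝ} (hg : HasInt (gauEnt 𝕜) (fun x => f (vmat x)) (gauMass 𝕜 ^ 9 * v))
    (Ds : List (Matrix (Fin 3) (Fin 3) 𝕜)) (hDs : ∀ D ∈ Ds, D * Dᴴ = 1) (hne : Ds ≠ [])
    (l : List ((ℕ × ℕ × ℕ × ℕ × ℕ × ℕ) × (Matrix (Fin 3) (Fin 3) 𝕜 → ℝ)))
    (hl : ∀ t ∈ l, Continuous t.2)
    (h : ∀ (p : HermCoord 𝕜) (X : Matrix (Fin 3) (Fin 3) 𝕜), 0 < p.1 → 0 < p.2.2.2.1 →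
      0 < p.2.2.2.2.2 → (Ds.map fun D => f (X * D * (cholMat p)ᴴ)).sum
        = Ds.length * (l.map fun t => chiMono t.1 p * t.2 X).sum) :
    (l.map fun t => chiVal 𝕜 (k + 3 * finrank ℝ 𝕜 / 2) t.1 * ∫ x, t.2 (vmat x) ∂muX 𝕜 k).sum
      = muMass 𝕜 k * v := by
  set κ : ℝ := k + 3 * finrank ℝ 𝕜 / 2 with hκ
  have hκ1 : -1 < κ := neg_one_lt_kappa k
  have h1 : HasInt ((chi 𝕜 κ).prod (muX 𝕜 k))
      (fun q => (Ds.map fun D => f (vmat q.2 * D * (cholMat q.1)ᴴ)).sum)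
      (Ds.map fun _ => chiMass 𝕜 k * (gauMass 𝕜 ^ 9 * v)).sum :=
    HasInt.listSum Ds fun D hD => hasInt_cholAct k hf hg (hDs D hD)
  have h2 : HasInt ((chi 𝕜 κ).prod (muX 𝕜 k))
      (fun q => Ds.length * (l.map fun t => chiMono t.1 q.1 * t.2 (vmat q.2)).sum)
      (Ds.length * (l.map fun t => (chiMass 𝕜 κ * chiVal 𝕜 κ t.1) *
        ∫ x, t.2 (vmat x) ∂muX 𝕜 k).sum) := by
    -- The Cholesky variables are independent of X, so every term factors into a known moment and an
    -- unknown integral over `muX`.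
    refine HasInt.const_mul (HasInt.listSum l fun t ht => ?_) _
    exact (hasInt_chiMono hκ1 t.1).mul_prod
      (integrable_muX k ((hl t ht).comp continuous_vmat)).hasInt
  have h3 := h2.congr_ae (g := fun q => (Ds.map fun D => f (vmat q.2 * D * (cholMat q.1)ᴴ)).sum) (by
    filter_upwards [Measure.quasiMeasurePreserving_fst.ae (ae_chi_pos (𝕜 := 𝕜) κ)] with q hq
    exact (h q.1 (vmat q.2) hq.1 hq.2.1 hq.2.2).symm)
  have h4 := h3.unique h1
  have hlen : (Ds.length : ℝ) ≠ 0 := by simpa using hne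
  have h5 := chiMass_pos (𝕜 := 𝕜) hκ1
  simp only [List.map_const', List.sum_replicate, nsmul_eq_mul] at h4
  have h6 := mul_left_cancel₀ hlen h4
  have h7 : (l.map fun t => (chiMass 𝕜 κ * chiVal 𝕜 κ t.1) * ∫ x, t.2 (vmat x) ∂muX 𝕜 k).sum
      = chiMass 𝕜 κ * (l.map fun t => chiVal 𝕜 κ t.1 * ∫ x, t.2 (vmat x) ∂muX 𝕜 k).sum := by
    rw [← List.sum_map_mul_left]
    simp only [mul_assoc]
  rw [h7] at h6
  rw [muMass, ← hκ]
  field_simp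
  linarith

/-- The squared absolute value of an entry. -/
noncomputable def nx (X : Matrix (Fin 3) (Fin 3) 𝕜) (q : Fin 3 × Fin 3) : ℝ := ‖X q.1 q.2‖ ^ 2

/-- The squared absolute value of a cofactor. -/
noncomputable def ny (X : Matrix (Fin 3) (Fin 3) 𝕜) (q : Fin 3 × Fin 3) : ℝ :=
  ‖X.adjugate q.2 q.1‖ ^ 2

/-- The squared absolute value of the determinant. -/
noncomputable def nd (X : Matrix (Fin 3) (Fin 3) 𝕜) : ℝ := ‖X.det‖ ^ 2

theorem continuous_nx : Continuous (nx (𝕜 := 𝕜)) := by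
  unfold nx
  fun_prop

theorem continuous_ny : Continuous (ny (𝕜 := 𝕜)) :=
  continuous_pi fun q => ((continuous_id.matrix_adjugate.matrix_elem q.2 q.1).norm).pow 2

theorem continuous_nd : Continuous (nd (𝕜 := 𝕜)) := (continuous_id.matrix_det.norm).pow 2

/-- Rows and columns can be permuted independently. Cofactors are permuted up to a factor det U ·
det V of modulus 1, invisible in their squared absolute values. -/
theorem integral_muX_perm (k : ℕ) (σ τ : Equiv.Perm (Fin 3))
    {F : (Fin 3 × Fin 3 → ℝ) → (Fin 3 × Fin 3 → ℝ) → ℝ → ℝ}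
    (hF : Continuous fun q : (Fin 3 × Fin 3 → ℝ) × (Fin 3 × Fin 3 → ℝ) × ℝ => F q.1 q.2.1 q.2.2) :
    ∫ x, F (nx (vmat x) ∘ Prod.map σ τ) (ny (vmat x) ∘ Prod.map σ τ) (nd (vmat x)) ∂muX 𝕜 k
      = ∫ x, F (nx (vmat x)) (ny (vmat x)) (nd (vmat x)) ∂muX 𝕜 k := by
  set U : Matrix (Fin 3) (Fin 3) 𝕜 := (1 : Matrix (Fin 3) (Fin 3) 𝕜).submatrix σ id with hU
  set V : Matrix (Fin 3) (Fin 3) 𝕜 := (1 : Matrix (Fin 3) (Fin 3) 𝕜).submatrix id τ with hV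
  have hUU : U * Uᴴ = 1 := by
    ext i j
    simp [hU, mul_apply, one_apply, eq_comm]
  have hVV : Vᴴ * V = 1 := by
    ext i j
    simp [hV, mul_apply, one_apply, eq_comm]
  have hX : ∀ X : Matrix (Fin 3) (Fin 3) 𝕜, U * X * V = X.submatrix σ τ := by
    intro X
    ext i j
    simp [hU, hV, mul_apply, one_apply]
  have hUd : ‖U.det‖ ^ 2 = 1 := by
    have := congrArg det hUU
    rw [det_mul, det_conjTranspose, det_one, RCLike.star_def, RCLike.mul_conj] at this
    exact_mod_cast this
  have hVd : ‖V.det‖ ^ 2 = 1 := by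
    have := congrArg det hVV
    rw [det_mul, det_conjTranspose, det_one, RCLike.star_def, RCLike.conj_mul] at this
    exact_mod_cast this
  have hUa : U.adjugate = U.det • Uᴴ := by
    calc U.adjugate = U.adjugate * (U * Uᴴ) := by rw [hUU, mul_one]
      _ = U.det • Uᴴ := by rw [← mul_assoc, adjugate_mul, smul_mul, one_mul]
  have hVa : V.adjugate = V.det • Vᴴ := by
    calc V.adjugate = (Vᴴ * V) * V.adjugate := by rw [hVV, one_mul]
      _ = V.det • Vᴴ := by rw [mul_assoc, mul_adjugate, Matrix.mul_smul, mul_one]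
  have e1 : ∀ X : Matrix (Fin 3) (Fin 3) 𝕜, nx (U * X * V) = nx X ∘ Prod.map σ τ := by
    intro X
    rw [hX]
    rfl
  have e2 : ∀ X : Matrix (Fin 3) (Fin 3) 𝕜, ny (U * X * V) = ny X ∘ Prod.map σ τ := by
    intro X
    funext q
    have : (U * X * V).adjugate q.2 q.1 = V.det * U.det * X.adjugate (τ q.2) (σ q.1) := by
      rw [adjugate_mul_distrib, adjugate_mul_distrib, hUa, hVa]
      simp [hU, hV, mul_apply, one_apply]
      ring
    rw [ny, this, norm_mul, norm_mul, mul_pow, mul_pow, hUd, hVd]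
    simp [ny]
  have e3 : ∀ X : Matrix (Fin 3) (Fin 3) 𝕜, nd (U * X * V) = nd X := by
    intro X
    rw [nd, det_mul, det_mul, norm_mul, norm_mul, mul_pow, mul_pow, hUd, hVd, nd]
    ring
  have := integral_muX_sandwich k (U := U) (V := V) (mul_eq_one_comm.1 hUU)
    (mul_eq_one_comm.1 hVV) (f := fun X => F (nx X) (ny X) (nd X))
    (hF.comp (continuous_nx.prodMk (continuous_ny.prodMk continuous_nd)))
  simpa only [e1, e2, e3] using this

/-- With S = XᴴFX one has det(F - S) = det F - tr(adj F · S) + tr(F · adj S) - det S. Because F is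
diagonal, only diagonal entries of S and of adj S = adj X · adj F · (adj X)ᴴ matter, and these are
sums of squared absolute values. -/
theorem cDet_eq (f : Fin 3 → ℝ) (X : Matrix (Fin 3) (Fin 3) 𝕜) : cDet f X = f 0 * f 1 * f 2
    - ∑ i, ∑ j, f i * (![f 1 * f 2, f 0 * f 2, f 0 * f 1] j) * nx X (i, j)
    + ∑ i, ∑ j, f j * (![f 1 * f 2, f 0 * f 2, f 0 * f 1] i) * ny X (i, j)
    - f 0 * f 1 * f 2 * nd X := by
  set F : Matrix (Fin 3) (Fin 3) 𝕜 := diagonal (fun i => (f i : 𝕜)) with hF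
  set q : Fin 3 → ℝ := ![f 1 * f 2, f 0 * f 2, f 0 * f 1] with hq
  have hFa : F.adjugate = diagonal (fun i => (q i : 𝕜)) := by
    rw [hF, adjugate_fin_three]
    ext i j
    fin_cases i <;> fin_cases j <;> simp [hq, diagonal]
  set S := Xᴴ * F * X with hS
  have h1 : ∀ j, S j j = ((∑ i, f i * nx X (i, j) : ℝ) : 𝕜) := by
    intro j
    rw [hS, mul_assoc, mul_apply]
    simp only [hF, diagonal_mul, conjTranspose_apply, nx]
    push_cast
    refine Finset.sum_congr rfl fun i _ => ?_
    rw [← RCLike.conj_mul, RCLike.star_def]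
    ring
  have h2 : ∀ j, S.adjugate j j = ((∑ i, q i * ny X (i, j) : ℝ) : 𝕜) := by
    intro j
    rw [hS, adjugate_mul_distrib, adjugate_mul_distrib, hFa, ← adjugate_conjTranspose, mul_apply]
    simp only [diagonal_mul, conjTranspose_apply, ny]
    push_cast
    refine Finset.sum_congr rfl fun i _ => ?_
    rw [← RCLike.mul_conj, RCLike.star_def]
    ring
  have h3 : S.det = ((f 0 * f 1 * f 2 * nd X : ℝ) : 𝕜) := by
    rw [hS, det_mul, det_mul, det_conjTranspose, hF, det_diagonal, nd, Fin.prod_univ_three]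
    push_cast
    rw [← RCLike.conj_mul, RCLike.star_def]
    ring
  have h4 : (F - S).det = (f 0 : 𝕜) * f 1 * f 2 - (q 0 * S 0 0 + q 1 * S 1 1 + q 2 * S 2 2)
      + (f 0 * S.adjugate 0 0 + f 1 * S.adjugate 1 1 + f 2 * S.adjugate 2 2) - S.det := by
    rw [det_fin_three, det_fin_three, adjugate_fin_three]
    simp [hF, hq]
    ring
  have h5 : (F - S).det = ((f 0 * f 1 * f 2 - ∑ i, ∑ j, f i * q j * nx X (i, j)
      + ∑ i, ∑ j, f j * q i * ny X (i, j) - f 0 * f 1 * f 2 * nd X : ℝ) : 𝕜) := by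
    rw [h4, h1, h1, h1, h2, h2, h2, h3]
    simp only [Fin.sum_univ_three]
    push_cast
    ring
  rw [cDet, rdet, h5, RCLike.ofReal_re]

end Transfer

open Matrix Module
open scoped ENNReal Kronecker

/-! ### Gaussian second moments of entries, minors and the determinant -/

section GaussianNorms

variable {𝕜 : Type*} [RCLike 𝕜]

theorem integrable_gau_id : Integrable (fun z : 𝕜 => ((Real.exp (-‖z‖ ^ 2) : ℝ) : 𝕜) * z)
    Measure.addHaar := by
  have h0 := (hasInt_gau_iff.1 (hasInt_gau (𝕜 := 𝕜) 0)).1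
  have h1 := (hasInt_gau_iff.1 (hasInt_gau (𝕜 := 𝕜) 1)).1
  refine (h0.add h1).mono' (by fun_prop) (Filter.Eventually.of_forall fun z => ?_)
  simp only [norm_mul, RCLike.norm_ofReal, abs_of_pos (Real.exp_pos _), Pi.add_apply, pow_zero,
    pow_one, ← mul_add]
  refine mul_le_mul_of_nonneg_left ?_ (Real.exp_pos _).le
  nlinarith [sq_nonneg (‖z‖ - 1)]

theorem integral_gau_id : ∫ z : 𝕜, ((Real.exp (-‖z‖ ^ 2) : ℝ) : 𝕜) * z ∂Measure.addHaar = 0 := by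
  have h := integral_neg_eq_self (fun z : 𝕜 => ((Real.exp (-‖z‖ ^ 2) : ℝ) : 𝕜) * z)
    Measure.addHaar
  simp only [norm_neg, mul_neg, integral_neg] at h
  exact self_eq_neg.1 h.symm

theorem integrable_gau_conj : Integrable (fun z : 𝕜 => ((Real.exp (-‖z‖ ^ 2) : ℝ) : 𝕜) * star z)
    Measure.addHaar := by
  refine integrable_gau_id.norm.mono' (by fun_prop) (Filter.Eventually.of_forall fun z => ?_)
  simp

/-- A factor of the integrand in `hasInt_gauEnt_cross`. -/
noncomputable def crossFactor (a b : Prop) [Decidable a] [Decidable b] (z : 𝕜) : 𝕜 :=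
  (if a then z else 1) * (if b then star z else 1)

theorem integrable_crossFactor (a b : Prop) [Decidable a] [Decidable b] :
    Integrable (fun z : 𝕜 => ((Real.exp (-‖z‖ ^ 2) : ℝ) : 𝕜) * crossFactor a b z)
      Measure.addHaar := by
  have h0 := (hasInt_gau_iff.1 (hasInt_gau (𝕜 := 𝕜) 0)).1.ofReal (𝕜 := 𝕜)
  have h1 := (hasInt_gau_iff.1 (hasInt_gau (𝕜 := 𝕜) 1)).1.ofReal (𝕜 := 𝕜)
  unfold crossFactor
  split_ifs
  · refine h1.congr (Filter.Eventually.of_forall fun z => ?_)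
    simp [RCLike.mul_conj]
  · simpa using integrable_gau_id
  · simpa using integrable_gau_conj
  · simpa using h0

/-- The hypothesis excludes a lone conjugate. Distinct sets S and T of equal size always have an
element of S outside T, so that case is never needed to see that a mixed moment vanishes. -/
theorem integral_crossFactor (a b : Prop) [Decidable a] [Decidable b] (h : b → a) :
    ∫ z : 𝕜, ((Real.exp (-‖z‖ ^ 2) : ℝ) : 𝕜) * crossFactor a b z ∂Measure.addHaar
      = ((gauMass 𝕜 * (if a then (if b then (finrank ℝ 𝕜 : ℝ) / 2 else 0) else 1) : ℝ) : 𝕜) := by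
  have h0 := (hasInt_gau_iff.1 (hasInt_gau (𝕜 := 𝕜) 0)).2
  have h1 := (hasInt_gau_iff.1 (hasInt_gau (𝕜 := 𝕜) 1)).2
  simp only [rising, pow_zero, pow_one, Finset.range_zero, Finset.prod_empty, mul_one,
    Finset.range_one, Finset.prod_singleton, Nat.cast_zero, add_zero] at h0 h1
  unfold crossFactor
  by_cases ha : a
  · by_cases hb : b
    · simp only [ha, hb, if_true]
      rw [← h1, ← integral_ofReal]
      congr 1
      funext z
      rw [RCLike.star_def, RCLike.mul_conj]
      push_cast
      ring
    · simp only [ha, hb, if_true, if_false, mul_one, mul_zero]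
      rw [integral_gau_id]
      simp
  · have hb : ¬ b := fun hb => ha (h hb)
    simp only [ha, hb, if_false, mul_one]
    rw [integral_ofReal, h0]

/-- Distinct square-free monomials of the same degree are orthogonal: some variable occurs in only
one of them and has mean zero. -/
theorem hasInt_gauEnt_cross {m : ℕ} (S T : Finset (Fin 3 × Fin 3)) (hS : S.card = m)
    (hT : T.card = m) : HasInt (gauEnt 𝕜)
      (fun x => RCLike.re ((∏ q ∈ S, x q) * star (∏ q ∈ T, x q)))
      (gauMass 𝕜 ^ 9 * if S = T then ((finrank ℝ 𝕜 : ℝ) / 2) ^ m else 0) := by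
  have key : HasInt (gauEnt 𝕜)
      (fun x => RCLike.re ((∏ q ∈ S, x q) * star (∏ q ∈ T, x q)))
      (RCLike.re (∏ q, ∫ z : 𝕜, ((Real.exp (-‖z‖ ^ 2) : ℝ) : 𝕜) *
        crossFactor (q ∈ S) (q ∈ T) z ∂Measure.addHaar)) := by
    rw [hasInt_gauEnt_iff]
    have e : ∀ x : Ent 𝕜, Real.exp (-hs x) * RCLike.re ((∏ q ∈ S, x q) * star (∏ q ∈ T, x q))
        = RCLike.re (∏ q, ((Real.exp (-‖x q‖ ^ 2) : ℝ) : 𝕜) *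
          crossFactor (q ∈ S) (q ∈ T) (x q)) := by
      intro x
      unfold crossFactor
      rw [Finset.prod_mul_distrib, Finset.prod_mul_distrib, Finset.prod_ite_mem,
        Finset.prod_ite_mem, Finset.univ_inter, Finset.univ_inter, ← RCLike.ofReal_prod,
        ← Real.exp_sum, Finset.sum_neg_distrib, ← hs, RCLike.re_ofReal_mul, star_prod]
    simp only [e]
    have hi : Integrable (fun x : Ent 𝕜 => ∏ q, ((Real.exp (-‖x q‖ ^ 2) : ℝ) : 𝕜) *
        crossFactor (q ∈ S) (q ∈ T) (x q)) (entVol 𝕜) :=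
      Integrable.fintype_prod fun q => integrable_crossFactor (q ∈ S) (q ∈ T)
    refine ⟨hi.re, ?_⟩
    rw [integral_re hi]
    congr 1
    exact integral_fintype_prod_eq_prod (μ := fun _ => Measure.addHaar)
      fun (q : Fin 3 × Fin 3) (z : 𝕜) => ((Real.exp (-‖z‖ ^ 2) : ℝ) : 𝕜) *
        crossFactor (q ∈ S) (q ∈ T) z
  refine key.congr (fun _ => rfl) ?_
  by_cases hST : S = T
  · subst hST
    rw [if_pos rfl]
    have : ∀ q, ∫ z : 𝕜, ((Real.exp (-‖z‖ ^ 2) : ℝ) : 𝕜) * crossFactor (q ∈ S) (q ∈ S) z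
        ∂Measure.addHaar
        = ((gauMass 𝕜 * (if q ∈ S then (finrank ℝ 𝕜 : ℝ) / 2 else 1) : ℝ) : 𝕜) := by
      intro q
      rw [integral_crossFactor _ _ id]
      by_cases hq : q ∈ S <;> simp [hq]
    simp only [this]
    rw [← RCLike.ofReal_prod, RCLike.ofReal_re, Finset.prod_mul_distrib, Finset.prod_ite_mem,
      Finset.univ_inter, Finset.prod_const, Finset.prod_const, hS]
    simp
  · rw [if_neg hST, mul_zero]
    obtain ⟨q, hqS, hqT⟩ : ∃ q ∈ S, q ∉ T := by
      by_contra! h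
      exact hST (Finset.eq_of_subset_of_card_le h (by omega))
    rw [Finset.prod_eq_zero (Finset.mem_univ q), map_zero]
    rw [integral_crossFactor _ _ (fun h => absurd h hqT)]
    simp [hqS, hqT]

/-- The second moment of a multilinear homogeneous polynomial in Gaussian variables. -/
theorem hasInt_gauEnt_normSq {ι : Type*} [Fintype ι] [DecidableEq ι] {m : ℕ} (c : ι → ℝ)
    (S : ι → Finset (Fin 3 × Fin 3)) (hS : Function.Injective S) (hm : ∀ a, (S a).card = m) :
    HasInt (gauEnt 𝕜) (fun x => ‖∑ a, (c a : 𝕜) * ∏ q ∈ S a, x q‖ ^ 2)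
      (gauMass 𝕜 ^ 9 * ((∑ a, c a ^ 2) * ((finrank ℝ 𝕜 : ℝ) / 2) ^ m)) := by
  refine (HasInt.sum Finset.univ fun a _ => HasInt.sum Finset.univ fun b _ =>
    (hasInt_gauEnt_cross (𝕜 := 𝕜) (S a) (S b) (hm a) (hm b)).const_mul (c a * c b)).congr
    (fun x => ?_) ?_
  · have h1 : ((‖∑ a, (c a : 𝕜) * ∏ q ∈ S a, x q‖ ^ 2 : ℝ) : 𝕜)
        = ∑ a, ∑ b, ((c a * c b : ℝ) : 𝕜) * ((∏ q ∈ S a, x q) * star (∏ q ∈ S b, x q)) := by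
      push_cast
      rw [← RCLike.mul_conj, map_sum, Finset.sum_mul_sum]
      refine Finset.sum_congr rfl fun a _ => Finset.sum_congr rfl fun b _ => ?_
      rw [map_mul, RCLike.conj_ofReal, RCLike.star_def]
      ring
    have h2 := congrArg RCLike.re h1
    rw [RCLike.ofReal_re] at h2
    rw [h2]
    simp only [map_sum, RCLike.re_ofReal_mul]
  · simp only [hS.eq_iff]
    simp only [mul_ite, mul_zero, Finset.sum_ite_eq, Finset.mem_univ, if_true]
    rw [Finset.sum_mul, Finset.mul_sum]
    exact Finset.sum_congr rfl fun a _ => by ring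

theorem hasInt_gauEnt_entry : HasInt (gauEnt 𝕜) (fun x => nx (vmat x) (0, 0))
    (gauMass 𝕜 ^ 9 * (finrank ℝ 𝕜 / 2 : ℝ)) := by
  refine (hasInt_gauEnt_normSq (𝕜 := 𝕜) (m := 1) (fun _ : Fin 1 => 1) ![{(0, 0)}] (by decide)
    (by decide)).congr (fun x => ?_) (by simp)
  simp [nx, vmat]

theorem hasInt_gauEnt_minor : HasInt (gauEnt 𝕜) (fun x => ny (vmat x) (0, 2))
    (gauMass 𝕜 ^ 9 * (2 * (finrank ℝ 𝕜 / 2 : ℝ) ^ 2)) := by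
  refine (hasInt_gauEnt_normSq (𝕜 := 𝕜) (m := 2) (![1, -1] : Fin 2 → ℝ)
    ![{(1, 0), (2, 1)}, {(1, 1), (2, 0)}] (by decide) (by decide)).congr (fun x => ?_) ?_
  · rw [ny, adjugate_fin_three]
    simp [vmat, Fin.sum_univ_two, ← sub_eq_add_neg]
  · norm_num [Fin.sum_univ_two]

theorem hasInt_gauEnt_det : HasInt (gauEnt 𝕜) (fun x => nd (vmat x))
    (gauMass 𝕜 ^ 9 * (6 * (finrank ℝ 𝕜 / 2 : ℝ) ^ 3)) := by
  refine (hasInt_gauEnt_normSq (𝕜 := 𝕜) (m := 3) (![1, -1, -1, 1, 1, -1] : Fin 6 → ℝ)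
    ![{(0, 0), (1, 1), (2, 2)}, {(0, 0), (1, 2), (2, 1)}, {(0, 1), (1, 0), (2, 2)},
      {(0, 1), (1, 2), (2, 0)}, {(0, 2), (1, 0), (2, 1)}, {(0, 2), (1, 1), (2, 0)}]
    (by decide) (by decide)).congr (fun x => ?_) ?_
  · rw [nd, det_fin_three]
    congr 2
    simp [vmat, Fin.sum_univ_six]
    ring
  · simp [Fin.sum_univ_six]
    norm_num

end GaussianNorms

/-! ### First moments of entries, minors and the determinant of a contraction -/

section ContractionNorms

variable {𝕜 : Type*} [RCLike 𝕜]

theorem mul_cholMat_zero (M : Matrix (Fin 3) (Fin 3) 𝕜) (p : HermCoord 𝕜) (i : Fin 3) :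
    (M * (cholMat p)ᴴ) i 0 = (√p.1 : ℝ) * M i 0 := by
  simp [mul_apply, cholMat, Fin.sum_univ_three, mul_comm]

theorem mul_cholMat_one (M : Matrix (Fin 3) (Fin 3) 𝕜) (p : HermCoord 𝕜) (i : Fin 3) :
    (M * (cholMat p)ᴴ) i 1 = star p.2.1 * M i 0 + (√p.2.2.2.1 : ℝ) * M i 1 := by
  simp [mul_apply, cholMat, Fin.sum_univ_three, mul_comm]

theorem mul_cholMat_two (M : Matrix (Fin 3) (Fin 3) 𝕜) (p : HermCoord 𝕜) (i : Fin 3) :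
    (M * (cholMat p)ᴴ) i 2 = star p.2.2.1 * M i 0 + star p.2.2.2.2.1 * M i 1
      + (√p.2.2.2.2.2 : ℝ) * M i 2 := by
  simp [mul_apply, cholMat, Fin.sum_univ_three, mul_comm]

theorem adjugate_mul_cholMat_two (M : Matrix (Fin 3) (Fin 3) 𝕜) (p : HermCoord 𝕜) (i : Fin 3) :
    (M * (cholMat p)ᴴ).adjugate 2 i = (√p.1 : ℝ) * (√p.2.2.2.1 : ℝ) * M.adjugate 2 i := by
  rw [adjugate_mul_distrib, adjugate_fin_three (cholMat p)ᴴ]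
  simp [mul_apply, cholMat, Fin.sum_univ_three]

theorem adjugate_mul_cholMat_one (M : Matrix (Fin 3) (Fin 3) 𝕜) (p : HermCoord 𝕜) (i : Fin 3) :
    (M * (cholMat p)ᴴ).adjugate 1 i = (√p.1 : ℝ) * ((√p.2.2.2.2.2 : ℝ) * M.adjugate 1 i
      - star p.2.2.2.2.1 * M.adjugate 2 i) := by
  rw [adjugate_mul_distrib, adjugate_fin_three (cholMat p)ᴴ]
  simp [mul_apply, cholMat, Fin.sum_univ_three]
  ring

theorem norm_ofReal_sqrt_sq {a : ℝ} (ha : 0 ≤ a) : ‖((√a : ℝ) : 𝕜)‖ ^ 2 = a := by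
  rw [RCLike.norm_ofReal, sq_abs, Real.sq_sqrt ha]

theorem nx_mul_cholMat_zero (M : Matrix (Fin 3) (Fin 3) 𝕜) {p : HermCoord 𝕜} (h1 : 0 < p.1)
    (i : Fin 3) : nx (M * (cholMat p)ᴴ) (i, 0) = p.1 * nx M (i, 0) := by
  rw [nx, mul_cholMat_zero, norm_mul, mul_pow, norm_ofReal_sqrt_sq h1.le]
  rfl

theorem ny_mul_cholMat_two (M : Matrix (Fin 3) (Fin 3) 𝕜) {p : HermCoord 𝕜} (h1 : 0 < p.1)
    (h2 : 0 < p.2.2.2.1) (i : Fin 3) :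
    ny (M * (cholMat p)ᴴ) (i, 2) = p.1 * p.2.2.2.1 * ny M (i, 2) := by
  rw [ny, adjugate_mul_cholMat_two, norm_mul, norm_mul, mul_pow, mul_pow,
    norm_ofReal_sqrt_sq h1.le, norm_ofReal_sqrt_sq h2.le]
  rfl

theorem nd_mul_cholMat (M : Matrix (Fin 3) (Fin 3) 𝕜) {p : HermCoord 𝕜} (h1 : 0 < p.1)
    (h2 : 0 < p.2.2.2.1) (h3 : 0 < p.2.2.2.2.2) :
    nd (M * (cholMat p)ᴴ) = p.1 * p.2.2.2.1 * p.2.2.2.2.2 * nd M := by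
  rw [nd, det_mul, det_conjTranspose, norm_mul, norm_star, det_cholMat, mul_pow]
  push_cast
  rw [norm_mul, norm_mul, mul_pow, mul_pow,
    norm_ofReal_sqrt_sq h1.le, norm_ofReal_sqrt_sq h2.le, norm_ofReal_sqrt_sq h3.le, nd]
  ring

/-- The version of `integral_muX_of_gauEnt` with a single monomial. -/
theorem integral_muX_of_gauEnt_mono (k : ℕ) {f : Matrix (Fin 3) (Fin 3) 𝕜 → ℝ} (hf : Continuous f)
    {v : ℝ} (hg : HasInt (gauEnt 𝕜) (fun x => f (vmat x)) (gauMass 𝕜 ^ 9 * v))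
    (t : ℕ × ℕ × ℕ × ℕ × ℕ × ℕ)
    (h : ∀ (p : HermCoord 𝕜) (X : Matrix (Fin 3) (Fin 3) 𝕜), 0 < p.1 → 0 < p.2.2.2.1 →
      0 < p.2.2.2.2.2 → f (X * (cholMat p)ᴴ) = chiMono t p * f X) :
    chiVal 𝕜 (k + 3 * finrank ℝ 𝕜 / 2) t * ∫ x, f (vmat x) ∂muX 𝕜 k = muMass 𝕜 k * v := by
  simpa using integral_muX_of_gauEnt k hf hg [1] (by simp) (by simp) [(t, f)] (by simpa using hf)
    (fun p X h1 h2 h3 => by simpa using h p X h1 h2 h3)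

theorem integral_one_muX (k : ℕ) : ∫ _, (1 : ℝ) ∂muX 𝕜 k = muMass 𝕜 k := by
  have h : HasInt (gauEnt 𝕜) (fun _ => 1) (gauMass 𝕜 ^ 9 * 1) := by
    refine (hasInt_gauEnt (𝕜 := 𝕜) fun _ => hasInt_gau 0).congr (fun x => by simp) ?_
    simp [rising]
  have := integral_muX_of_gauEnt_mono k (f := fun _ => 1) continuous_const h 0
    (by simp [chiMono])
  simpa [chiVal, rising] using this

/-- By symmetry q may be taken in the first column, which right multiplication by Lᴴ merely scales
by √a. -/
theorem integral_nx_muX (k : ℕ) (q : Fin 3 × Fin 3) :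
    chiVal 𝕜 (k + 3 * finrank ℝ 𝕜 / 2) (1, 0, 0, 0, 0, 0) * ∫ x, nx (vmat x) q ∂muX 𝕜 k
      = muMass 𝕜 k * (finrank ℝ 𝕜 / 2) := by
  have h := integral_muX_perm (𝕜 := 𝕜) k (Equiv.swap 0 q.1) (Equiv.swap 0 q.2)
    (F := fun a _ _ => a (0, 0)) (by fun_prop)
  simp only [Function.comp_apply, Prod.map_apply, Equiv.swap_apply_left, Prod.mk.eta] at h
  rw [h]
  refine integral_muX_of_gauEnt_mono k (f := fun X => nx X (0, 0))
    (continuous_pi_iff.1 continuous_nx (0, 0)) hasInt_gauEnt_entry _ fun p X h1 h2 h3 => ?_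
  simp [nx_mul_cholMat_zero X h1, chiMono]

/-- By symmetry the cofactor may be taken in the last column; it is built from the first two columns
of X, and right multiplication by Lᴴ scales it by √(a b). -/
theorem integral_ny_muX (k : ℕ) (q : Fin 3 × Fin 3) :
    chiVal 𝕜 (k + 3 * finrank ℝ 𝕜 / 2) (1, 0, 0, 1, 0, 0) * ∫ x, ny (vmat x) q ∂muX 𝕜 k
      = muMass 𝕜 k * (2 * (finrank ℝ 𝕜 / 2) ^ 2) := by
  have h := integral_muX_perm (𝕜 := 𝕜) k (Equiv.swap 0 q.1) (Equiv.swap 2 q.2)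
    (F := fun _ a _ => a (0, 2)) (by fun_prop)
  simp only [Function.comp_apply, Prod.map_apply, Equiv.swap_apply_left, Prod.mk.eta] at h
  rw [h]
  refine integral_muX_of_gauEnt_mono k (f := fun X => ny X (0, 2))
    (continuous_pi_iff.1 continuous_ny (0, 2)) hasInt_gauEnt_minor _ fun p X h1 h2 h3 => ?_
  simp [ny_mul_cholMat_two X h1 h2, chiMono]

theorem integral_nd_muX (k : ℕ) :
    chiVal 𝕜 (k + 3 * finrank ℝ 𝕜 / 2) (1, 0, 0, 1, 0, 1) * ∫ x, nd (vmat x) ∂muX 𝕜 k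
      = muMass 𝕜 k * (6 * (finrank ℝ 𝕜 / 2) ^ 3) := by
  refine integral_muX_of_gauEnt_mono k (f := nd) continuous_nd hasInt_gauEnt_det _
    fun p X h1 h2 h3 => ?_
  simp [nd_mul_cholMat X h1 h2 h3, chiMono, mul_assoc]

theorem rising_pos {s : ℝ} (hs : 0 < s) (j : ℕ) : 0 < rising s j :=
  Finset.prod_pos fun i _ => by positivity

theorem chiVal_pos {κ : ℝ} (hκ : -1 < κ) (t : ℕ × ℕ × ℕ × ℕ × ℕ × ℕ) : 0 < chiVal 𝕜 κ t := by
  have h : 0 < κ + 1 := by linarith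
  have hβ : 0 < finrank ℝ 𝕜 := finrank_pos
  have h1 := rising_pos (s := κ + 1 + finrank ℝ 𝕜) (by positivity)
  have h2 := rising_pos (s := κ + 1 + finrank ℝ 𝕜 / 2) (by positivity)
  have h3 := rising_pos h
  have h4 := rising_pos (s := (finrank ℝ 𝕜 / 2 : ℝ)) (by positivity)
  exact mul_pos (mul_pos (mul_pos (mul_pos (mul_pos (h1 _) (h4 _)) (h4 _)) (h2 _)) (h4 _)) (h3 _)

/-- The coefficients of the first moment of `cDet`. -/
theorem integral_cDet (k : ℕ) (f : Fin 3 → ℝ) : ∫ x, cDet f (vmat x) ∂muX 𝕜 k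
    = muMass 𝕜 k * ((1 - 6 * (finrank ℝ 𝕜 / 2 : ℝ) ^ 3 /
        chiVal 𝕜 (k + 3 * finrank ℝ 𝕜 / 2) (1, 0, 0, 1, 0, 1)) * (f 0 * f 1 * f 2)
      + (2 * (finrank ℝ 𝕜 / 2 : ℝ) ^ 2 / chiVal 𝕜 (k + 3 * finrank ℝ 𝕜 / 2) (1, 0, 0, 1, 0, 0)
        - (finrank ℝ 𝕜 / 2 : ℝ) / chiVal 𝕜 (k + 3 * finrank ℝ 𝕜 / 2) (1, 0, 0, 0, 0, 0))
        * ((f 0 + f 1 + f 2) * (f 1 * f 2 + f 0 * f 2 + f 0 * f 1))) := by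
  set κ : ℝ := k + 3 * finrank ℝ 𝕜 / 2 with hκ
  have hpos := chiVal_pos (𝕜 := 𝕜) (neg_one_lt_kappa (𝕜 := 𝕜) k)
  have hx : ∀ q, HasInt (muX 𝕜 k) (fun x => nx (vmat x) q)
      (muMass 𝕜 k * (finrank ℝ 𝕜 / 2) / chiVal 𝕜 κ (1, 0, 0, 0, 0, 0)) := fun q =>
    ⟨integrable_muX k ((continuous_pi_iff.1 continuous_nx q).comp continuous_vmat), by
      rw [eq_div_iff (hpos _).ne', mul_comm, integral_nx_muX]⟩
  have hy : ∀ q, HasInt (muX 𝕜 k) (fun x => ny (vmat x) q)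
      (muMass 𝕜 k * (2 * (finrank ℝ 𝕜 / 2) ^ 2) / chiVal 𝕜 κ (1, 0, 0, 1, 0, 0)) := fun q =>
    ⟨integrable_muX k ((continuous_pi_iff.1 continuous_ny q).comp continuous_vmat), by
      rw [eq_div_iff (hpos _).ne', mul_comm, integral_ny_muX]⟩
  have hd : HasInt (muX 𝕜 k) (fun x => nd (vmat x))
      (muMass 𝕜 k * (6 * (finrank ℝ 𝕜 / 2) ^ 3) / chiVal 𝕜 κ (1, 0, 0, 1, 0, 1)) :=
    ⟨integrable_muX k (continuous_nd.comp continuous_vmat), by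
      rw [eq_div_iff (hpos _).ne', mul_comm, integral_nd_muX]⟩
  have h1 : HasInt (muX 𝕜 k) (fun _ => 1) (muMass 𝕜 k) :=
    ⟨integrable_muX k continuous_const, integral_one_muX k⟩
  refine Eq.trans ?_ ((((h1.const_mul (f 0 * f 1 * f 2)).sub
    (HasInt.sum Finset.univ fun i _ => HasInt.sum Finset.univ fun j _ => (hx (i, j)).const_mul
      (f i * (![f 1 * f 2, f 0 * f 2, f 0 * f 1] j)))).add
    (HasInt.sum Finset.univ fun i _ => HasInt.sum Finset.univ fun j _ => (hy (i, j)).const_mul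
      (f j * (![f 1 * f 2, f 0 * f 2, f 0 * f 1] i)))).sub
    (hd.const_mul (f 0 * f 1 * f 2))).2 |>.trans ?_
  · simp only [cDet_eq, mul_one]
  -- All entries have the same mean, and so do all cofactors, so each double sum factors as e₁ e₂.
  · simp only [Fin.sum_univ_three]
    simp
    ring

end ContractionNorms

open Matrix Module
open scoped ENNReal Kronecker

/-! ### Polar coordinates on a cone -/

section PolarCoordinates

theorem lintegral_comp_smul_haar {E : Type*} [NormedAddCommGroup E] [NormedSpace ℝ E]
    [FiniteDimensional ℝ E] [MeasurableSpace E] [BorelSpace E] (μ : Measure E)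
    [μ.IsAddHaarMeasure] {t : ℝ} (ht : 0 < t) {F : E → ℝ≥0∞} (hF : Measurable F) :
    ∫⁻ x, F (t • x) ∂μ = ENNReal.ofReal ((t ^ finrank ℝ E)⁻¹) * ∫⁻ x, F x ∂μ := by
  rw [← lintegral_map (f := F) (g := fun x => t • x) hF (by fun_prop),
    Measure.map_addHaar_smul μ ht.ne', lintegral_smul_measure, abs_of_pos (by positivity),
    smul_eq_mul]

/-- Polar coordinates for a cone with section parallel to `E`. -/
theorem exists_map_polar {E P : Type*} [NormedAddCommGroup E] [NormedSpace ℝ E]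
    [FiniteDimensional ℝ E] [MeasurableSpace E] [BorelSpace E] (ν : Measure E)
    [ν.IsAddHaarMeasure] [NormedAddCommGroup P] [NormedSpace ℝ P] [FiniteDimensional ℝ P]
    [MeasurableSpace P] [BorelSpace P] (μ : Measure P) [μ.IsAddHaarMeasure] {τ : P → ℝ}
    (hτm : Measurable τ) (L : (ℝ × E) ≃ₗ[ℝ] P) (hτ : ∀ q, τ (L q) = q.1) :
    ∃ c : ℝ, 0 < c ∧ ((gam (finrank ℝ E + 1)).prod ν).map (fun q => L (q.1, q.1 • q.2))
      = ENNReal.ofReal c • μ.withDensity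
        ({w | 0 < τ w}.indicator fun w => ENNReal.ofReal (Real.exp (-τ w))) := by
  have hvol : ((volume : Measure ℝ).prod ν).IsAddHaarMeasure :=
    Measure.prod.instIsAddHaarMeasure _ _
  have hLm : Measurable L := L.toContinuousLinearEquiv.continuous.measurable
  have hmap : (((volume : Measure ℝ).prod ν).map L).IsAddHaarMeasure :=
    L.toContinuousLinearEquiv.isAddHaarMeasure_map _
  have heq := Measure.isAddLeftInvariant_eq_smul (((volume : Measure ℝ).prod ν).map L) μ
  set c := Measure.addHaarScalarFactor (((volume : Measure ℝ).prod ν).map L) μ with hc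
  have hcpos : 0 < c := Measure.addHaarScalarFactor_pos_of_isAddHaarMeasure _ _
  refine ⟨c, hcpos, Measure.ext_of_lintegral _ fun F hF => ?_⟩
  have hdens : Measurable ({w | 0 < τ w}.indicator fun w => ENNReal.ofReal (Real.exp (-τ w))) :=
    (Real.measurable_exp.comp hτm.neg).ennreal_ofReal.indicator
      (measurableSet_lt measurable_const hτm)
  have hQm : Measurable fun q : ℝ × E => L (q.1, q.1 • q.2) := hLm.comp (by fun_prop)
  have hr : ∫⁻ w, F w ∂(ENNReal.ofReal c • μ.withDensity
        ({w | 0 < τ w}.indicator fun w => ENNReal.ofReal (Real.exp (-τ w))))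
      = ∫⁻ w, ({w | 0 < τ w}.indicator fun w => ENNReal.ofReal (Real.exp (-τ w))) w * F w
        ∂(((volume : Measure ℝ).prod ν).map L) := by
    rw [heq, lintegral_smul_measure, ENNReal.ofReal_coe_nnreal,
      lintegral_withDensity_eq_lintegral_mul _ hdens hF, ENNReal.smul_def,
      lintegral_smul_measure]
    rfl
  have hr' := lintegral_map (μ := (volume : Measure ℝ).prod ν) (hdens.mul hF) hLm
  have hr2 := lintegral_prod (μ := (volume : Measure ℝ)) (ν := ν) _
    ((hdens.mul hF).comp hLm).aemeasurable
  simp only [Pi.mul_apply, Function.comp_apply] at hr' hr2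
  rw [hr, hr', hr2, lintegral_map hF hQm, lintegral_prod _ (by fun_prop), lintegral_gam,
    ← lintegral_indicator measurableSet_Ioi]
  refine lintegral_congr fun t => ?_
  by_cases ht : 0 < t
  -- The Gamma parameter dim E + 1 supplies t^(dim E), which cancels the Jacobian of dilating the
  -- section by t.
  · rw [Set.indicator_of_mem (by exact ht), lintegral_comp_smul_haar (F := fun z => F (L (t, z))) ν
      ht (by fun_prop), ← mul_assoc, ← ENNReal.ofReal_mul (by positivity), add_sub_cancel_right,
      Real.rpow_natCast]
    have : ∀ z : E, ({w | 0 < τ w}.indicator fun w => ENNReal.ofReal (Real.exp (-τ w))) (L (t, z))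
        = ENNReal.ofReal (Real.exp (-t)) := by
      intro z
      rw [Set.indicator_of_mem]
      · rw [hτ]
      · simpa [hτ] using ht
    simp only [this]
    rw [lintegral_const_mul' _ _ ENNReal.ofReal_ne_top]
    congr 2
    field_simp
  · rw [Set.indicator_of_notMem (by exact ht)]
    have : ∀ z : E, ({w | 0 < τ w}.indicator fun w => ENNReal.ofReal (Real.exp (-τ w))) (L (t, z))
        = 0 := by
      intro z
      rw [Set.indicator_of_notMem]
      simpa [hτ] using ht
    simp only [this, zero_mul, lintegral_zero]

end PolarCoordinates

/-! ### Coordinates on Hermitian 6×6 matrices and the traceless subspace -/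

section Section

variable {𝕜 : Type*} [RCLike 𝕜]

/-- Coordinates of Hermitian `6 × 6` matrices. -/
abbrev Par (𝕜 : Type*) : Type _ := (HermCoord 𝕜 × HermCoord 𝕜) × Ent 𝕜

variable (𝕜) in
/-- Haar measure on the coordinates. -/
noncomputable abbrev parVol : Measure (Par 𝕜) :=
  ((hermVol 𝕜).prod (hermVol 𝕜)).prod (entVol 𝕜)

/-- The Hermitian matrix with the given coordinates. -/
def parBlk (w : Par 𝕜) : Matrix (Fin 3 ⊕ Fin 3) (Fin 3 ⊕ Fin 3) 𝕜 :=
  blk (hmat w.1.1) (vmat w.2) (hmat w.1.2)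

/-- The enumeration of the six basis vectors by blocks. -/
def sixEquiv : Fin 3 ⊕ Fin 3 ≃ Fin 2 × Fin 3 where
  toFun := Sum.elim (fun b => (0, b)) fun b => (1, b)
  invFun q := if q.1 = 0 then Sum.inl q.2 else Sum.inr q.2
  left_inv := by rintro (b | b) <;> rfl
  right_inv := by rintro ⟨a, b⟩; fin_cases a <;> rfl

/-- `toMatrix`, with rows and columns enumerated by blocks. -/
def HSSpace.toBlk (x : HSSpace 𝕜) : Matrix (Fin 3 ⊕ Fin 3) (Fin 3 ⊕ Fin 3) 𝕜 :=
  x.toMatrix.submatrix sixEquiv sixEquiv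

theorem vmat_entries (M : Matrix (Fin 3) (Fin 3) 𝕜) : vmat (entries M) = M := rfl

theorem parBlk_add (w w' : Par 𝕜) : parBlk (w + w') = parBlk w + parBlk w' := by
  have h : vmat (w.2 + w'.2) = vmat w.2 + vmat w'.2 := rfl
  simp [parBlk, blk, hmat_add, h, fromBlocks_add, conjTranspose_add]

theorem hmat_smul (r : ℝ) (p : HermCoord 𝕜) : hmat (r • p) = r • hmat p := hmatLin.map_smul r p

theorem parBlk_smul (r : ℝ) (w : Par 𝕜) : parBlk (r • w) = r • parBlk w := by
  have h : vmat (r • w.2) = r • vmat w.2 := rfl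
  simp [parBlk, blk, hmat_smul, h, fromBlocks_smul, conjTranspose_smul]

theorem parBlk_isHermitian (w : Par 𝕜) : (parBlk w).IsHermitian :=
  (hmat_isHermitian _).fromBlocks rfl (hmat_isHermitian _)

/-- The point of the Hilbert-Schmidt space with the given coordinates. -/
noncomputable def parLin : Par 𝕜 →ₗ[ℝ] HSSpace 𝕜 where
  toFun w := WithLp.toLp 2 fun q => parBlk w (sixEquiv.symm q.1) (sixEquiv.symm q.2)
  map_add' w w' := by
    ext q
    simp [parBlk_add]
  map_smul' r w := by
    ext q
    simp [parBlk_smul]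

theorem toBlk_parLin (w : Par 𝕜) : (parLin w).toBlk = parBlk w := by
  ext i j
  simp [HSSpace.toBlk, HSSpace.toMatrix, parLin]

/-- The coordinates of a matrix. -/
noncomputable def parCoord : HSSpace 𝕜 →ₗ[ℝ] Par 𝕜 where
  toFun x := ((coordLin x.toBlk.toBlocks₁₁, coordLin x.toBlk.toBlocks₂₂),
    entries x.toBlk.toBlocks₁₂)
  map_add' x y := by
    simp only [Prod.mk_add_mk, ← map_add]
    rfl
  map_smul' r x := by
    simp only [RingHom.id_apply, Prod.smul_mk, ← map_smul]
    rfl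

theorem parBlk_parCoord {x : HSSpace 𝕜} (hx : x.toMatrix.IsHermitian) :
    parBlk (parCoord x) = x.toBlk := by
  have h : x.toBlk.IsHermitian := hx.submatrix _
  rw [← fromBlocks_toBlocks x.toBlk, isHermitian_fromBlocks_iff] at h
  conv_rhs => rw [← fromBlocks_toBlocks x.toBlk]
  simp only [parBlk, parCoord, LinearMap.coe_mk, AddHom.coe_mk, hmat_coordLin h.1,
    hmat_coordLin h.2.2.2, vmat_entries, blk, h.2.1]

theorem toBlk_injective : Function.Injective (HSSpace.toBlk (𝕜 := 𝕜)) := by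
  intro x y h
  ext q
  have := congrFun (congrFun h (sixEquiv.symm q.1)) (sixEquiv.symm q.2)
  simpa [HSSpace.toBlk, HSSpace.toMatrix] using this

theorem parLin_parCoord {x : HSSpace 𝕜} (hx : x.toMatrix.IsHermitian) :
    parLin (parCoord x) = x :=
  toBlk_injective (by rw [toBlk_parLin, parBlk_parCoord hx])

theorem parBlk_injective : Function.Injective (parBlk (𝕜 := 𝕜)) := by
  intro w w' h
  obtain ⟨h1, h2, -, h4⟩ := fromBlocks_inj.1 h
  exact Prod.ext (Prod.ext (hmat_injective h1) (hmat_injective h4))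
    (funext fun q => congrFun (congrFun h2 q.1) q.2)

theorem isHermitian_toMatrix {x : HSSpace 𝕜} : x.toMatrix.IsHermitian ↔ x.toBlk.IsHermitian := by
  refine ⟨fun h => h.submatrix _, fun h => ?_⟩
  have := h.submatrix sixEquiv.symm
  simpa [HSSpace.toBlk, submatrix_submatrix] using this

theorem trace_toBlk (x : HSSpace 𝕜) : x.toBlk.trace = x.toMatrix.trace := by
  simp only [HSSpace.toBlk, trace, diag_apply, submatrix_apply]
  exact sixEquiv.sum_comp fun i => x.toMatrix i i

variable (𝕜) in
/-- The traceless Hermitian matrices. -/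
noncomputable def traceless : Submodule ℝ (HSSpace 𝕜) where
  carrier := {x | x.toMatrix.IsHermitian ∧ x.toMatrix.trace = 0}
  zero_mem' := ⟨isHermitian_zero, trace_zero _ _⟩
  add_mem' {x y} hx hy := by
    have e : (x + y).toMatrix = x.toMatrix + y.toMatrix := rfl
    exact ⟨e ▸ hx.1.add hy.1, by rw [e, trace_add, hx.2, hy.2, add_zero]⟩
  smul_mem' r x hx := by
    have e : (r • x).toMatrix = r • x.toMatrix := rfl
    refine ⟨?_, by rw [e, trace_smul, hx.2, smul_zero]⟩
    rw [e, IsHermitian, conjTranspose_smul, hx.1]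
    simp

variable (𝕜) in
/-- The maximally mixed state. -/
noncomputable def center : HSSpace 𝕜 := WithLp.toLp 2 fun q => if q.1 = q.2 then 6⁻¹ else 0

theorem toMatrix_center : (center 𝕜).toMatrix = (6⁻¹ : ℝ) • 1 := by
  ext i j
  by_cases h : i = j <;>
    simp [HSSpace.toMatrix, center, one_apply, h, Algebra.smul_def,
      map_ofNat (algebraMap ℝ 𝕜) 6]

theorem isHermitian_center : (center 𝕜).toMatrix.IsHermitian := by
  rw [toMatrix_center, IsHermitian, conjTranspose_smul]
  simp

theorem trace_center : (center 𝕜).toMatrix.trace = 1 := by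
  rw [toMatrix_center, trace_smul, trace_one]
  simp [Algebra.smul_def, map_ofNat (algebraMap ℝ 𝕜) 6]

/-- The trace in coordinates. -/
noncomputable def parTr (w : Par 𝕜) : ℝ := rtr (hmat w.1.1) + rtr (hmat w.1.2)

theorem parTr_eq (w : Par 𝕜) : parTr w = RCLike.re (parBlk w).trace := by
  simp [parTr, rtr, parBlk, blk, trace, Fintype.sum_sum_type]

theorem trace_parLin (w : Par 𝕜) : (parLin w).toMatrix.trace = (parTr w : ℝ) := by
  have h := RCLike.conj_eq_iff_re.1 (show star (parBlk w).trace = (parBlk w).trace by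
    rw [← trace_conjTranspose, parBlk_isHermitian w])
  rw [← trace_toBlk, toBlk_parLin, parTr_eq, h]

variable (𝕜) in
/-- Coordinates on the Hermitian matrices adapted to the trace. -/
noncomputable def sectionEquiv : (ℝ × traceless 𝕜) ≃ₗ[ℝ] Par 𝕜 where
  toFun q := parCoord (q.1 • center 𝕜 + q.2)
  invFun w := (parTr w, ⟨parLin w - parTr w • center 𝕜, by
    have e : (parLin w - parTr w • center 𝕜).toMatrix
      = (parLin w).toMatrix - parTr w • (center 𝕜).toMatrix := rfl
    refine ⟨?_, ?_⟩
    · rw [e]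
      refine (isHermitian_toMatrix.2 ?_).sub ?_
      · rw [toBlk_parLin]
        exact parBlk_isHermitian w
      · rw [IsHermitian, conjTranspose_smul, isHermitian_center]
        simp
    · rw [e, trace_sub, trace_smul, trace_parLin, trace_center]
      simp [RCLike.real_smul_eq_coe_mul]⟩)
  map_add' q q' := by
    rw [← map_add]
    congr 1
    simp only [Prod.fst_add, Prod.snd_add, add_smul, Submodule.coe_add]
    abel
  map_smul' r q := by
    rw [RingHom.id_apply, ← map_smul]
    congr 1
    simp only [Prod.smul_fst, Prod.smul_snd, smul_add, Submodule.coe_smul, smul_assoc]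
  left_inv q := by
    have hh : (q.1 • center 𝕜 + (q.2 : HSSpace 𝕜)).toMatrix.IsHermitian := by
      refine IsHermitian.add (A := q.1 • (center 𝕜).toMatrix) (B := (q.2 : HSSpace 𝕜).toMatrix)
        ?_ q.2.2.1
      rw [IsHermitian, conjTranspose_smul, isHermitian_center]
      simp
    have ht : parTr (parCoord (q.1 • center 𝕜 + (q.2 : HSSpace 𝕜))) = q.1 := by
      have h := trace_parLin (parCoord (q.1 • center 𝕜 + (q.2 : HSSpace 𝕜)))
      rw [parLin_parCoord hh] at h
      have e : (q.1 • center 𝕜 + (q.2 : HSSpace 𝕜)).toMatrix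
        = q.1 • (center 𝕜).toMatrix + (q.2 : HSSpace 𝕜).toMatrix := rfl
      rw [e, trace_add, trace_smul, trace_center, q.2.2.2, add_zero,
        RCLike.real_smul_eq_coe_mul, mul_one] at h
      exact (RCLike.ofReal_injective h).symm
    refine Prod.ext ht (Subtype.ext ?_)
    simp only [ht, parLin_parCoord hh, add_sub_cancel_left]
  right_inv w := by
    apply parBlk_injective
    simp only [add_sub_cancel]
    rw [parBlk_parCoord, toBlk_parLin]
    rw [isHermitian_toMatrix, toBlk_parLin]
    exact parBlk_isHermitian w

theorem parTr_sectionEquiv (q : ℝ × traceless 𝕜) : parTr (sectionEquiv 𝕜 q) = q.1 :=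
  congrArg Prod.fst ((sectionEquiv 𝕜).left_inv q)

/-- Each diagonal block has 3 + 3β real coordinates and the off-diagonal block 9β; the trace takes
away one dimension. -/
theorem finrank_traceless : finrank ℝ (traceless 𝕜) = 5 + 15 * finrank ℝ 𝕜 := by
  have h := (sectionEquiv 𝕜).finrank_eq
  rw [Module.finrank_prod, Module.finrank_prod, Module.finrank_prod] at h
  have h1 : finrank ℝ (HermCoord 𝕜) = 3 + 3 * finrank ℝ 𝕜 := by
    unfold HermCoord
    simp only [Module.finrank_prod, Module.finrank_self]
    ring
  have h2 : finrank ℝ (Ent 𝕜) = 9 * finrank ℝ 𝕜 := by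
    rw [Module.finrank_pi_fintype]
    simp
  rw [h1, h2, Module.finrank_self] at h
  omega

end Section

open Matrix Module
open scoped ENNReal Kronecker

/-! ### The cone of positive definite matrices and its unit-trace section -/

section SectionIntegral

variable {𝕜 : Type*} [RCLike 𝕜]

instance : BorelSpace (HermCoord 𝕜) := by unfold HermCoord; infer_instance
instance : SecondCountableTopology (HermCoord 𝕜) := by unfold HermCoord; infer_instance
instance : BorelSpace (HermCoord 𝕜 × HermCoord 𝕜) := Prod.borelSpace
instance : BorelSpace (Par 𝕜) := Prod.borelSpace
instance : MeasurableAdd (HermCoord 𝕜) := inferInstance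
instance : MeasurableAdd (HermCoord 𝕜 × HermCoord 𝕜) :=
  ⟨fun _ => (continuous_const.add continuous_id).measurable,
    fun _ => (continuous_id.add continuous_const).measurable⟩
instance : SigmaFinite (hermVol 𝕜) := inferInstance

/-- Exchange of the off-diagonal blocks. -/
def swapOff (M : Matrix (Fin 3 ⊕ Fin 3) (Fin 3 ⊕ Fin 3) 𝕜) :
    Matrix (Fin 3 ⊕ Fin 3) (Fin 3 ⊕ Fin 3) 𝕜 :=
  fromBlocks M.toBlocks₁₁ M.toBlocks₂₁ M.toBlocks₁₂ M.toBlocks₂₂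

theorem swapOff_smul (r : ℝ) (M : Matrix (Fin 3 ⊕ Fin 3) (Fin 3 ⊕ Fin 3) 𝕜) :
    swapOff (r • M) = r • swapOff M := by
  ext i j
  rcases i with i | i <;> rcases j with j | j <;> rfl

theorem continuous_swapOff : Continuous (swapOff (𝕜 := 𝕜)) :=
  continuous_matrix fun i j => by
    rcases i with i | i <;> rcases j with j | j <;> exact continuous_id.matrix_elem _ _

theorem rdet_real_smul (r : ℝ) (M : Matrix (Fin 3 ⊕ Fin 3) (Fin 3 ⊕ Fin 3) 𝕜) :
    rdet (r • M) = r ^ 6 * rdet M := by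
  rw [rdet, det_smul_of_tower, RCLike.smul_re, rdet]
  simp

/-- The integrand of the moments, on positive definite matrices. -/
noncomputable def momFun (k n : ℕ) (M : Matrix (Fin 3 ⊕ Fin 3) (Fin 3 ⊕ Fin 3) 𝕜) : ℝ :=
  {M : Matrix (Fin 3 ⊕ Fin 3) (Fin 3 ⊕ Fin 3) 𝕜 | M.PosDef}.indicator
    (fun M => rdet M ^ k * rdet (swapOff M) ^ n) M

theorem continuous_momFun_aux (k n : ℕ) :
    Continuous fun M : Matrix (Fin 3 ⊕ Fin 3) (Fin 3 ⊕ Fin 3) 𝕜 =>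
      rdet M ^ k * rdet (swapOff M) ^ n :=
  (continuous_rdet.pow k).mul ((continuous_rdet.comp continuous_swapOff).pow n)

theorem momFun_smul {t : ℝ} (ht : 0 < t) (k n : ℕ)
    (M : Matrix (Fin 3 ⊕ Fin 3) (Fin 3 ⊕ Fin 3) 𝕜) :
    momFun k n (t • M) = t ^ (6 * (k + n)) * momFun k n M := by
  have h : (t • M).PosDef ↔ M.PosDef := by
    refine ⟨fun h => ?_, fun h => h.smul ht⟩
    have := h.smul (inv_pos.2 ht)
    rwa [smul_smul, inv_mul_cancel₀ ht.ne', one_smul] at this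
  unfold momFun
  by_cases hM : M.PosDef
  · rw [Set.indicator_of_mem (by exact h.2 hM), Set.indicator_of_mem (by exact hM), swapOff_smul,
      rdet_real_smul, rdet_real_smul]
    ring
  · rw [Set.indicator_of_notMem (by exact mt h.1 hM), Set.indicator_of_notMem (by exact hM),
      mul_zero]

theorem continuous_toBlk : Continuous (HSSpace.toBlk (𝕜 := 𝕜)) :=
  continuous_matrix fun i j => (EuclideanSpace.proj (𝕜 := 𝕜) (sixEquiv i, sixEquiv j)).continuous

/-- The matrix of unit trace with the given traceless part. -/
noncomputable def secBlk (y : traceless 𝕜) : Matrix (Fin 3 ⊕ Fin 3) (Fin 3 ⊕ Fin 3) 𝕜 :=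
  (center 𝕜 + y).toBlk

theorem continuous_secBlk : Continuous (secBlk (𝕜 := 𝕜)) :=
  continuous_toBlk.comp (by fun_prop)

theorem toBlk_center : (center 𝕜).toBlk = (6⁻¹ : ℝ) • 1 := by
  rw [HSSpace.toBlk, toMatrix_center]
  ext i j
  simp [one_apply]

theorem secBlk_eq (y : traceless 𝕜) : secBlk y = (6⁻¹ : ℝ) • 1 + (y : HSSpace 𝕜).toBlk := by
  rw [← toBlk_center]
  rfl

theorem isHermitian_secBlk (y : traceless 𝕜) : (secBlk y).IsHermitian :=
  isHermitian_toMatrix.1 (IsHermitian.add isHermitian_center y.2.1)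

theorem trace_secBlk (y : traceless 𝕜) : (secBlk y).trace = 1 := by
  have e : (center 𝕜 + (y : HSSpace 𝕜)).toMatrix
    = (center 𝕜).toMatrix + (y : HSSpace 𝕜).toMatrix := rfl
  rw [secBlk, trace_toBlk, e, trace_add, trace_center, y.2.2, add_zero]

theorem parBlk_sectionEquiv (t : ℝ) (y : traceless 𝕜) :
    parBlk (sectionEquiv 𝕜 (t, t • y)) = t • secBlk y := by
  have e : sectionEquiv 𝕜 (t, t • y) = t • parCoord (center 𝕜 + (y : HSSpace 𝕜)) := by
    rw [← map_smul, smul_add]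
    rfl
  rw [e, parBlk_smul, parBlk_parCoord (x := center 𝕜 + (y : HSSpace 𝕜))
    (IsHermitian.add isHermitian_center y.2.1), secBlk]

/-- Diagonal entries are positive with sum 1, and 2×2 principal minors control the others. This
bounds the section, which gives integrability. -/
theorem norm_apply_le_one {M : Matrix (Fin 3 ⊕ Fin 3) (Fin 3 ⊕ Fin 3) 𝕜} (hM : M.PosDef)
    (ht : M.trace = 1) (i j : Fin 3 ⊕ Fin 3) : ‖M i j‖ ≤ 1 := by
  have hd : ∀ i, 0 < RCLike.re (M i i) := fun i => (RCLike.pos_iff.1 hM.diag_pos).1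
  have hs : ∑ i, RCLike.re (M i i) = 1 := by
    have := congrArg RCLike.re ht
    simpa [trace] using this
  have hle : ∀ i, RCLike.re (M i i) ≤ 1 := fun i => by
    rw [← hs]
    exact Finset.single_le_sum (fun j _ => (hd j).le) (Finset.mem_univ i)
  have hreal : ∀ i, M i i = (RCLike.re (M i i) : ℝ) := fun i =>
    (RCLike.conj_eq_iff_re.1 (congrFun (congrFun hM.1 i) i)).symm
  by_cases hij : i = j
  · subst hij
    rw [hreal, RCLike.norm_ofReal, abs_of_pos (hd i)]
    exact hle i
  · have h := (PosDef.submatrix hM (e := ![i, j])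
      (by intro a b; fin_cases a <;> fin_cases b <;> simp [hij, Ne.symm hij])).det_pos
    have hc : M j i = star (M i j) := (congrFun (congrFun hM.1 j) i).symm
    have e : (M.submatrix ![i, j] ![i, j]).det
        = ((RCLike.re (M i i) * RCLike.re (M j j) - ‖M i j‖ ^ 2 : ℝ) : 𝕜) := by
      rw [det_fin_two]
      simp only [submatrix_apply, cons_val_zero, cons_val_one, hc, RCLike.star_def,
        RCLike.mul_conj]
      rw [hreal i, hreal j]
      simp
    rw [e, RCLike.ofReal_pos] at h
    nlinarith [norm_nonneg (M i j), hd i, hd j, hle i, hle j]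

theorem posDef_secBlk_subset : {y : traceless 𝕜 | (secBlk y).PosDef} ⊆
    Metric.closedBall 0 (6 + ‖center 𝕜‖) := by
  intro y hy
  have h1 : ‖center 𝕜 + (y : HSSpace 𝕜)‖ ≤ 6 := by
    refine le_of_sq_le_sq ?_ (by norm_num)
    rw [EuclideanSpace.norm_sq_eq]
    calc ∑ q, ‖(center 𝕜 + (y : HSSpace 𝕜)) q‖ ^ 2
        ≤ ∑ _q : (Fin 2 × Fin 3) × (Fin 2 × Fin 3), (1 : ℝ) := by
          refine Finset.sum_le_sum fun q _ => ?_
          have := norm_apply_le_one hy (trace_secBlk y) (sixEquiv.symm q.1) (sixEquiv.symm q.2)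
          have e : secBlk y (sixEquiv.symm q.1) (sixEquiv.symm q.2)
              = (center 𝕜 + (y : HSSpace 𝕜)) q := by
            simp [secBlk, HSSpace.toBlk, HSSpace.toMatrix]
          rw [e] at this
          exact pow_le_one₀ (norm_nonneg _) this
      _ = 6 ^ 2 := by norm_num
  rw [mem_closedBall_zero_iff]
  calc ‖y‖ = ‖(center 𝕜 + (y : HSSpace 𝕜)) - center 𝕜‖ := by simp
    _ ≤ _ := (norm_sub_le _ _).trans (by linarith)

theorem measurableSet_secBlk : MeasurableSet {y : traceless 𝕜 | (secBlk y).PosDef} :=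
  measurableSet_posDef continuous_secBlk

theorem integrable_momFun_secBlk (ν : Measure (traceless 𝕜)) [ν.IsAddHaarMeasure] (k n : ℕ) :
    Integrable (fun y => momFun k n (secBlk y)) ν := by
  have : (fun y : traceless 𝕜 => momFun k n (secBlk y)) = {y | (secBlk y).PosDef}.indicator
      fun y => rdet (secBlk y) ^ k * rdet (swapOff (secBlk y)) ^ n := rfl
  rw [this, integrable_indicator_iff measurableSet_secBlk]
  refine IntegrableOn.mono_set ?_ posDef_secBlk_subset
  exact ((continuous_momFun_aux k n).comp continuous_secBlk).continuousOn.integrableOn_compact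
    (isCompact_closedBall 0 _)

theorem convex_posSemidef_secBlk : Convex ℝ {y : traceless 𝕜 | (secBlk y).PosSemidef} := by
  intro x hx y hy a b ha hb hab
  have e : secBlk (a • x + b • y) = a • secBlk x + b • secBlk y := by
    have e1 : ((a • x + b • y : traceless 𝕜) : HSSpace 𝕜).toBlk
      = a • (x : HSSpace 𝕜).toBlk + b • (y : HSSpace 𝕜).toBlk := rfl
    rw [secBlk_eq, secBlk_eq, secBlk_eq, e1, smul_add, smul_add]
    have : (6⁻¹ : ℝ) • (1 : Matrix (Fin 3 ⊕ Fin 3) (Fin 3 ⊕ Fin 3) 𝕜)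
        = a • (6⁻¹ : ℝ) • 1 + b • (6⁻¹ : ℝ) • 1 := by
      rw [← add_smul, hab, one_smul]
    conv_lhs => rw [this]
    abel
  rw [Set.mem_ofPred_eq, e]
  exact (hx.smul ha).add (hy.smul hb)

/-- The positive semidefinite section is convex, so its frontier is null. An interior point is
positive definite, because it stays semidefinite when pushed slightly away from the maximally mixed
state. -/
theorem posDef_secBlk_ae_eq (ν : Measure (traceless 𝕜)) [ν.IsAddHaarMeasure] :
    {y : traceless 𝕜 | (secBlk y).PosSemidef} =ᵐ[ν] {y : traceless 𝕜 | (secBlk y).PosDef} := by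
  have h0 := convex_posSemidef_secBlk.addHaar_frontier ν
  have hcl : IsClosed {y : traceless 𝕜 | (secBlk y).PosSemidef} :=
    isClosed_posSemidef.preimage continuous_secBlk
  refine Filter.EventuallyLE.antisymm ?_ (Filter.Eventually.of_forall fun y hy =>
    PosDef.posSemidef hy)
  rw [ae_le_set]
  refine measure_mono_null ?_ h0
  rintro y ⟨hy, hy'⟩
  rw [hcl.frontier_eq]
  refine ⟨hy, fun hi => hy' ?_⟩
  have hlim : Filter.Tendsto (fun s : ℝ => (1 + s) • y) (nhds 0) (nhds y) := by
    have : Continuous fun s : ℝ => (1 + s) • y := by fun_prop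
    simpa using this.tendsto 0
  obtain ⟨ε, hε, hb⟩ := Metric.eventually_nhds_iff.1
    (hlim.eventually (mem_interior_iff_mem_nhds.1 hi))
  have h1 : (secBlk ((1 + ε / 2) • y)).PosSemidef := hb (by
    rw [Real.dist_eq, sub_zero, abs_of_pos (by positivity)]
    linarith)
  -- Only the traceless part was dilated; the missing share of the centre is (ε/2)/6 times the
  -- identity.
  have e : (1 + ε / 2) • secBlk y
      = secBlk ((1 + ε / 2) • y) + (ε / 12) • (1 : Matrix (Fin 3 ⊕ Fin 3) (Fin 3 ⊕ Fin 3) 𝕜) := by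
    have e1 : (((1 + ε / 2) • y : traceless 𝕜) : HSSpace 𝕜).toBlk
      = (1 + ε / 2) • (y : HSSpace 𝕜).toBlk := rfl
    rw [secBlk_eq, secBlk_eq, e1, smul_add, add_right_comm, ← add_smul, smul_smul]
    congr 2
    ring
  have h2 : ((1 + ε / 2) • secBlk y).PosDef := by
    rw [e]
    exact PosDef.posSemidef_add h1 (PosDef.one.smul (by positivity))
  have h3 := h2.smul (inv_pos.2 (show 0 < 1 + ε / 2 by positivity))
  rwa [smul_smul, inv_mul_cancel₀ (by positivity), one_smul] at h3

theorem continuous_parTr : Continuous (parTr (𝕜 := 𝕜)) := by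
  have h : Continuous fun p : HermCoord 𝕜 => rtr (hmat p) :=
    RCLike.continuous_re.comp continuous_hmat.matrix_trace
  exact (h.comp (continuous_fst.comp continuous_fst)).add
    (h.comp (continuous_snd.comp continuous_fst))

theorem continuous_parBlk : Continuous (parBlk (𝕜 := 𝕜)) :=
  Continuous.matrix_fromBlocks (continuous_hmat.comp (continuous_fst.comp continuous_fst))
    (continuous_vmat.comp continuous_snd) (continuous_vmat.comp continuous_snd).matrix_conjTranspose
    (continuous_hmat.comp (continuous_snd.comp continuous_fst))

theorem measurable_momFun {α : Type*} [TopologicalSpace α] [MeasurableSpace α] [BorelSpace α]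
    {f : α → Matrix (Fin 3 ⊕ Fin 3) (Fin 3 ⊕ Fin 3) 𝕜} (hf : Continuous f) (k n : ℕ) :
    Measurable fun x => momFun k n (f x) :=
  ((continuous_momFun_aux k n).comp hf).measurable.indicator (measurableSet_posDef hf)

/-- The integral over the cone of positive definite matrices is a multiple of the integral over
its section by the matrices of unit trace. -/
theorem exists_hasInt_parVol (ν : Measure (traceless 𝕜)) [ν.IsAddHaarMeasure] :
    ∃ c : ℝ, 0 < c ∧ ∀ k n : ℕ, HasInt (parVol 𝕜)
      (fun w => Real.exp (-parTr w) * momFun k n (parBlk w))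
      (c * rising (finrank ℝ (traceless 𝕜) + 1) (6 * (k + n)) *
        ∫ y, momFun k n (secBlk y) ∂ν) := by
  have hP : (parVol 𝕜).IsAddHaarMeasure := by
    have : ((hermVol 𝕜).prod (hermVol 𝕜)).IsAddHaarMeasure :=
      Measure.prod.instIsAddHaarMeasure _ _
    exact Measure.prod.instIsAddHaarMeasure _ _
  obtain ⟨c, hc, hmap⟩ := exists_map_polar ν (parVol 𝕜) continuous_parTr.measurable
    (sectionEquiv 𝕜) parTr_sectionEquiv
  set d : ℝ := ((finrank ℝ (traceless 𝕜) : ℕ) : ℝ) with hd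
  have hd0 : 0 < d + 1 := by positivity
  have hG := Real.Gamma_pos_of_pos hd0
  refine ⟨c⁻¹ * Real.Gamma (d + 1), by positivity, fun k n => ?_⟩
  have hgm : Measurable fun w : Par 𝕜 => momFun k n (parBlk w) :=
    measurable_momFun continuous_parBlk k n
  have hdens : Measurable ({w : Par 𝕜 | 0 < parTr w}.indicator
      fun w => ENNReal.ofReal (Real.exp (-parTr w))) :=
    (Real.measurable_exp.comp continuous_parTr.measurable.neg).ennreal_ofReal.indicator
      (measurableSet_lt measurable_const continuous_parTr.measurable)
  have h1 : HasInt ((gam (d + 1)).prod ν) (fun q => q.1 ^ (6 * (k + n)) * momFun k n (secBlk q.2))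
      (Real.Gamma (d + 1) * rising (d + 1) (6 * (k + n)) * ∫ y, momFun k n (secBlk y) ∂ν) :=
    (hasInt_gam hd0 (6 * (k + n))).mul_prod (integrable_momFun_secBlk ν k n).hasInt
  have hpos : ∀ᵐ q ∂((gam (d + 1)).prod ν), 0 < q.1 := by
    have hg : ∀ᵐ x ∂gam (d + 1), 0 < x :=
      (withDensity_absolutelyContinuous _ _).ae_le (ae_restrict_mem measurableSet_Ioi)
    exact Measure.quasiMeasurePreserving_fst.ae hg
  -- Homogeneity of degree 6(k + n) absorbs the power of the radial variable.
  have h2 := h1.congr_ae (g := fun q => momFun k n (parBlk (sectionEquiv 𝕜 (q.1, q.1 • q.2)))) (by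
    filter_upwards [hpos] with q hq
    rw [parBlk_sectionEquiv, momFun_smul hq])
  have hQm : Measurable fun q : ℝ × traceless 𝕜 => sectionEquiv 𝕜 (q.1, q.1 • q.2) :=
    (sectionEquiv 𝕜).toContinuousLinearEquiv.continuous.measurable.comp (by fun_prop)
  rw [← hasInt_map (f := fun w => momFun k n (parBlk w)) hQm hgm, hmap] at h2
  have h3 : HasInt ((parVol 𝕜).withDensity ({w : Par 𝕜 | 0 < parTr w}.indicator
      fun w => ENNReal.ofReal (Real.exp (-parTr w)))) (fun w => momFun k n (parBlk w))
      (c⁻¹ * (Real.Gamma (d + 1) * rising (d + 1) (6 * (k + n)) *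
        ∫ y, momFun k n (secBlk y) ∂ν)) := by
    have hc' : ENNReal.ofReal c ≠ 0 := by simpa using hc
    constructor
    · exact (integrable_smul_measure hc' ENNReal.ofReal_ne_top).1 h2.1
    · rw [← h2.2, integral_smul_measure, ENNReal.toReal_ofReal hc.le, smul_eq_mul,
        inv_mul_cancel_left₀ hc.ne']
  have hfin : ∀ w : Par 𝕜, ({w : Par 𝕜 | 0 < parTr w}.indicator
      fun w => ENNReal.ofReal (Real.exp (-parTr w))) w < ⊤ := by
    intro w
    unfold Set.indicator
    split_ifs <;> simp
  have e : ∀ w : Par 𝕜, (({w : Par 𝕜 | 0 < parTr w}.indicator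
      fun w => ENNReal.ofReal (Real.exp (-parTr w))) w).toReal • momFun k n (parBlk w)
      = Real.exp (-parTr w) * momFun k n (parBlk w) := by
    intro w
    -- The cut-off to positive trace is automatic where the integrand does not vanish.
    by_cases hw : (parBlk w).PosDef
    · have ht : 0 < parTr w := by
        rw [parTr_eq]
        exact (RCLike.pos_iff.1 hw.trace_pos).1
      rw [Set.indicator_of_mem (by exact ht), ENNReal.toReal_ofReal (Real.exp_pos _).le,
        smul_eq_mul]
    · have : momFun k n (parBlk w) = 0 := Set.indicator_of_notMem (by exact hw) _
      rw [this, smul_zero, mul_zero]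
  unfold HasInt at h3
  rw [integrable_withDensity_iff_integrable_smul' hdens (Filter.Eventually.of_forall hfin),
    integral_withDensity_eq_integral_toReal_smul hdens (Filter.Eventually.of_forall hfin)] at h3
  simp only [e] at h3
  exact ⟨h3.1, h3.2.trans (by ring)⟩

end SectionIntegral

open Matrix Module
open scoped ENNReal Kronecker

/-! ### Moments of the Hilbert–Schmidt measure as integrals over the cone -/

section Moments

variable {𝕜 : Type*} [RCLike 𝕜]

theorem det_eq_of_isHermitian {n : Type*} [Fintype n] [DecidableEq n] {M : Matrix n n 𝕜}
    (hM : M.IsHermitian) : M.det = (rdet M : 𝕜) := by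
  refine (RCLike.conj_eq_iff_re.1 ?_).symm
  have := det_conjTranspose M
  rw [hM] at this
  exact this.symm

theorem swapOff_isHermitian {M : Matrix (Fin 3 ⊕ Fin 3) (Fin 3 ⊕ Fin 3) 𝕜}
    (hM : M.IsHermitian) : (swapOff M).IsHermitian := by
  have h := hM
  rw [← fromBlocks_toBlocks M, isHermitian_fromBlocks_iff] at h
  exact isHermitian_fromBlocks_iff.2 ⟨h.1, h.2.2.1, h.2.1, h.2.2.2⟩

/-- Transposing within each block, followed by a full transposition, moves whole blocks and leaves
them intact. -/
theorem det_partialTranspose (x : HSSpace 𝕜) :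
    (partialTranspose x.toMatrix).det = (swapOff x.toBlk).det := by
  rw [← det_submatrix_equiv_self sixEquiv, ← det_transpose]
  congr 1
  ext i j
  rcases i with i | i <;> rcases j with j | j <;> rfl

theorem det_toMatrix (x : HSSpace 𝕜) : x.toMatrix.det = x.toBlk.det :=
  (det_submatrix_equiv_self sixEquiv _).symm

theorem mem_densityMatrices_iff {x : HSSpace 𝕜} :
    x.toMatrix ∈ densityMatrices 𝕜 ↔ x.toBlk.PosSemidef ∧ x.toBlk.trace = 1 := by
  rw [trace_toBlk, HSSpace.toBlk, posSemidef_submatrix_equiv]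
  rfl

/-- The isometric parametrisation of the matrices of unit trace by their traceless part. -/
noncomputable def secMap (y : traceless 𝕜) : HSSpace 𝕜 := center 𝕜 + y

theorem isometry_secMap : Isometry (secMap (𝕜 := 𝕜)) :=
  (IsometryEquiv.addLeft (center 𝕜)).isometry.comp isometry_subtype_coe

theorem densityMatrices_subset_range :
    {x : HSSpace 𝕜 | x.toMatrix ∈ densityMatrices 𝕜} ⊆ Set.range secMap := by
  rintro x ⟨hx, ht⟩
  refine ⟨⟨x - center 𝕜, ?_, ?_⟩, by simp [secMap]⟩
  · exact hx.1.sub isHermitian_center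
  · have e : (x - center 𝕜).toMatrix = x.toMatrix - (center 𝕜).toMatrix := rfl
    rw [e, trace_sub, ht, trace_center, sub_self]

theorem preimage_densityMatrices : secMap ⁻¹' {x : HSSpace 𝕜 | x.toMatrix ∈ densityMatrices 𝕜}
    = {y | (secBlk y).PosSemidef} := by
  ext y
  simp only [Set.mem_preimage, Set.mem_ofPred_eq, mem_densityMatrices_iff]
  exact and_iff_left (trace_secBlk y)

theorem measurableSet_densityMatrices :
    MeasurableSet {x : HSSpace 𝕜 | x.toMatrix ∈ densityMatrices 𝕜} := by
  have : {x : HSSpace 𝕜 | x.toMatrix ∈ densityMatrices 𝕜}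
      = {x | x.toBlk.PosSemidef} ∩ {x | x.toBlk.trace = 1} := by
    ext x
    exact mem_densityMatrices_iff
  rw [this]
  exact (measurableSet_posSemidef continuous_toBlk).inter
    (isClosed_eq continuous_toBlk.matrix_trace continuous_const).measurableSet

/-- Translation by the maximally mixed state is an isometry from the traceless subspace onto the
matrices of unit trace, and isometries transport Hausdorff measure. In the dimension of the subspace
this measure is a Haar measure. -/
theorem hausdorff_restrict {d : ℝ} (hd : 0 ≤ d) :
    (Measure.hausdorffMeasure d).restrict {x : HSSpace 𝕜 | x.toMatrix ∈ densityMatrices 𝕜}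
      = ((Measure.hausdorffMeasure d).restrict
        {y : traceless 𝕜 | (secBlk y).PosSemidef}).map secMap := by
  rw [← preimage_densityMatrices, ← Measure.restrict_map isometry_secMap.continuous.measurable
    measurableSet_densityMatrices, isometry_secMap.map_hausdorffMeasure (Or.inl hd),
    Measure.restrict_restrict measurableSet_densityMatrices,
    Set.inter_eq_self_of_subset_left densityMatrices_subset_range]

variable (𝕜) in
/-- The unnormalised moments. -/
noncomputable def rawMoment (k n : ℕ) : ℝ :=
  ∫ y : traceless 𝕜, momFun k n (secBlk y)
    ∂Measure.hausdorffMeasure (finrank ℝ (traceless 𝕜) : ℕ)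

theorem hausdorff_densityMatrices {d : ℝ} (hd : (finrank ℝ (traceless 𝕜) : ℕ) = d) :
    Measure.hausdorffMeasure d {x : HSSpace 𝕜 | x.toMatrix ∈ densityMatrices 𝕜}
      = ENNReal.ofReal (rawMoment 𝕜 0 0) := by
  subst hd
  have h1 := congrArg (fun m => m Set.univ)
    (hausdorff_restrict (𝕜 := 𝕜) (d := (finrank ℝ (traceless 𝕜) : ℕ)) (by positivity))
  simp only [Measure.restrict_apply_univ] at h1
  rw [Measure.map_apply isometry_secMap.continuous.measurable MeasurableSet.univ,
    Set.preimage_univ, Measure.restrict_apply_univ, measure_congr (posDef_secBlk_ae_eq _)] at h1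
  have h2 := integrable_momFun_secBlk (𝕜 := 𝕜)
    (Measure.hausdorffMeasure (finrank ℝ (traceless 𝕜) : ℕ)) 0 0
  have e : (fun y : traceless 𝕜 => momFun 0 0 (secBlk y))
      = {y | (secBlk y).PosDef}.indicator 1 := by
    funext y
    simp [momFun, Set.indicator]
  rw [e, integrable_indicator_iff measurableSet_secBlk] at h2
  have h3 : Measure.hausdorffMeasure (finrank ℝ (traceless 𝕜) : ℕ)
      {y : traceless 𝕜 | (secBlk y).PosDef} ≠ ⊤ := by
    have := (integrableOn_const_iff (μ := Measure.hausdorffMeasure (finrank ℝ (traceless 𝕜) : ℕ))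
      (s := {y : traceless 𝕜 | (secBlk y).PosDef}) (C := (1 : ℝ))).1 h2
    simpa [lt_top_iff_ne_top] using this
  rw [h1, rawMoment, e, integral_indicator_one measurableSet_secBlk, Measure.real,
    ENNReal.ofReal_toReal h3]

theorem isProbabilityMeasure_hsMeasure {d : ℝ} (hd : (finrank ℝ (traceless 𝕜) : ℕ) = d)
    (h : 0 < rawMoment 𝕜 0 0) : IsProbabilityMeasure (hsMeasure 𝕜 d) := by
  refine ProbabilityTheory.cond_isProbabilityMeasure_of_finite ?_ ?_
  · rw [hausdorff_densityMatrices hd]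
    simpa using h
  · rw [hausdorff_densityMatrices hd]
    exact ENNReal.ofReal_ne_top

theorem moment_hsMeasure {d : ℝ} (hd : (finrank ℝ (traceless 𝕜) : ℕ) = d)
    (h : 0 < rawMoment 𝕜 0 0) (k n : ℕ) :
    moment (hsMeasure 𝕜 d) k n = ((rawMoment 𝕜 k n / rawMoment 𝕜 0 0 : ℝ) : 𝕜) := by
  have hc : Continuous fun x : HSSpace 𝕜 =>
      x.toMatrix.det ^ k * (partialTranspose x.toMatrix).det ^ n := by
    simp only [det_toMatrix, det_partialTranspose]
    exact (continuous_toBlk.matrix_det.pow k).mul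
      ((continuous_swapOff.comp continuous_toBlk).matrix_det.pow n)
  have h1 : ∫ x in {x : HSSpace 𝕜 | x.toMatrix ∈ densityMatrices 𝕜},
      x.toMatrix.det ^ k * (partialTranspose x.toMatrix).det ^ n ∂Measure.hausdorffMeasure d
      = ((rawMoment 𝕜 k n : ℝ) : 𝕜) := by
    subst hd
    rw [hausdorff_restrict (by positivity),
      integral_map isometry_secMap.continuous.measurable.aemeasurable
      hc.aestronglyMeasurable, Measure.restrict_congr_set (posDef_secBlk_ae_eq _), rawMoment,
      ← integral_ofReal, ← integral_indicator measurableSet_secBlk]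
    congr 1
    funext y
    by_cases hy : (secBlk y).PosDef
    · rw [Set.indicator_of_mem (by exact hy), momFun, Set.indicator_of_mem (by exact hy),
        det_toMatrix, det_partialTranspose]
      have e : (secMap y).toBlk = secBlk y := rfl
      rw [e, det_eq_of_isHermitian (isHermitian_secBlk y),
        det_eq_of_isHermitian (swapOff_isHermitian (isHermitian_secBlk y))]
      push_cast
      rfl
    · rw [Set.indicator_of_notMem (by exact hy), momFun, Set.indicator_of_notMem (by exact hy)]
      simp
  rw [moment, hsMeasure, ProbabilityTheory.cond, integral_smul_measure, h1,
    hausdorff_densityMatrices hd, ENNReal.toReal_inv, ENNReal.toReal_ofReal h.le,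
    RCLike.real_smul_eq_coe_mul]
  push_cast
  ring

theorem hasInt_wish_iff {κ : ℝ} {f : HermCoord 𝕜 → ℝ} {v : ℝ} : HasInt (wish 𝕜 κ) f v ↔
    HasInt (hermVol 𝕜) (fun p => {p : HermCoord 𝕜 | (hmat p).PosDef}.indicator
      (fun p => Real.exp (-rtr (hmat p)) * rdet (hmat p) ^ κ) p * f p) v := by
  have hm : Measurable ({p : HermCoord 𝕜 | (hmat p).PosDef}.indicator fun p =>
      ENNReal.ofReal (Real.exp (-RCLike.re (hmat p).trace) * RCLike.re (hmat p).det ^ κ)) :=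
    ((Real.measurable_exp.comp measurable_re_trace_hmat.neg).mul
      (measurable_re_det_hmat.pow_const _)).ennreal_ofReal.indicator
      (measurableSet_posDef continuous_hmat)
  have hfin : ∀ p, ({p : HermCoord 𝕜 | (hmat p).PosDef}.indicator fun p =>
      ENNReal.ofReal (Real.exp (-RCLike.re (hmat p).trace) * RCLike.re (hmat p).det ^ κ)) p < ⊤ := by
    intro p
    unfold Set.indicator
    split_ifs <;> simp
  have e : ∀ p, (({p : HermCoord 𝕜 | (hmat p).PosDef}.indicator fun p =>
      ENNReal.ofReal (Real.exp (-RCLike.re (hmat p).trace) * RCLike.re (hmat p).det ^ κ)) p).toReal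
        • f p = {p : HermCoord 𝕜 | (hmat p).PosDef}.indicator
      (fun p => Real.exp (-rtr (hmat p)) * rdet (hmat p) ^ κ) p * f p := by
    intro p
    by_cases hp : (hmat p).PosDef
    · have := PosDef.rdet_pos hp
      rw [Set.indicator_of_mem (by exact hp), Set.indicator_of_mem (by exact hp), smul_eq_mul,
        ENNReal.toReal_ofReal]
      · rfl
      · exact mul_nonneg (Real.exp_pos _).le (Real.rpow_nonneg this.le _)
    · rw [Set.indicator_of_notMem (by exact hp), Set.indicator_of_notMem (by exact hp)]
      simp
  unfold HasInt wish
  rw [integrable_withDensity_iff_integrable_smul' hm (Filter.Eventually.of_forall hfin),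
    integral_withDensity_eq_integral_toReal_smul hm (Filter.Eventually.of_forall hfin)]
  simp only [e]

/-- Integration over the off-diagonal block, then over the first and the second diagonal block. -/
theorem integral_parVol {k n : ℕ}
    (hI : Integrable (fun w => Real.exp (-parTr w) * momFun k n (parBlk w)) (parVol 𝕜))
    {G : Matrix (Fin 3) (Fin 3) 𝕜 → Matrix (Fin 3) (Fin 3) 𝕜 → ℝ}
    (hG : ∀ A C : Matrix (Fin 3) (Fin 3) 𝕜, ∀ f : Fin 3 → ℝ,
      (f 0 + f 1 + f 2) * rdet C = mixOne A C →
      (f 1 * f 2 + f 0 * f 2 + f 0 * f 1) * rdet C = mixTwo A C →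
      f 0 * f 1 * f 2 * rdet C = rdet A →
      rdet C ^ (2 * n) * ∫ x, cDet f (vmat x) ^ n ∂muX 𝕜 k = G A C)
    {H : Matrix (Fin 3) (Fin 3) 𝕜 → ℝ} {v : ℝ}
    (hA : ∀ C : Matrix (Fin 3) (Fin 3) 𝕜, C.IsHermitian →
      HasInt (wish 𝕜 (k + 3 * finrank ℝ 𝕜 / 2)) (fun p => G (hmat p) C) (H C))
    (hC : HasInt (wish 𝕜 (k + 3 * finrank ℝ 𝕜 / 2)) (fun p => H (hmat p)) v) :
    ∫ w, Real.exp (-parTr w) * momFun k n (parBlk w) ∂parVol 𝕜 = v := by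
  set κ : ℝ := k + 3 * finrank ℝ 𝕜 / 2 with hκ
  set dens : HermCoord 𝕜 → ℝ := {p : HermCoord 𝕜 | (hmat p).PosDef}.indicator
      (fun p => Real.exp (-rtr (hmat p)) * rdet (hmat p) ^ κ) with hdens
  have h0 : ∀ p, ¬ (hmat p).PosDef → dens p = 0 := fun p hp => Set.indicator_of_notMem (by exact hp) _
  -- The weight exp(-tr A - tr C) (det A det C)^κ splits into two Wishart densities of parameter κ.
  have key : ∀ q : HermCoord 𝕜 × HermCoord 𝕜,
      ∫ y, Real.exp (-parTr (q, y)) * momFun k n (parBlk (q, y)) ∂entVol 𝕜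
        = dens q.2 * (dens q.1 * G (hmat q.1) (hmat q.2)) := by
    rintro ⟨a, c⟩
    have ht : ∀ y : Ent 𝕜, parTr ((a, c), y) = rtr (hmat a) + rtr (hmat c) := fun _ => rfl
    simp only [ht, integral_const_mul]
    by_cases hac : (hmat a).PosDef ∧ (hmat c).PosDef
    · obtain ⟨ha, hc⟩ := hac
      obtain ⟨f, hf1, hf2, hf3, hf⟩ := exists_integral_blk ha hc
      have hpa := PosDef.rdet_pos ha
      have hpc := PosDef.rdet_pos hc
      have := hf k n
      rw [hG _ _ f hf1 hf2 hf3] at this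
      have e : ∫ y, momFun k n (parBlk ((a, c), y)) ∂entVol 𝕜
          = (rdet (hmat a) * rdet (hmat c)) ^ κ * G (hmat a) (hmat c) := this
      rw [e, hdens, Set.indicator_of_mem (by exact hc), Set.indicator_of_mem (by exact ha),
        Real.mul_rpow hpa.le hpc.le, neg_add, Real.exp_add]
      ring
    · have hz : ∀ y : Ent 𝕜, momFun k n (parBlk ((a, c), y)) = 0 := fun y =>
        Set.indicator_of_notMem (by exact fun h => hac (posDef_of_posDef_blk h)) _
      simp only [hz, integral_zero, mul_zero]
      rcases not_and_or.1 hac with h | h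
      · rw [h0 a h]
        ring
      · rw [h0 c h]
        ring
  have hI2 : Integrable (fun q : HermCoord 𝕜 × HermCoord 𝕜 =>
      dens q.2 * (dens q.1 * G (hmat q.1) (hmat q.2))) ((hermVol 𝕜).prod (hermVol 𝕜)) := by
    have := hI.integral_prod_left
    simpa only [key] using this
  rw [integral_prod _ hI]
  simp only [key]
  -- The order is exchanged so that the integral over A comes first, with C fixed.
  rw [integral_prod_symm _ hI2]
  rw [hasInt_wish_iff] at hC
  rw [← hC.2]
  congr 1
  funext c
  refine (integral_const_mul (dens c) fun x => dens x * G (hmat x) (hmat c)).trans ?_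
  rw [(hasInt_wish_iff.1 (hA (hmat c) (hmat_isHermitian c))).2]

end Moments

open Matrix Module
open scoped ENNReal Kronecker

/-! ### The first moment over both fields -/

section FirstMoment

variable {𝕜 : Type*} [RCLike 𝕜]

theorem hasInt_wish_one {κ : ℝ} (hκ : -1 < κ) : HasInt (wish 𝕜 κ) (fun _ => 1) (chiMass 𝕜 κ) :=
  (hasInt_wish_det hκ 0).congr (fun _ => pow_zero _) (by simp [detVal, chiVal, rising])

variable (𝕜) in
/-- The integrals over the cone of positive definite matrices. -/
noncomputable def coneInt (k n : ℕ) : ℝ :=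
  ∫ w, Real.exp (-parTr w) * momFun k n (parBlk w) ∂parVol 𝕜

variable (𝕜) in
theorem exists_coneInt_eq : ∃ c : ℝ, 0 < c ∧ ∀ k n : ℕ, coneInt 𝕜 k n
    = c * rising ((finrank ℝ (traceless 𝕜) : ℕ) + 1) (6 * (k + n)) * rawMoment 𝕜 k n := by
  obtain ⟨c, hc, h⟩ := exists_hasInt_parVol
    (Measure.hausdorffMeasure (finrank ℝ (traceless 𝕜) : ℕ) : Measure (traceless 𝕜))
  exact ⟨c, hc, fun k n => (h k n).2⟩

theorem integrable_cone (k n : ℕ) :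
    Integrable (fun w => Real.exp (-parTr w) * momFun k n (parBlk w)) (parVol 𝕜) := by
  obtain ⟨c, hc, h⟩ := exists_hasInt_parVol
    (Measure.hausdorffMeasure (finrank ℝ (traceless 𝕜) : ℕ) : Measure (traceless 𝕜))
  exact (h k n).1

theorem coneInt_zero (k : ℕ) :
    coneInt 𝕜 k 0 = muMass 𝕜 k * chiMass 𝕜 (k + 3 * finrank ℝ 𝕜 / 2) ^ 2 := by
  have h1 := hasInt_wish_one (𝕜 := 𝕜) (neg_one_lt_kappa (𝕜 := 𝕜) k)
  refine integral_parVol (integrable_cone k 0) (G := fun _ _ => muMass 𝕜 k)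
    (fun A C f _ _ _ => ?_) (H := fun _ => muMass 𝕜 k * chiMass 𝕜 (k + 3 * finrank ℝ 𝕜 / 2))
    (fun C _ => ?_) ?_
  · simpa using integral_one_muX (𝕜 := 𝕜) k
  · exact (h1.const_mul _).congr (fun _ => mul_one _) rfl
  · exact (h1.const_mul _).congr (fun _ => mul_one _) (by ring)

theorem coneInt_zero_pos (k : ℕ) : 0 < coneInt 𝕜 k 0 := by
  have h1 := chiMass_pos (𝕜 := 𝕜) (neg_one_lt_kappa (𝕜 := 𝕜) k)
  have h2 := muMass_pos (𝕜 := 𝕜) k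
  rw [coneInt_zero]
  positivity

theorem rawMoment_zero_pos (k : ℕ) : 0 < rawMoment 𝕜 k 0 := by
  obtain ⟨c, hc, h⟩ := exists_coneInt_eq 𝕜
  have h1 := coneInt_zero_pos (𝕜 := 𝕜) k
  rw [h] at h1
  have h2 := rising_pos (s := ((finrank ℝ (traceless 𝕜) : ℕ) : ℝ) + 1) (by positivity) (6 * (k + 0))
  exact pos_of_mul_pos_right h1 (by positivity)

theorem rising_add (s : ℝ) (i j : ℕ) : rising s (i + j) = rising s i * rising (s + i) j := by
  unfold rising
  rw [Finset.prod_range_add]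
  congr 1
  refine Finset.prod_congr rfl fun x _ => ?_
  push_cast
  ring

/-- Ratios of moments are ratios of integrals over the cone. -/
theorem rawMoment_eq (k n : ℕ) : rawMoment 𝕜 k n = coneInt 𝕜 k n / coneInt 𝕜 k 0 /
    rising (6 + 15 * finrank ℝ 𝕜 + 6 * k) (6 * n) * rawMoment 𝕜 k 0 := by
  obtain ⟨c, hc, h⟩ := exists_coneInt_eq 𝕜
  have h1 := rawMoment_zero_pos (𝕜 := 𝕜) k
  have h2 := rising_pos (s := ((finrank ℝ (traceless 𝕜) : ℕ) : ℝ) + 1) (by positivity) (6 * k)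
  have h3 := rising_pos (s := (6 + 15 * finrank ℝ 𝕜 + 6 * k : ℝ)) (by positivity) (6 * n)
  -- The radial factor for degree 6(k + n) divided by that for degree 6k leaves a rising factorial
  -- of length 6n starting here.
  have h4 : ((finrank ℝ (traceless 𝕜) : ℕ) : ℝ) + 1 + (6 * k : ℕ)
      = 6 + 15 * finrank ℝ 𝕜 + 6 * k := by
    rw [finrank_traceless]
    push_cast
    ring
  rw [h, h, mul_add, rising_add, h4, add_zero]
  field_simp

/-- The X-average is α det A det C + γ tr(adj C · A) tr(adj A · C). Averaging over A turns the
second product into a combination of det C and tr C · e₂(C), whose averages over C are known. -/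
theorem coneInt_one (k : ℕ) {κ α γ : ℝ} (hκ : κ = k + 3 * finrank ℝ 𝕜 / 2)
    (hα : α = 1 - 6 * (finrank ℝ 𝕜 / 2 : ℝ) ^ 3 / chiVal 𝕜 κ (1, 0, 0, 1, 0, 1))
    (hγ : γ = 2 * (finrank ℝ 𝕜 / 2 : ℝ) ^ 2 / chiVal 𝕜 κ (1, 0, 0, 1, 0, 0)
        - (finrank ℝ 𝕜 / 2 : ℝ) / chiVal 𝕜 κ (1, 0, 0, 0, 0, 0)) :
    coneInt 𝕜 k 1 / coneInt 𝕜 k 0 = α * detVal 𝕜 κ 1 ^ 2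
      + γ * (3 * pairVal 𝕜 κ 0 0 0 * detVal 𝕜 κ 1
        + pairVal 𝕜 κ 0 0 1 * (3 * pairVal 𝕜 κ 0 0 0 + 6 * pairVal 𝕜 κ 0 0 1
          - 3 * detVal 𝕜 κ 1)) := by
  have hκ1 : -1 < κ := hκ ▸ neg_one_lt_kappa k
  have hm := chiMass_pos (𝕜 := 𝕜) hκ1
  have hM := muMass_pos (𝕜 := 𝕜) k
  have hd := hasInt_wish_det (𝕜 := 𝕜) hκ1 1
  have ht := hasInt_wish_tr_etwo (𝕜 := 𝕜) hκ1 0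
  have key : coneInt 𝕜 k 1 = muMass 𝕜 k * chiMass 𝕜 κ ^ 2 * (α * detVal 𝕜 κ 1 ^ 2
      + γ * (3 * pairVal 𝕜 κ 0 0 0 * detVal 𝕜 κ 1
        + pairVal 𝕜 κ 0 0 1 * (3 * pairVal 𝕜 κ 0 0 0 + 6 * pairVal 𝕜 κ 0 0 1
          - 3 * detVal 𝕜 κ 1))) := by
    refine integral_parVol (integrable_cone k 1) (G := fun A C => muMass 𝕜 k *
        (α * (rdet A * rdet C) + γ * (mixOne A C * mixTwo A C)))
      (fun A C f h1 h2 h3 => ?_)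
      (H := fun C => muMass 𝕜 k * chiMass 𝕜 κ * (α * detVal 𝕜 κ 1 * rdet C
        + γ * (pairVal 𝕜 κ 0 0 0 * (3 * rdet C)
        + pairVal 𝕜 κ 0 0 1 * (rtr C * etwo C - 3 * rdet C)))) (fun C hC => ?_) ?_
    · simp only [pow_one]
      rw [integral_cDet, ← hκ, ← hα, ← hγ, ← h1, ← h2, ← h3]
      ring
    · rw [← hκ]
      refine (((hd.const_mul (α * rdet C)).add
        ((hasInt_wish_mix_pair (𝕜 := 𝕜) hκ1 0 hC).const_mul γ)).const_mul (muMass 𝕜 k)).congr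
        (fun p => ?_) ?_
      · ring
      · ring
    · rw [← hκ]
      refine ((hd.const_mul (muMass 𝕜 k * chiMass 𝕜 κ * (α * detVal 𝕜 κ 1 + 3 * γ *
        (pairVal 𝕜 κ 0 0 0 - pairVal 𝕜 κ 0 0 1)))).add
        (ht.const_mul (muMass 𝕜 k * chiMass 𝕜 κ * (γ * pairVal 𝕜 κ 0 0 1)))).congr
        (fun p => ?_) ?_
      · ring
      · ring
  rw [key, coneInt_zero, ← hκ]
  field_simp

end FirstMoment

/-! ### Closed forms of the first moments -/

section FirstMomentValues

theorem finrank_real_real : finrank ℝ ℝ = 1 := Module.finrank_self ℝ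

theorem rawMoment_real_one (k : ℕ) : rawMoment ℝ k 1 = (4 * (k : ℝ) ^ 5 + 40 * (k : ℝ) ^ 4
      + 95 * (k : ℝ) ^ 3 - 220 * (k : ℝ) ^ 2 - 1149 * (k : ℝ) - 1170) /
    (576 * ((k : ℝ) + 4) * (3 * (k : ℝ) + 11) * (3 * (k : ℝ) + 13) * (6 * (k : ℝ) + 23)
      * (6 * (k : ℝ) + 25)) * rawMoment ℝ k 0 := by
  rw [rawMoment_eq k 1, coneInt_one k rfl rfl rfl]
  congr 1
  simp only [pairVal, detVal, chiVal, rising, finrank_real_real, Finset.prod_range_succ,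
    Finset.range_zero, Finset.prod_empty]
  norm_num
  field_simp
  ring

theorem rawMoment_complex_one (k : ℕ) : rawMoment ℂ k 1 = ((k : ℝ) ^ 5 + 15 * (k : ℝ) ^ 4
      + 37 * (k : ℝ) ^ 3 - 423 * (k : ℝ) ^ 2 - 2558 * (k : ℝ) - 3840) /
    (72 * (2 * (k : ℝ) + 13) * (3 * (k : ℝ) + 19) * (3 * (k : ℝ) + 20) * (6 * (k : ℝ) + 37)
      * (6 * (k : ℝ) + 41)) * rawMoment ℂ k 0 := by
  rw [rawMoment_eq k 1, coneInt_one k rfl rfl rfl]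
  congr 1
  simp only [pairVal, detVal, chiVal, rising, Complex.finrank_real_complex, Finset.prod_range_succ,
    Finset.range_zero, Finset.prod_empty]
  norm_num
  field_simp
  ring

end FirstMomentValues

open Matrix Module
open scoped ENNReal Kronecker

/-! ### Gaussian moments of integer polynomials over ℝ -/

section RealGaussian

/-- The moments of a standard normal variable. -/
def normalMoment : ℕ → ℤ
  | 0 => 1
  | 1 => 0
  | n + 2 => (n + 1) * normalMoment n

/-- The weight exp(-x²) is that of a centred normal variable of variance 1/2, whence the powers of
1/√2. Even moments come from the radial formula and odd ones vanish by reflection. -/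
theorem hasInt_gau_real (n : ℕ) : HasInt (gau ℝ) (fun x => x ^ n)
    (gauMass ℝ * (normalMoment n * (√2)⁻¹ ^ n)) := by
  have heven : ∀ j : ℕ, HasInt (gau ℝ) (fun x => x ^ (2 * j)) (gauMass ℝ * rising (1 / 2) j) := by
    intro j
    have := hasInt_gau (𝕜 := ℝ) j
    rw [finrank_real_real, Nat.cast_one] at this
    exact this.congr (fun x => by rw [Real.norm_eq_abs, sq_abs, pow_mul]) rfl
  rcases Nat.even_or_odd' n with ⟨j, rfl | rfl⟩
  · refine (heven j).congr (fun _ => rfl) ?_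
    congr 1
    have h2 : ((√2)⁻¹ : ℝ) ^ 2 = 1 / 2 := by
      rw [inv_pow, Real.sq_sqrt (by norm_num)]
      norm_num
    rw [pow_mul, h2]
    induction j with
    | zero => simp [rising, normalMoment]
    | succ j ih =>
      rw [rising, Finset.prod_range_succ, ← rising, ih,
        show 2 * (j + 1) = 2 * j + 2 by ring, normalMoment]
      push_cast
      ring
  · have h0 : normalMoment (2 * j + 1) = 0 := by
      induction j with
      | zero => rfl
      | succ j ih =>
        rw [show 2 * (j + 1) + 1 = (2 * j + 1) + 2 by ring, normalMoment, ih, mul_zero]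
    rw [h0, Int.cast_zero, zero_mul, mul_zero]
    have hi : Integrable (fun x : ℝ => x ^ (2 * j + 1)) (gau ℝ) := by
      refine ((heven j).1.add (heven (j + 1)).1).mono' (by fun_prop)
        (Filter.Eventually.of_forall fun x => ?_)
      have h1 : x ^ (2 * j) = (x ^ j) ^ 2 := by rw [← pow_mul, mul_comm]
      have h2 : x ^ (2 * (j + 1)) = (x ^ j) ^ 2 * x ^ 2 := by ring
      have h3 : ‖x ^ (2 * j + 1)‖ = (x ^ j) ^ 2 * |x| := by
        rw [pow_succ, h1, norm_mul, Real.norm_eq_abs, Real.norm_eq_abs, abs_of_nonneg (sq_nonneg _)]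
      rw [h3, Pi.add_apply, h1, h2, ← mul_one_add]
      refine mul_le_mul_of_nonneg_left ?_ (sq_nonneg _)
      nlinarith [sq_nonneg (|x| - 1), sq_abs x]
    refine ⟨hi, ?_⟩
    have h := (hasInt_gau_iff.1 hi.hasInt).2
    rw [← h]
    have h4 := integral_neg_eq_self (fun z : ℝ => Real.exp (-‖z‖ ^ 2) * z ^ (2 * j + 1))
      Measure.addHaar
    simp only [norm_neg, Odd.neg_pow ⟨j, rfl⟩, mul_neg, integral_neg] at h4
    exact self_eq_neg.1 h4.symm

/-- Integer polynomials in the nine entries, as lists of coefficients and words. -/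
abbrev EntPoly := List (ℤ × List (Fin 3 × Fin 3))

/-- Evaluation of a polynomial. -/
def EntPoly.ev (l : EntPoly) (x : Ent ℝ) : ℝ := (l.map fun t => (t.1 : ℝ) * (t.2.map x).prod).sum

/-- The product of polynomials. -/
def EntPoly.mul (l l' : EntPoly) : EntPoly :=
  l.flatMap fun s => l'.map fun t => (s.1 * t.1, s.2 ++ t.2)

theorem EntPoly.ev_mul (l l' : EntPoly) (x : Ent ℝ) : (l.mul l').ev x = l.ev x * l'.ev x := by
  unfold EntPoly.ev EntPoly.mul
  induction l with
  | nil => simp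
  | cons a l ih =>
    rw [List.flatMap_cons, List.map_append, List.sum_append, ih, List.map_cons, List.sum_cons,
      add_mul]
    congr 1
    rw [List.map_map, ← List.sum_map_mul_left]
    congr 1
    refine List.map_congr_left fun t _ => ?_
    simp only [Function.comp_apply, List.map_append, List.prod_append]
    push_cast
    ring

/-- The expectation of a polynomial in standard normal variables. -/
def EntPoly.wick (l : EntPoly) : ℤ :=
  (l.map fun t => t.1 * ((List.finRange 3).map fun i => ((List.finRange 3).map fun j =>
    normalMoment (t.2.count (i, j))).prod).prod).sum

theorem prod_map_eq_prod_pow_count (w : List (Fin 3 × Fin 3)) (x : Ent ℝ) :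
    (w.map x).prod = ∏ q, x q ^ w.count q := by
  induction w with
  | nil => simp
  | cons a w ih =>
    rw [List.map_cons, List.prod_cons, ih]
    have : ∀ q, (a :: w).count q = w.count q + if a = q then 1 else 0 := by
      intro q
      rw [List.count_cons]
      simp
    simp only [this, pow_add, Finset.prod_mul_distrib]
    rw [mul_comm]
    congr 1
    rw [Finset.prod_eq_single a] <;> simp +contextual [eq_comm]

theorem sum_count (w : List (Fin 3 × Fin 3)) : ∑ q, w.count q = w.length := by
  induction w with
  | nil => simp
  | cons a w ih =>
    have : ∀ q, (a :: w).count q = w.count q + if a = q then 1 else 0 := by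
      intro q
      rw [List.count_cons]
      simp
    simp [this, Finset.sum_add_distrib, ih]

/-- Gaussian moments of homogeneous polynomials. -/
theorem EntPoly.hasInt_gauEnt (l : EntPoly) (m : ℕ) (hl : ∀ t ∈ l, t.2.length = 2 * m) :
    HasInt (gauEnt ℝ) l.ev (gauMass ℝ ^ 9 * (l.wick / 2 ^ m)) := by
  have h := HasInt.listSum l fun t _ => (_root_.hasInt_gauEnt (𝕜 := ℝ)
    fun q => hasInt_gau_real (t.2.count q)).const_mul (t.1 : ℝ)
  refine h.congr (fun x => ?_) ?_
  · simp only [EntPoly.ev, prod_map_eq_prod_pow_count]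
  · rw [EntPoly.wick]
    push_cast
    rw [List.map_map, div_eq_mul_inv, ← List.sum_map_mul_right, ← List.sum_map_mul_left]
    congr 1
    refine List.map_congr_left fun t ht => ?_
    have h2 : ((√2)⁻¹ : ℝ) ^ 2 = 2⁻¹ := by
      rw [inv_pow, Real.sq_sqrt (by norm_num)]
    have h3 : ((√2)⁻¹ : ℝ) ^ t.2.length = (2 ^ m)⁻¹ := by
      rw [hl t ht, pow_mul, h2, inv_pow]
    rw [Finset.prod_mul_distrib, Finset.prod_mul_distrib, Finset.prod_pow_eq_pow_sum, sum_count,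
      h3]
    simp only [Fintype.prod_prod_type, Fin.prod_univ_three, Function.comp_apply]
    simp [List.finRange_succ]
    ring

end RealGaussian

open Matrix Module
open scoped ENNReal Kronecker

/-! ### Sign averaging and second moments of the entries of a real contraction -/

section RealContraction

/-- The expectation becomes the evaluation of an integer-valued list function, so each concrete
Gaussian moment is checked by the kernel. -/
theorem hasInt_gauEnt_of_poly {f : Matrix (Fin 3) (Fin 3) ℝ → ℝ} (l : EntPoly) (m : ℕ) (v : ℤ)
    (hl : ∀ t ∈ l, t.2.length = 2 * m) (hw : l.wick = v) (h : ∀ x, l.ev x = f (vmat x)) :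
    HasInt (gauEnt ℝ) (fun x => f (vmat x)) (gauMass ℝ ^ 9 * (v / 2 ^ m)) :=
  (l.hasInt_gauEnt m hl).congr h (by rw [hw])

/-- The polynomial of an entry. -/
def entPoly (i j : Fin 3) : EntPoly := [(1, [(i, j)])]

/-- The polynomial of a `2 × 2` minor. -/
def minorPoly (i i' j j' : Fin 3) : EntPoly := [(1, [(i, j), (i', j')]), (-1, [(i, j'), (i', j)])]

/-- The polynomial of the squared determinant. -/
def detSqPoly : EntPoly :=
  let l : EntPoly := [(1, [(0, 0), (1, 1), (2, 2)]), (-1, [(0, 0), (1, 2), (2, 1)]),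
    (-1, [(0, 1), (1, 0), (2, 2)]), (1, [(0, 1), (1, 2), (2, 0)]),
    (1, [(0, 2), (1, 0), (2, 1)]), (-1, [(0, 2), (1, 1), (2, 0)])]
  l.mul l

/-- The square of a polynomial. -/
def EntPoly.sq (l : EntPoly) : EntPoly := l.mul l

theorem ev_entPoly (i j : Fin 3) (x : Ent ℝ) : (entPoly i j).sq.ev x = nx (vmat x) (i, j) := by
  rw [EntPoly.sq, EntPoly.ev_mul]
  simp [entPoly, EntPoly.ev, nx, vmat, ← sq]

theorem ev_detSqPoly (x : Ent ℝ) : detSqPoly.ev x = nd (vmat x) := by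
  rw [detSqPoly, EntPoly.ev_mul, nd, det_fin_three]
  simp [EntPoly.ev, vmat]
  ring

theorem ev_minorPoly (x : Ent ℝ) : (minorPoly 1 2 0 1).sq.ev x = ny (vmat x) (0, 2) ∧
    (minorPoly 0 2 0 1).sq.ev x = ny (vmat x) (1, 2) ∧
    (minorPoly 1 2 0 2).sq.ev x = ny (vmat x) (0, 1) ∧
    (minorPoly 0 2 0 2).sq.ev x = ny (vmat x) (1, 1) := by
  simp only [EntPoly.sq, EntPoly.ev_mul, ny, adjugate_fin_three]
  refine ⟨?_, ?_, ?_, ?_⟩ <;> simp [minorPoly, EntPoly.ev, vmat] <;> ring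

theorem continuous_nx_apply (q : Fin 3 × Fin 3) :
    Continuous fun X : Matrix (Fin 3) (Fin 3) ℝ => nx X q := continuous_pi_iff.1 continuous_nx q

theorem continuous_ny_apply (q : Fin 3 × Fin 3) :
    Continuous fun X : Matrix (Fin 3) (Fin 3) ℝ => ny X q := continuous_pi_iff.1 continuous_ny q

section Diagonal

variable (X : Matrix (Fin 3) (Fin 3) ℝ) (d : Fin 3 → ℝ) {p : HermCoord ℝ} (i : Fin 3)

theorem adjugate_diagonal_mul (j : Fin 3) : (X * diagonal d).adjugate j i
    = ![d 1 * d 2, d 0 * d 2, d 0 * d 1] j * X.adjugate j i := by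
  rw [adjugate_mul_distrib]
  have : (diagonal d).adjugate = diagonal ![d 1 * d 2, d 0 * d 2, d 0 * d 1] := by
    rw [adjugate_fin_three]
    ext i j
    fin_cases i <;> fin_cases j <;> simp [diagonal]
  rw [this, diagonal_mul]

theorem nx_real_zero (h1 : 0 < p.1) : nx (X * diagonal d * (cholMat p)ᴴ) (i, 0)
    = p.1 * (d 0 * X i 0) ^ 2 := by
  rw [nx_mul_cholMat_zero _ h1, nx, mul_diagonal, Real.norm_eq_abs, sq_abs, mul_comm (X _ _)]

theorem nx_real_one : nx (X * diagonal d * (cholMat p)ᴴ) (i, 1)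
    = (p.2.1 * (d 0 * X i 0) + √p.2.2.2.1 * (d 1 * X i 1)) ^ 2 := by
  rw [nx, mul_cholMat_one, Real.norm_eq_abs, sq_abs, mul_diagonal, mul_diagonal]
  simp [mul_comm]

theorem nx_real_two : nx (X * diagonal d * (cholMat p)ᴴ) (i, 2)
    = (p.2.2.1 * (d 0 * X i 0) + p.2.2.2.2.1 * (d 1 * X i 1)
      + √p.2.2.2.2.2 * (d 2 * X i 2)) ^ 2 := by
  rw [nx, mul_cholMat_two, Real.norm_eq_abs, sq_abs, mul_diagonal, mul_diagonal, mul_diagonal]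
  simp [mul_comm]

theorem ny_real_two (h1 : 0 < p.1) (h2 : 0 < p.2.2.2.1) :
    ny (X * diagonal d * (cholMat p)ᴴ) (i, 2)
      = p.1 * p.2.2.2.1 * (d 0 * d 1 * X.adjugate 2 i) ^ 2 := by
  rw [ny_mul_cholMat_two _ h1 h2, ny, adjugate_diagonal_mul, Real.norm_eq_abs, sq_abs]
  rfl

theorem ny_real_one (h1 : 0 < p.1) : ny (X * diagonal d * (cholMat p)ᴴ) (i, 1)
    = p.1 * (√p.2.2.2.2.2 * (d 0 * d 2 * X.adjugate 1 i)
      - p.2.2.2.2.1 * (d 0 * d 1 * X.adjugate 2 i)) ^ 2 := by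
  rw [ny, adjugate_mul_cholMat_one, adjugate_diagonal_mul, adjugate_diagonal_mul,
    Real.norm_eq_abs, sq_abs, mul_pow]
  simp [Real.sq_sqrt h1.le]

theorem nx_real (q : Fin 3 × Fin 3) : nx X q = X q.1 q.2 ^ 2 := by
  rw [nx, Real.norm_eq_abs, sq_abs]

theorem ny_real (q : Fin 3 × Fin 3) : ny X q = X.adjugate q.2 q.1 ^ 2 := by
  rw [ny, Real.norm_eq_abs, sq_abs]

end Diagonal

theorem sign_mul_conjTranspose {d : Fin 3 → ℝ} (h : ∀ i, d i * d i = 1) :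
    diagonal d * (diagonal d)ᴴ = 1 := by
  rw [diagonal_conjTranspose, diagonal_mul_diagonal]
  simp [h]

/-- Flipping the sign of the second column cancels the cross term with the first or third column,
leaving two squares. -/
theorem integral_muX_two_signs (k : ℕ) {f : Matrix (Fin 3) (Fin 3) ℝ → ℝ} (hf : Continuous f)
    {v : ℝ} (hg : HasInt (gauEnt ℝ) (fun x => f (vmat x)) (gauMass ℝ ^ 9 * v))
    (t t' : ℕ × ℕ × ℕ × ℕ × ℕ × ℕ) {g g' : Matrix (Fin 3) (Fin 3) ℝ → ℝ} (hgc : Continuous g)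
    (hgc' : Continuous g')
    (h : ∀ (p : HermCoord ℝ) (X : Matrix (Fin 3) (Fin 3) ℝ), 0 < p.1 → 0 < p.2.2.2.1 →
      0 < p.2.2.2.2.2 → f (X * diagonal ![1, 1, 1] * (cholMat p)ᴴ)
        + f (X * diagonal ![1, -1, 1] * (cholMat p)ᴴ)
        = 2 * (chiMono t p * g X + chiMono t' p * g' X)) :
    chiVal ℝ (k + 3 / 2) t * ∫ x, g (vmat x) ∂muX ℝ k
      + chiVal ℝ (k + 3 / 2) t' * ∫ x, g' (vmat x) ∂muX ℝ k = muMass ℝ k * v := by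
  have := integral_muX_of_gauEnt k hf hg [diagonal ![1, 1, 1], diagonal ![1, -1, 1]]
    (by
      intro D hD
      simp only [List.mem_cons, List.not_mem_nil, or_false] at hD
      rcases hD with rfl | rfl <;> refine sign_mul_conjTranspose fun i => ?_ <;>
        fin_cases i <;> simp)
    (by simp) [(t, g), (t', g')] (by simp [hgc, hgc'])
    (fun p X h1 h2 h3 => by simpa using h p X h1 h2 h3)
  simpa [finrank_real_real] using this

/-- Three columns interact here. The signs of the first two suffice to cancel all three cross terms,
because only relative signs matter in a square. -/
theorem integral_muX_four_signs (k : ℕ) {f : Matrix (Fin 3) (Fin 3) ℝ → ℝ} (hf : Continuous f)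
    {v : ℝ} (hg : HasInt (gauEnt ℝ) (fun x => f (vmat x)) (gauMass ℝ ^ 9 * v))
    (t t' t'' : ℕ × ℕ × ℕ × ℕ × ℕ × ℕ) {g g' g'' : Matrix (Fin 3) (Fin 3) ℝ → ℝ}
    (hgc : Continuous g) (hgc' : Continuous g') (hgc'' : Continuous g'')
    (h : ∀ (p : HermCoord ℝ) (X : Matrix (Fin 3) (Fin 3) ℝ), 0 < p.1 → 0 < p.2.2.2.1 →
      0 < p.2.2.2.2.2 → f (X * diagonal ![1, 1, 1] * (cholMat p)ᴴ)
        + f (X * diagonal ![1, -1, 1] * (cholMat p)ᴴ) + f (X * diagonal ![-1, 1, 1] * (cholMat p)ᴴ)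
        + f (X * diagonal ![-1, -1, 1] * (cholMat p)ᴴ)
        = 4 * (chiMono t p * g X + chiMono t' p * g' X + chiMono t'' p * g'' X)) :
    chiVal ℝ (k + 3 / 2) t * ∫ x, g (vmat x) ∂muX ℝ k
      + chiVal ℝ (k + 3 / 2) t' * ∫ x, g' (vmat x) ∂muX ℝ k
      + chiVal ℝ (k + 3 / 2) t'' * ∫ x, g'' (vmat x) ∂muX ℝ k = muMass ℝ k * v := by
  have := integral_muX_of_gauEnt k hf hg [diagonal ![1, 1, 1], diagonal ![1, -1, 1],
    diagonal ![-1, 1, 1], diagonal ![-1, -1, 1]]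
    (by
      intro D hD
      simp only [List.mem_cons, List.not_mem_nil, or_false] at hD
      rcases hD with rfl | rfl | rfl | rfl <;> refine sign_mul_conjTranspose fun i => ?_ <;>
        fin_cases i <;> simp)
    (by simp) [(t, g), (t', g'), (t'', g'')] (by simp [hgc, hgc', hgc''])
    (fun p X h1 h2 h3 => by simpa [add_assoc] using h p X h1 h2 h3)
  simpa [finrank_real_real, add_assoc] using this

theorem neg_one_lt_add_half (k : ℕ) : -1 < (k + 3 / 2 : ℝ) := by
  have : (0 : ℝ) ≤ k := by positivity
  linarith

/-- This solves one row of the triangular system: the coefficient of the unknown integral is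
positive. -/
theorem eq_of_two_terms (k : ℕ) {t t' : ℕ × ℕ × ℕ × ℕ × ℕ × ℕ} {M a va b vb v : ℝ}
    (h : chiVal ℝ (k + 3 / 2) t * a + chiVal ℝ (k + 3 / 2) t' * b = M * v) (ha : a = M * va)
    (hv : chiVal ℝ (k + 3 / 2) t * va + chiVal ℝ (k + 3 / 2) t' * vb = v) : b = M * vb := by
  refine mul_left_cancel₀ (chiVal_pos (𝕜 := ℝ) (neg_one_lt_add_half k) t').ne' ?_
  rw [← hv, ha] at h
  linarith

theorem eq_of_three_terms (k : ℕ) {t t' t'' : ℕ × ℕ × ℕ × ℕ × ℕ × ℕ}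
    {M a va b vb c vc v : ℝ}
    (h : chiVal ℝ (k + 3 / 2) t * a + chiVal ℝ (k + 3 / 2) t' * b
      + chiVal ℝ (k + 3 / 2) t'' * c = M * v) (ha : a = M * va) (hb : b = M * vb)
    (hv : chiVal ℝ (k + 3 / 2) t * va + chiVal ℝ (k + 3 / 2) t' * vb
      + chiVal ℝ (k + 3 / 2) t'' * vc = v) : c = M * vc := by
  refine mul_left_cancel₀ (chiVal_pos (𝕜 := ℝ) (neg_one_lt_add_half k) t'').ne' ?_
  rw [← hv, ha, hb] at h
  linarith

theorem integral_muX_mono_real (k : ℕ) {f : Matrix (Fin 3) (Fin 3) ℝ → ℝ} (hf : Continuous f)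
    {v : ℝ} (hg : HasInt (gauEnt ℝ) (fun x => f (vmat x)) (gauMass ℝ ^ 9 * v))
    (t : ℕ × ℕ × ℕ × ℕ × ℕ × ℕ)
    (h : ∀ (p : HermCoord ℝ) (X : Matrix (Fin 3) (Fin 3) ℝ), 0 < p.1 → 0 < p.2.2.2.1 →
      0 < p.2.2.2.2.2 → f (X * (cholMat p)ᴴ) = chiMono t p * f X) :
    ∫ x, f (vmat x) ∂muX ℝ k = muMass ℝ k * (v / chiVal ℝ (k + 3 / 2) t) := by
  have h1 := integral_muX_of_gauEnt_mono k hf hg t h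
  have h2 := chiVal_pos (𝕜 := ℝ) (neg_one_lt_add_half k) t
  rw [finrank_real_real] at h1
  norm_num at h1
  rw [mul_div_assoc', eq_div_iff h2.ne', ← h1]
  ring

/-- Two entries in the first column are only scaled by √a, which settles equal positions and a
common column. If the second entry lies in the second column, sign averaging expresses it through
the new integral and an already known one in the first column. -/
theorem integral_nx_nx (k : ℕ) :
    ∫ x, nx (vmat x) (0, 0) * nx (vmat x) (0, 0) ∂muX ℝ k
      = muMass ℝ k * (3 / ((2 * k + 7) * (2 * k + 9))) ∧
    ∫ x, nx (vmat x) (0, 0) * nx (vmat x) (1, 0) ∂muX ℝ k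
      = muMass ℝ k * (1 / ((2 * k + 7) * (2 * k + 9))) ∧
    ∫ x, nx (vmat x) (0, 0) * nx (vmat x) (0, 1) ∂muX ℝ k
      = muMass ℝ k * (1 / ((2 * k + 7) * (2 * k + 9))) ∧
    ∫ x, nx (vmat x) (0, 0) * nx (vmat x) (1, 1) ∂muX ℝ k
      = muMass ℝ k * ((k + 4) / ((2 * k + 7) * (2 * k + 9) * (k + 3))) := by
  have hc : ∀ q q', Continuous fun X : Matrix (Fin 3) (Fin 3) ℝ => nx X q * nx X q' :=
    fun q q' => (continuous_nx_apply q).mul (continuous_nx_apply q')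
  have g := fun (q q' : Fin 3 × Fin 3) (v : ℤ) h => hasInt_gauEnt_of_poly
    (f := fun X => nx X q * nx X q')
    ((entPoly q.1 q.2).sq.mul (entPoly q'.1 q'.2).sq) 2 v
    (by simp [EntPoly.sq, EntPoly.mul, entPoly]) h
    (fun x => by rw [EntPoly.ev_mul, ev_entPoly, ev_entPoly])
  have h4 := integral_muX_mono_real k (hc (0, 0) (0, 0)) (g (0, 0) (0, 0) 3 (by decide +kernel))
    (2, 0, 0, 0, 0, 0) fun p X h1 h2 h3 => by
      simp only [nx_mul_cholMat_zero X h1, chiMono]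
      ring
  have h2 := integral_muX_mono_real k (hc (0, 0) (1, 0)) (g (0, 0) (1, 0) 1 (by decide +kernel))
    (2, 0, 0, 0, 0, 0) fun p X h1 h2 h3 => by
      simp only [nx_mul_cholMat_zero X h1, chiMono]
      ring
  have e4 : ∫ x, nx (vmat x) (0, 0) * nx (vmat x) (0, 0) ∂muX ℝ k
      = muMass ℝ k * (3 / ((2 * k + 7) * (2 * k + 9))) := by
    rw [h4]
    congr 1
    simp [chiVal, rising, Finset.prod_range_succ]
    field_simp
    ring
  have e2 : ∫ x, nx (vmat x) (0, 0) * nx (vmat x) (1, 0) ∂muX ℝ k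
      = muMass ℝ k * (1 / ((2 * k + 7) * (2 * k + 9))) := by
    rw [h2]
    congr 1
    simp [chiVal, rising, Finset.prod_range_succ]
    field_simp
    ring
  have hr := integral_muX_two_signs k (hc (0, 0) (0, 1)) (g (0, 0) (0, 1) 1 (by decide +kernel))
    (1, 1, 0, 0, 0, 0) (1, 0, 0, 1, 0, 0) (hc (0, 0) (0, 0)) (hc (0, 0) (0, 1))
    fun p X h1 h2 h3 => by
      simp only [nx_real_zero _ _ _ h1, nx_real_one, chiMono, Real.norm_eq_abs, sq_abs]
      simp [nx_real]
      linear_combination (2 * p.1 * X 0 0 ^ 2 * X 0 1 ^ 2) * Real.sq_sqrt h2.le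
  have hd := integral_muX_two_signs k (hc (0, 0) (1, 1)) (g (0, 0) (1, 1) 1 (by decide +kernel))
    (1, 1, 0, 0, 0, 0) (1, 0, 0, 1, 0, 0) (hc (0, 0) (1, 0)) (hc (0, 0) (1, 1))
    fun p X h1 h2 h3 => by
      simp only [nx_real_zero _ _ _ h1, nx_real_one, chiMono, Real.norm_eq_abs, sq_abs]
      simp [nx_real]
      linear_combination (2 * p.1 * X 0 0 ^ 2 * X 1 1 ^ 2) * Real.sq_sqrt h2.le
  refine ⟨e4, e2, eq_of_two_terms k hr e4 ?_, eq_of_two_terms k hd e2 ?_⟩ <;>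
  · simp [chiVal, rising]
    field_simp
    ring

end RealContraction

open Matrix Module
open scoped ENNReal Kronecker

/-! ### Second moments involving minors and the determinant -/

section RealContractionTable

/-- The scheme of `integral_nx_nx` applies from the other end: cofactors in the last column are
scaled, and those in the middle column mix only with the last. -/
theorem integral_ny_ny (k : ℕ) :
    ∫ x, ny (vmat x) (0, 2) * ny (vmat x) (0, 2) ∂muX ℝ k
      = muMass ℝ k * (6 / ((2 * k + 7) * (2 * k + 9) * (k + 3) * (k + 4))) ∧
    ∫ x, ny (vmat x) (0, 2) * ny (vmat x) (1, 2) ∂muX ℝ k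
      = muMass ℝ k * (2 / ((2 * k + 7) * (2 * k + 9) * (k + 3) * (k + 4))) ∧
    ∫ x, ny (vmat x) (0, 2) * ny (vmat x) (0, 1) ∂muX ℝ k
      = muMass ℝ k * (2 / ((2 * k + 7) * (2 * k + 9) * (k + 3) * (k + 4))) ∧
    ∫ x, ny (vmat x) (0, 2) * ny (vmat x) (1, 1) ∂muX ℝ k
      = muMass ℝ k * ((3 * k + 10) /
        ((2 * k + 7) * (2 * k + 9) * (k + 3) * (k + 4) * (2 * k + 5))) := by
  have hc : ∀ q q', Continuous fun X : Matrix (Fin 3) (Fin 3) ℝ => ny X q * ny X q' :=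
    fun q q' => (continuous_ny_apply q).mul (continuous_ny_apply q')
  have g := fun (l l' : EntPoly) (q q' : Fin 3 × Fin 3) (v : ℤ) h hl
      (h1 : ∀ x, l.ev x = ny (vmat x) q) (h2 : ∀ x, l'.ev x = ny (vmat x) q') =>
    hasInt_gauEnt_of_poly (f := fun X => ny X q * ny X q') (l.mul l') 4 v h hl
      (fun x => by rw [EntPoly.ev_mul, h1 x, h2 x])
  have h4 := integral_muX_mono_real k (hc (0, 2) (0, 2))
    (g _ _ (0, 2) (0, 2) 24 (by decide +kernel) (by decide +kernel)
      (fun x => (ev_minorPoly x).1) (fun x => (ev_minorPoly x).1))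
    (2, 0, 0, 2, 0, 0) fun p X h1 h2 h3 => by
      simp only [ny_mul_cholMat_two X h1 h2, chiMono]
      ring
  have h2 := integral_muX_mono_real k (hc (0, 2) (1, 2))
    (g _ _ (0, 2) (1, 2) 8 (by decide +kernel) (by decide +kernel)
      (fun x => (ev_minorPoly x).1) (fun x => (ev_minorPoly x).2.1))
    (2, 0, 0, 2, 0, 0) fun p X h1 h2 h3 => by
      simp only [ny_mul_cholMat_two X h1 h2, chiMono]
      ring
  have e4 : ∫ x, ny (vmat x) (0, 2) * ny (vmat x) (0, 2) ∂muX ℝ k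
      = muMass ℝ k * (6 / ((2 * k + 7) * (2 * k + 9) * (k + 3) * (k + 4))) := by
    rw [h4]
    congr 1
    simp [chiVal, rising, Finset.prod_range_succ]
    field_simp
    ring
  have e2 : ∫ x, ny (vmat x) (0, 2) * ny (vmat x) (1, 2) ∂muX ℝ k
      = muMass ℝ k * (2 / ((2 * k + 7) * (2 * k + 9) * (k + 3) * (k + 4))) := by
    rw [h2]
    congr 1
    simp [chiVal, rising, Finset.prod_range_succ]
    field_simp
    ring
  have hr := integral_muX_two_signs k (hc (0, 2) (0, 1))
    (g _ _ (0, 2) (0, 1) 8 (by decide +kernel) (by decide +kernel)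
      (fun x => (ev_minorPoly x).1) (fun x => (ev_minorPoly x).2.2.1))
    (2, 0, 0, 1, 1, 0) (2, 0, 0, 1, 0, 1) (hc (0, 2) (0, 2)) (hc (0, 2) (0, 1))
    fun p X h1 h2 h3 => by
      simp only [ny_real_two _ _ _ h1 h2, ny_real_one _ _ _ h1, chiMono, Real.norm_eq_abs, sq_abs]
      simp only [ny_real]
      simp
      linear_combination (2 * p.1 ^ 2 * p.2.2.2.1 * X.adjugate 2 0 ^ 2 * X.adjugate 1 0 ^ 2)
        * Real.sq_sqrt h3.le
  have hd := integral_muX_two_signs k (hc (0, 2) (1, 1))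
    (g _ _ (0, 2) (1, 1) 6 (by decide +kernel) (by decide +kernel)
      (fun x => (ev_minorPoly x).1) (fun x => (ev_minorPoly x).2.2.2))
    (2, 0, 0, 1, 1, 0) (2, 0, 0, 1, 0, 1) (hc (0, 2) (1, 2)) (hc (0, 2) (1, 1))
    fun p X h1 h2 h3 => by
      simp only [ny_real_two _ _ _ h1 h2, ny_real_one _ _ _ h1, chiMono, Real.norm_eq_abs, sq_abs]
      simp only [ny_real]
      simp
      linear_combination (2 * p.1 ^ 2 * p.2.2.2.1 * X.adjugate 2 0 ^ 2 * X.adjugate 1 1 ^ 2)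
        * Real.sq_sqrt h3.le
  refine ⟨e4, e2, eq_of_two_terms k hr e4 ?_, eq_of_two_terms k hd e2 ?_⟩ <;>
  · simp [chiVal, rising, Finset.prod_range_succ]
    field_simp
    ring

/-- Rows and columns are permuted separately, so the orbit of a pair of positions is determined by
whether the rows agree and whether the columns agree. -/
theorem exists_perm_of_iff {p q p' q' : Fin 3 × Fin 3} (h1 : p.1 = q.1 ↔ p'.1 = q'.1)
    (h2 : p.2 = q.2 ↔ p'.2 = q'.2) : ∃ σ τ : Equiv.Perm (Fin 3),
      Prod.map σ τ p = p' ∧ Prod.map σ τ q = q' := by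
  have key : ∀ a b a' b' : Fin 3, (a = b ↔ a' = b') →
      ∃ σ : Equiv.Perm (Fin 3), σ a = a' ∧ σ b = b' := by decide
  obtain ⟨σ, hs1, hs2⟩ := key _ _ _ _ h1
  obtain ⟨τ, ht1, ht2⟩ := key _ _ _ _ h2
  exact ⟨σ, τ, Prod.ext hs1 ht1, Prod.ext hs2 ht2⟩

section Symmetry

variable (k : ℕ) {p q p' q' : Fin 3 × Fin 3} (h1 : p.1 = q.1 ↔ p'.1 = q'.1)
  (h2 : p.2 = q.2 ↔ p'.2 = q'.2)

include h1 h2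

theorem integral_nx_nx_eq : ∫ x, nx (vmat x) p * nx (vmat x) q ∂muX ℝ k
    = ∫ x, nx (vmat x) p' * nx (vmat x) q' ∂muX ℝ k := by
  obtain ⟨σ, τ, rfl, rfl⟩ := exists_perm_of_iff h1 h2
  exact (integral_muX_perm k σ τ (F := fun a _ _ => a p * a q) (by fun_prop)).symm

theorem integral_ny_ny_eq : ∫ x, ny (vmat x) p * ny (vmat x) q ∂muX ℝ k
    = ∫ x, ny (vmat x) p' * ny (vmat x) q' ∂muX ℝ k := by
  obtain ⟨σ, τ, rfl, rfl⟩ := exists_perm_of_iff h1 h2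
  exact (integral_muX_perm k σ τ (F := fun _ b _ => b p * b q) (by fun_prop)).symm

theorem integral_nx_ny_eq : ∫ x, nx (vmat x) p * ny (vmat x) q ∂muX ℝ k
    = ∫ x, nx (vmat x) p' * ny (vmat x) q' ∂muX ℝ k := by
  obtain ⟨σ, τ, rfl, rfl⟩ := exists_perm_of_iff h1 h2
  exact (integral_muX_perm k σ τ (F := fun a b _ => a p * b q) (by fun_prop)).symm

end Symmetry

/-- An entry of the first column and a cofactor of the last are both merely scaled. For an entry of
the last column all three columns of X contribute; sign averaging separates them, and the first two
contributions are known up to a permutation of columns. -/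
theorem integral_nx_ny (k : ℕ) :
    ∫ x, nx (vmat x) (0, 0) * ny (vmat x) (1, 2) ∂muX ℝ k
      = muMass ℝ k * (2 / ((2 * k + 7) * (2 * k + 9) * (k + 3))) ∧
    ∫ x, nx (vmat x) (0, 0) * ny (vmat x) (0, 2) ∂muX ℝ k
      = muMass ℝ k * (1 / ((2 * k + 7) * (2 * k + 9) * (k + 3))) ∧
    ∫ x, nx (vmat x) (0, 2) * ny (vmat x) (1, 2) ∂muX ℝ k
      = muMass ℝ k * (1 / ((2 * k + 7) * (2 * k + 9) * (k + 3))) ∧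
    ∫ x, nx (vmat x) (0, 2) * ny (vmat x) (0, 2) ∂muX ℝ k
      = muMass ℝ k * (1 / ((2 * k + 9) * (k + 3) * (2 * k + 5))) := by
  have hc : ∀ q q', Continuous fun X : Matrix (Fin 3) (Fin 3) ℝ => nx X q * ny X q' :=
    fun q q' => (continuous_nx_apply q).mul (continuous_ny_apply q')
  have g := fun (l' : EntPoly) (q q' : Fin 3 × Fin 3) (v : ℤ) h hl
      (h2 : ∀ x, l'.ev x = ny (vmat x) q') => hasInt_gauEnt_of_poly (f := fun X => nx X q * ny X q') ((entPoly q.1 q.2).sq.mul l') 3 v h hl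
      (fun x => by rw [EntPoly.ev_mul, ev_entPoly, h2 x])
  have hu := integral_muX_mono_real k (hc (0, 0) (1, 2))
    (g _ (0, 0) (1, 2) 4 (by decide +kernel) (by decide +kernel) (fun x => (ev_minorPoly x).2.1))
    (2, 0, 0, 1, 0, 0) fun p X h1 h2 h3 => by
      simp only [nx_mul_cholMat_zero X h1, ny_mul_cholMat_two X h1 h2, chiMono]
      ring
  have hr := integral_muX_mono_real k (hc (0, 0) (0, 2))
    (g _ (0, 0) (0, 2) 2 (by decide +kernel) (by decide +kernel) (fun x => (ev_minorPoly x).1))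
    (2, 0, 0, 1, 0, 0) fun p X h1 h2 h3 => by
      simp only [nx_mul_cholMat_zero X h1, ny_mul_cholMat_two X h1 h2, chiMono]
      ring
  have eu : ∫ x, nx (vmat x) (0, 0) * ny (vmat x) (1, 2) ∂muX ℝ k
      = muMass ℝ k * (2 / ((2 * k + 7) * (2 * k + 9) * (k + 3))) := by
    rw [hu]
    congr 1
    simp [chiVal, rising, Finset.prod_range_succ]
    field_simp
    ring
  have er : ∫ x, nx (vmat x) (0, 0) * ny (vmat x) (0, 2) ∂muX ℝ k
      = muMass ℝ k * (1 / ((2 * k + 7) * (2 * k + 9) * (k + 3))) := by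
    rw [hr]
    congr 1
    simp [chiVal, rising, Finset.prod_range_succ]
    field_simp
    ring
  have eu' := (integral_nx_ny_eq k (p := (0, 1)) (q := (1, 2)) (p' := (0, 0)) (q' := (1, 2))
    (by decide) (by decide)).trans eu
  have er' := (integral_nx_ny_eq k (p := (0, 1)) (q := (0, 2)) (p' := (0, 0)) (q' := (0, 2))
    (by decide) (by decide)).trans er
  have h4 : ∀ (i : Fin 3) (p : HermCoord ℝ) (X : Matrix (Fin 3) (Fin 3) ℝ), 0 < p.1 →
      0 < p.2.2.2.1 → 0 < p.2.2.2.2.2 →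
      nx (X * diagonal ![1, 1, 1] * (cholMat p)ᴴ) (0, 2)
          * ny (X * diagonal ![1, 1, 1] * (cholMat p)ᴴ) (i, 2)
        + nx (X * diagonal ![1, -1, 1] * (cholMat p)ᴴ) (0, 2)
          * ny (X * diagonal ![1, -1, 1] * (cholMat p)ᴴ) (i, 2)
        + nx (X * diagonal ![-1, 1, 1] * (cholMat p)ᴴ) (0, 2)
          * ny (X * diagonal ![-1, 1, 1] * (cholMat p)ᴴ) (i, 2)
        + nx (X * diagonal ![-1, -1, 1] * (cholMat p)ᴴ) (0, 2)
          * ny (X * diagonal ![-1, -1, 1] * (cholMat p)ᴴ) (i, 2)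
        = 4 * (chiMono (1, 0, 1, 1, 0, 0) p * (nx X (0, 0) * ny X (i, 2))
          + chiMono (1, 0, 0, 1, 1, 0) p * (nx X (0, 1) * ny X (i, 2))
          + chiMono (1, 0, 0, 1, 0, 1) p * (nx X (0, 2) * ny X (i, 2))) := by
    intro i p X h1 h2 h3
    simp only [ny_real_two _ _ _ h1 h2, nx_real_two, chiMono, Real.norm_eq_abs, sq_abs]
    simp only [ny_real, nx_real]
    simp
    linear_combination (4 * p.1 * p.2.2.2.1 * X.adjugate 2 i ^ 2 * X 0 2 ^ 2)
      * Real.sq_sqrt h3.le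
  have hv := integral_muX_four_signs k (hc (0, 2) (1, 2))
    (g _ (0, 2) (1, 2) 2 (by decide +kernel) (by decide +kernel) (fun x => (ev_minorPoly x).2.1))
    _ _ _ (hc _ _) (hc _ _) (hc _ _) (h4 1)
  have hs := integral_muX_four_signs k (hc (0, 2) (0, 2))
    (g _ (0, 2) (0, 2) 2 (by decide +kernel) (by decide +kernel) (fun x => (ev_minorPoly x).1))
    _ _ _ (hc _ _) (hc _ _) (hc _ _) (h4 0)
  refine ⟨eu, er, eq_of_three_terms k hv eu eu' ?_, eq_of_three_terms k hs er er' ?_⟩ <;>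
  · simp [chiVal, rising]
    field_simp
    ring

/-- The determinant is scaled by √(a b c), so with a suitable choice of q a single monomial occurs
and no sign averaging is needed. -/
theorem integral_nd_nd (k : ℕ) :
    (∀ q, ∫ x, nd (vmat x) * nx (vmat x) q ∂muX ℝ k
      = muMass ℝ k * (5 / ((2 * k + 5) * (2 * k + 7) * (2 * k + 9) * (k + 3)))) ∧
    (∀ q, ∫ x, nd (vmat x) * ny (vmat x) q ∂muX ℝ k
      = muMass ℝ k * (10 / ((2 * k + 5) * (2 * k + 7) * (2 * k + 9) * (k + 3) * (k + 4)))) ∧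
    ∫ x, nd (vmat x) * nd (vmat x) ∂muX ℝ k
      = muMass ℝ k * (90 / ((2 * k + 5) * (2 * k + 7) ^ 2 * (2 * k + 9) * (k + 3) * (k + 4))) := by
  have cd : Continuous fun X : Matrix (Fin 3) (Fin 3) ℝ => nd X := continuous_nd
  have g := fun (f : Matrix (Fin 3) (Fin 3) ℝ → ℝ) (l : EntPoly) (m : ℕ) (v : ℤ) hm hv
      (h : ∀ x, l.ev x = f (vmat x)) =>
    hasInt_gauEnt_of_poly (f := fun X => nd X * f X) (detSqPoly.mul l) m v hm hv
      (fun x => by rw [EntPoly.ev_mul, h, ev_detSqPoly])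
  have hx := integral_muX_mono_real k (f := fun X => nd X * nx X (0, 0))
    (cd.mul (continuous_nx_apply _)) (g (fun X => nx X (0, 0)) _ 4 10 (by decide +kernel)
      (by decide +kernel) (ev_entPoly 0 0))
    (2, 0, 0, 1, 0, 1) fun p X h1 h2 h3 => by
      simp only [nx_mul_cholMat_zero X h1, nd_mul_cholMat X h1 h2 h3, chiMono]
      ring
  have hy := integral_muX_mono_real k (f := fun X => nd X * ny X (0, 2))
    (cd.mul (continuous_ny_apply _))
    (g (fun X => ny X (0, 2)) _ 5 40 (by decide +kernel)
      (by decide +kernel) (fun x => (ev_minorPoly x).1))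
    (2, 0, 0, 2, 0, 1) fun p X h1 h2 h3 => by
      simp only [ny_mul_cholMat_two X h1 h2, nd_mul_cholMat X h1 h2 h3, chiMono]
      ring
  have hd := integral_muX_mono_real k (f := fun X => nd X * nd X) (cd.mul cd)
    (g nd _ 6 360 (by decide +kernel) (by decide +kernel) ev_detSqPoly)
    (2, 0, 0, 2, 0, 2) fun p X h1 h2 h3 => by
      simp only [nd_mul_cholMat X h1 h2 h3, chiMono]
      ring
  refine ⟨fun q => ?_, fun q => ?_, ?_⟩
  · have := integral_muX_perm (𝕜 := ℝ) k (Equiv.swap q.1 0) (Equiv.swap q.2 0)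
      (F := fun a _ t => t * a q) (by fun_prop)
    simp only [Function.comp_apply, Prod.map, Equiv.swap_apply_left] at this
    rw [← this, hx]
    congr 1
    simp [chiVal, rising, Finset.prod_range_succ]
    field_simp
    ring
  · have := integral_muX_perm (𝕜 := ℝ) k (Equiv.swap q.1 0) (Equiv.swap q.2 2)
      (F := fun _ b t => t * b q) (by fun_prop)
    simp only [Function.comp_apply, Prod.map, Equiv.swap_apply_left] at this
    rw [← this, hy]
    congr 1
    simp [chiVal, rising, Finset.prod_range_succ]
    field_simp
    ring
  · rw [hd]
    congr 1
    simp [chiVal, rising, Finset.prod_range_succ]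
    field_simp
    ring

end RealContractionTable

open Matrix Module
open scoped ENNReal Kronecker

/-! ### The second moment of the normal form over ℝ -/

section ContractionSquare

/-- A function on pairs of positions that only sees coincidences of rows and of columns. -/
def coincidence (a r c d : ℝ) (p q : Fin 3 × Fin 3) : ℝ :=
  if p.1 = q.1 then if p.2 = q.2 then a else r else if p.2 = q.2 then c else d

/-- The `decide` defaults certify that the four sample pairs realise the four coincidence patterns.
-/
theorem eq_coincidence {F : Fin 3 × Fin 3 → Fin 3 × Fin 3 → ℝ}
    (hF : ∀ p q p' q' : Fin 3 × Fin 3, (p.1 = q.1 ↔ p'.1 = q'.1) → (p.2 = q.2 ↔ p'.2 = q'.2) →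
      F p q = F p' q') {M a r c d : ℝ} {p₁ q₁ p₂ q₂ p₃ q₃ p₄ q₄ : Fin 3 × Fin 3}
    (h1 : F p₁ q₁ = M * a) (h2 : F p₂ q₂ = M * r) (h3 : F p₃ q₃ = M * c) (h4 : F p₄ q₄ = M * d)
    (p q : Fin 3 × Fin 3) (e1 : p₁.1 = q₁.1 ∧ p₁.2 = q₁.2 := by decide) (e2 : p₂.1 = q₂.1 ∧ p₂.2 ≠ q₂.2 := by decide)
    (e3 : p₃.1 ≠ q₃.1 ∧ p₃.2 = q₃.2 := by decide) (e4 : p₄.1 ≠ q₄.1 ∧ p₄.2 ≠ q₄.2 := by decide) : F p q = M * coincidence a r c d p q := by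
  unfold coincidence
  split_ifs with i j j
  · rw [← h1, hF p q p₁ q₁ (by simp [i, e1.1]) (by simp [j, e1.2])]
  · rw [← h2, hF p q p₂ q₂ (by simp [i, e2.1]) (by simp [j, e2.2])]
  · rw [← h3, hF p q p₃ q₃ (by simp [i, e3.1]) (by simp [j, e3.2])]
  · rw [← h4, hF p q p₄ q₄ (by simp [i, e4.1]) (by simp [j, e4.2])]

variable (f : Fin 3 → ℝ)

/-- The products of the complementary entries. -/
def cofac (i : Fin 3) : ℝ := ![f 1 * f 2, f 0 * f 2, f 0 * f 1] i

/-- The kernel is b + (a - b)([rows agree] + [columns agree]) + (a + b)[both agree], and each part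
factors. The sums of squares are e₁² - 2 e₂ for f and e₂² - 2 e₁ e₃ for the cofactors. -/
theorem sum_coincidence_same (a b : ℝ) :
    ∑ p : Fin 3 × Fin 3, ∑ q : Fin 3 × Fin 3,
      f p.1 * cofac f p.2 * (f q.1 * cofac f q.2) * coincidence (3 * a) a a b p q
      = 3 * a * ((f 0 + f 1 + f 2) * (f 1 * f 2 + f 0 * f 2 + f 0 * f 1)) ^ 2 - 4 * a * ((f 1 * f 2 + f 0 * f 2 + f 0 * f 1) ^ 3 + (f 0 + f 1 + f 2) ^ 3 * (f 0 * f 1 * f 2))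
        + 4 * (a + b) * ((f 0 + f 1 + f 2) * (f 1 * f 2 + f 0 * f 2 + f 0 * f 1) * (f 0 * f 1 * f 2)) := by
  simp [Fintype.sum_prod_type, Fin.sum_univ_three, coincidence, cofac]
  ring

theorem sum_coincidence_swap (a b : ℝ) :
    ∑ p : Fin 3 × Fin 3, ∑ q : Fin 3 × Fin 3,
      f p.2 * cofac f p.1 * (f q.2 * cofac f q.1) * coincidence (3 * a) a a b p q
      = 3 * a * ((f 0 + f 1 + f 2) * (f 1 * f 2 + f 0 * f 2 + f 0 * f 1)) ^ 2
        - 4 * a * ((f 1 * f 2 + f 0 * f 2 + f 0 * f 1) ^ 3 + (f 0 + f 1 + f 2) ^ 3 * (f 0 * f 1 * f 2))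
        + 4 * (a + b) * ((f 0 + f 1 + f 2) * (f 1 * f 2 + f 0 * f 2 + f 0 * f 1) * (f 0 * f 1 * f 2)) := by
  simp [Fintype.sum_prod_type, Fin.sum_univ_three, coincidence, cofac]
  ring

/-- Here agreement of rows, or of columns, pairs f i with its own cofactor, and each such product is
e₃. The parameters separate the constant part u, the single agreements v and the double agreement w.
-/
theorem sum_coincidence_mixed (u v w : ℝ) :
    ∑ p : Fin 3 × Fin 3, ∑ q : Fin 3 × Fin 3,
      f p.1 * cofac f p.2 * (f q.2 * cofac f q.1) * coincidence (u + 2 * v + w) (u + v) (u + v) u p q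
      = u * ((f 0 + f 1 + f 2) * (f 1 * f 2 + f 0 * f 2 + f 0 * f 1)) ^ 2
        + 6 * v * ((f 0 + f 1 + f 2) * (f 1 * f 2 + f 0 * f 2 + f 0 * f 1) * (f 0 * f 1 * f 2)) + 9 * w * (f 0 * f 1 * f 2) ^ 2 := by
  simp [Fintype.sum_prod_type, Fin.sum_univ_three, coincidence, cofac]
  ring

theorem sum_mul_cofac : ∑ p : Fin 3 × Fin 3, f p.1 * cofac f p.2 = (f 0 + f 1 + f 2) * (f 1 * f 2 + f 0 * f 2 + f 0 * f 1) ∧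
    ∑ p : Fin 3 × Fin 3, f p.2 * cofac f p.1 = (f 0 + f 1 + f 2) * (f 1 * f 2 + f 0 * f 2 + f 0 * f 1) := by
  simp only [Fintype.sum_prod_type, Fin.sum_univ_three, cofac]
  constructor <;> simp <;> ring

/-- The coefficients of the second moment of `cDet`. -/
noncomputable def sqCoeff (k : ℝ) : Fin 4 → ℝ :=
  ![(16 * k ^ 6 + 336 * k ^ 5 + 2920 * k ^ 4 + 13344 * k ^ 3 + 33469 * k ^ 2 + 42975 * k + 21510) /
      ((2 * k + 5) * (2 * k + 7) ^ 2 * (2 * k + 9) * (k + 3) * (k + 4)),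
    (-8 * k ^ 4 - 88 * k ^ 3 - 306 * k ^ 2 - 270 * k + 180) /
      ((2 * k + 5) * (2 * k + 7) * (2 * k + 9) * (k + 3) * (k + 4)),
    (3 * k ^ 2 + 17 * k + 26) / ((2 * k + 7) * (2 * k + 9) * (k + 3) * (k + 4)),
    -4 * (k ^ 2 + 7 * k + 14) / ((2 * k + 7) * (2 * k + 9) * (k + 3) * (k + 4))]

/-- The square of `cDet_eq` is integrated term by term. The cubic invariants e₂³ and e₁³ e₃ share
one coefficient because both sums of squares produce them in the same proportion. -/
theorem integral_cDet_sq (k : ℕ) : ∫ x, cDet f (vmat x : Matrix (Fin 3) (Fin 3) ℝ) ^ 2 ∂muX ℝ k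
    = muMass ℝ k * (sqCoeff k 0 * (f 0 * f 1 * f 2) ^ 2
      + sqCoeff k 1 * ((f 0 + f 1 + f 2) * (f 1 * f 2 + f 0 * f 2 + f 0 * f 1) * (f 0 * f 1 * f 2))
      + sqCoeff k 2 * ((f 0 + f 1 + f 2) * (f 1 * f 2 + f 0 * f 2 + f 0 * f 1)) ^ 2
      + sqCoeff k 3 * ((f 1 * f 2 + f 0 * f 2 + f 0 * f 1) ^ 3
        + (f 0 + f 1 + f 2) ^ 3 * (f 0 * f 1 * f 2))) := by
  have h1 : HasInt (muX ℝ k) (fun _ => 1) (muMass ℝ k * 1) :=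
    ⟨integrable_muX k continuous_const, by rw [mul_one, integral_one_muX k]⟩
  have hpos := chiVal_pos (𝕜 := ℝ) (neg_one_lt_add_half k)
  have cx := fun q => (continuous_nx_apply q).comp continuous_vmat
  have cy := fun q => (continuous_ny_apply q).comp continuous_vmat
  have cd := (continuous_nd (𝕜 := ℝ)).comp continuous_vmat
  have hx : ∀ q, HasInt (muX ℝ k) (fun x => nx (vmat x) q)
      (muMass ℝ k * (1 / (2 * k + 7))) := fun q =>
    ⟨integrable_muX k (cx q), by
      refine mul_left_cancel₀ (hpos (1, 0, 0, 0, 0, 0)).ne' ?_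
      have := integral_nx_muX (𝕜 := ℝ) k q
      rw [finrank_real_real] at this
      norm_num at this
      rw [this]
      simp [chiVal, rising]
      field_simp
      ring⟩
  have hy : ∀ q, HasInt (muX ℝ k) (fun x => ny (vmat x) q)
      (muMass ℝ k * (1 / ((2 * k + 7) * (k + 3)))) := fun q =>
    ⟨integrable_muX k (cy q), by
      refine mul_left_cancel₀ (hpos (1, 0, 0, 1, 0, 0)).ne' ?_
      have := integral_ny_muX (𝕜 := ℝ) k q
      rw [finrank_real_real] at this
      norm_num at this
      rw [this]
      simp [chiVal, rising]
      field_simp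
      ring⟩
  have hd : HasInt (muX ℝ k) (fun x => nd (vmat x))
      (muMass ℝ k * (3 / ((2 * k + 7) * (k + 3) * (2 * k + 5)))) :=
    ⟨integrable_muX k cd, by
      refine mul_left_cancel₀ (hpos (1, 0, 0, 1, 0, 1)).ne' ?_
      have := integral_nd_muX (𝕜 := ℝ) k
      rw [finrank_real_real] at this
      norm_num at this
      rw [this]
      simp [chiVal, rising]
      field_simp
      ring⟩
  have hxx : ∀ p q, HasInt (muX ℝ k) (fun x => nx (vmat x) p * nx (vmat x) q)
      (muMass ℝ k * coincidence (3 * (1 / ((2 * k + 7) * (2 * k + 9))))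
        (1 / ((2 * k + 7) * (2 * k + 9))) (1 / ((2 * k + 7) * (2 * k + 9)))
        ((k + 4) / ((2 * k + 7) * (2 * k + 9) * (k + 3))) p q) := by
    obtain ⟨i1, i2, i3, i4⟩ := integral_nx_nx k
    exact fun p q => ⟨integrable_muX k ((cx p).mul (cx q)), eq_coincidence
      (F := fun p q => ∫ x, nx (vmat x) p * nx (vmat x) q ∂muX ℝ k)
      (fun p q p' q' => integral_nx_nx_eq k) (i1.trans (by ring)) i3 i2 i4 p q⟩
  have hyy : ∀ p q, HasInt (muX ℝ k) (fun x => ny (vmat x) p * ny (vmat x) q)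
      (muMass ℝ k * coincidence (3 * (2 / ((2 * k + 7) * (2 * k + 9) * (k + 3) * (k + 4))))
        (2 / ((2 * k + 7) * (2 * k + 9) * (k + 3) * (k + 4)))
        (2 / ((2 * k + 7) * (2 * k + 9) * (k + 3) * (k + 4)))
        ((3 * k + 10) / ((2 * k + 7) * (2 * k + 9) * (k + 3) * (k + 4) * (2 * k + 5))) p q) := by
    obtain ⟨i1, i2, i3, i4⟩ := integral_ny_ny k
    exact fun p q => ⟨integrable_muX k ((cy p).mul (cy q)), eq_coincidence
      (F := fun p q => ∫ x, ny (vmat x) p * ny (vmat x) q ∂muX ℝ k)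
      (fun p q p' q' => integral_ny_ny_eq k) (i1.trans (by ring)) i3 i2 i4 p q⟩
  -- The four values are written as u + 2v + w, u + v, u + v and u with v = -u/2, as
  -- `sum_coincidence_mixed` requires.
  have hxy : ∀ p q, HasInt (muX ℝ k) (fun x => nx (vmat x) p * ny (vmat x) q)
      (muMass ℝ k * coincidence (2 / ((2 * k + 7) * (2 * k + 9) * (k + 3))
        + 2 * (-1 / ((2 * k + 7) * (2 * k + 9) * (k + 3)))
        + 1 / ((2 * k + 9) * (k + 3) * (2 * k + 5)))
        (2 / ((2 * k + 7) * (2 * k + 9) * (k + 3)) + -1 / ((2 * k + 7) * (2 * k + 9) * (k + 3)))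
        (2 / ((2 * k + 7) * (2 * k + 9) * (k + 3)) + -1 / ((2 * k + 7) * (2 * k + 9) * (k + 3)))
        (2 / ((2 * k + 7) * (2 * k + 9) * (k + 3))) p q) := by
    obtain ⟨i1, i2, i3, i4⟩ := integral_nx_ny k
    exact fun p q => ⟨integrable_muX k ((cx p).mul (cy q)), eq_coincidence
      (F := fun p q => ∫ x, nx (vmat x) p * ny (vmat x) q ∂muX ℝ k)
      (fun p q p' q' => integral_nx_ny_eq k) (i4.trans (by ring)) (i2.trans (by ring))
      (i3.trans (by ring)) i1 p q⟩
  obtain ⟨dx, dy, dd⟩ := integral_nd_nd k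
  have hdx : ∀ q, HasInt (muX ℝ k) (fun x => nd (vmat x) * nx (vmat x) q) _ :=
    fun q => ⟨integrable_muX k (cd.mul (cx q)), dx q⟩
  have hdy : ∀ q, HasInt (muX ℝ k) (fun x => nd (vmat x) * ny (vmat x) q) _ :=
    fun q => ⟨integrable_muX k (cd.mul (cy q)), dy q⟩
  have hdd : HasInt (muX ℝ k) (fun x => nd (vmat x) * nd (vmat x)) _ :=
    ⟨integrable_muX k (cd.mul cd), dd⟩
  have hF : ∀ x, cDet f (vmat x : Matrix (Fin 3) (Fin 3) ℝ) ^ 2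
      = (f 0 * f 1 * f 2) ^ 2 * 1 - 2 * (f 0 * f 1 * f 2) ^ 2 * nd (vmat x) + (f 0 * f 1 * f 2) ^ 2 * (nd (vmat x) * nd (vmat x))
      + 2 * (f 0 * f 1 * f 2) * ((∑ p : Fin 3 × Fin 3, f p.2 * cofac f p.1 * ny (vmat x) p)
        - ∑ p : Fin 3 × Fin 3, f p.1 * cofac f p.2 * nx (vmat x) p)
      + 2 * (f 0 * f 1 * f 2) * ((∑ p : Fin 3 × Fin 3, f p.1 * cofac f p.2 * (nd (vmat x) * nx (vmat x) p))
        - ∑ p : Fin 3 × Fin 3, f p.2 * cofac f p.1 * (nd (vmat x) * ny (vmat x) p))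
      + (∑ p : Fin 3 × Fin 3, ∑ q : Fin 3 × Fin 3,
          f p.1 * cofac f p.2 * (f q.1 * cofac f q.2) * (nx (vmat x) p * nx (vmat x) q))
      + (∑ p : Fin 3 × Fin 3, ∑ q : Fin 3 × Fin 3,
          f p.2 * cofac f p.1 * (f q.2 * cofac f q.1) * (ny (vmat x) p * ny (vmat x) q))
      - 2 * ∑ p : Fin 3 × Fin 3, ∑ q : Fin 3 × Fin 3,
          f p.1 * cofac f p.2 * (f q.2 * cofac f q.1) * (nx (vmat x) p * ny (vmat x) q) := by
    intro x
    have hX : ∀ (m : Fin 3 × Fin 3 → ℝ), ∑ p : Fin 3 × Fin 3, ∑ q : Fin 3 × Fin 3, m p * m q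
        = (∑ p, m p) * ∑ q, m q := fun m => (Fintype.sum_mul_sum _ _).symm
    set X := vmat x
    have hc : cDet f X = (f 0 * f 1 * f 2) - (∑ p : Fin 3 × Fin 3, f p.1 * cofac f p.2 * nx X p)
        + (∑ p : Fin 3 × Fin 3, f p.2 * cofac f p.1 * ny X p) - (f 0 * f 1 * f 2) * nd X := by
      simp only [cDet_eq, Fintype.sum_prod_type, cofac]
    have hp : ∀ a b a' b' : Fin 3 × Fin 3 → ℝ, ∑ p : Fin 3 × Fin 3, ∑ q : Fin 3 × Fin 3,
        a p * b q * (a' p * b' q) = (∑ p, a p * a' p) * ∑ q, b q * b' q := fun a b a' b' => by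
      rw [Fintype.sum_mul_sum]
      exact Finset.sum_congr rfl fun p _ => Finset.sum_congr rfl fun q _ => by ring
    have hn : ∀ a b : Fin 3 × Fin 3 → ℝ, ∑ p, a p * (nd X * b p) = nd X * ∑ p, a p * b p :=
      fun a b => by
        rw [Finset.mul_sum]
        exact Finset.sum_congr rfl fun p _ => by ring
    rw [hc, hp (fun p => f p.1 * cofac f p.2) (fun p => f p.1 * cofac f p.2),
      hp (fun p => f p.2 * cofac f p.1) (fun p => f p.2 * cofac f p.1),
      hp (fun p => f p.1 * cofac f p.2) (fun p => f p.2 * cofac f p.1),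
      hn (fun p => f p.1 * cofac f p.2), hn (fun p => f p.2 * cofac f p.1)]
    ring
  have hI := (((((((h1.const_mul ((f 0 * f 1 * f 2) ^ 2)).sub (hd.const_mul (2 * (f 0 * f 1 * f 2) ^ 2))).add
    (hdd.const_mul ((f 0 * f 1 * f 2) ^ 2))).add
    (((HasInt.sum Finset.univ fun p _ => (hy p).const_mul (f p.2 * cofac f p.1)).sub
      (HasInt.sum Finset.univ fun p _ => (hx p).const_mul (f p.1 * cofac f p.2))).const_mul
        (2 * (f 0 * f 1 * f 2)))).add
    (((HasInt.sum Finset.univ fun p _ => (hdx p).const_mul (f p.1 * cofac f p.2)).sub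
      (HasInt.sum Finset.univ fun p _ => (hdy p).const_mul (f p.2 * cofac f p.1))).const_mul
        (2 * (f 0 * f 1 * f 2)))).add
    (HasInt.sum Finset.univ fun p _ => HasInt.sum Finset.univ fun q _ => (hxx p q).const_mul
      (f p.1 * cofac f p.2 * (f q.1 * cofac f q.2)))).add
    (HasInt.sum Finset.univ fun p _ => HasInt.sum Finset.univ fun q _ => (hyy p q).const_mul
      (f p.2 * cofac f p.1 * (f q.2 * cofac f q.1)))).sub
    ((HasInt.sum Finset.univ fun p _ => HasInt.sum Finset.univ fun q _ => (hxy p q).const_mul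
      (f p.1 * cofac f p.2 * (f q.2 * cofac f q.1))).const_mul 2)
  rw [integral_congr_ae (.of_forall hF), hI.2]
  simp only [mul_left_comm _ (muMass ℝ k), ← Finset.mul_sum, ← Finset.sum_mul, sum_coincidence_same,
    sum_coincidence_swap, sum_coincidence_mixed, sum_mul_cofac, ← mul_sub, ← mul_add]
  congr 1
  simp only [sqCoeff, cons_val_zero, cons_val_one, cons_val]
  generalize (f 0 + f 1 + f 2) = e1
  generalize (f 1 * f 2 + f 0 * f 2 + f 0 * f 1) = e2
  generalize (f 0 * f 1 * f 2) = e3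
  field_simp
  ring

end ContractionSquare

open Matrix Module
open scoped ENNReal Kronecker

/-! ### Wishart moments for the second moment -/

section QuarticMoments

/-- The normalised integral of a polynomial in the squared diagonal and the squared entries. -/
noncomputable def listVal (κ : ℝ) (l : List (ℝ × ℕ × ℕ × ℕ × ℕ × ℕ × ℕ)) : ℝ :=
  (l.map fun t => t.1 * chiVal ℝ κ t.2).sum

/-- The orbit of `(i, k, j, l)` under permutations of the indices and the exchanges of `i` and `k`
and of `j` and `l`. -/
def quadType (i k j l : Fin 3) : Fin 8 :=
  if i = k then if j = l then if i = j then 0 else 1 else if i = j ∨ i = l then 2 else 3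
  else if j = l then if j = i ∨ j = k then 4 else 5
  else if i = j ∧ k = l ∨ i = l ∧ k = j then 6 else 7

/-- Representatives of the orbits. -/
def quadRep : Fin 8 → Fin 3 × Fin 3 × Fin 3 × Fin 3 :=
  ![(2, 2, 2, 2), (0, 0, 2, 2), (1, 1, 1, 2), (0, 0, 1, 2), (0, 2, 2, 2), (0, 1, 2, 2),
    (1, 2, 1, 2), (0, 2, 1, 2)]

/-- The products of two diagonal entries and two diagonal entries of the adjugate, in the Cholesky
coordinates. -/
def quadPoly : Fin 8 → List (ℝ × ℕ × ℕ × ℕ × ℕ × ℕ × ℕ) :=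
  ![[(1, 2, 0, 0, 2, 0, 2), (1, 2, 0, 2, 2, 0, 0), (1, 2, 0, 0, 2, 2, 0), (2, 2, 0, 1, 2, 0, 1),
      (2, 2, 0, 0, 2, 1, 1), (2, 2, 0, 1, 2, 1, 0)],
    [(1, 4, 0, 0, 2, 0, 0)],
    [(1, 2, 0, 0, 3, 0, 1), (1, 2, 0, 0, 3, 1, 0), (2, 2, 1, 0, 2, 0, 1), (2, 2, 1, 0, 2, 1, 0),
      (1, 2, 2, 0, 1, 0, 1), (1, 2, 2, 0, 1, 1, 0)],
    [(1, 4, 0, 0, 1, 0, 1), (1, 4, 0, 0, 1, 1, 0)],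
    [(1, 3, 0, 0, 2, 0, 1), (1, 3, 0, 1, 2, 0, 0), (1, 3, 0, 0, 2, 1, 0)],
    [(1, 3, 0, 0, 3, 0, 0), (1, 3, 1, 0, 2, 0, 0)],
    [(1, 2, 0, 0, 2, 0, 2), (2, 2, 0, 0, 2, 1, 1), (1, 2, 0, 0, 2, 2, 0), (1, 2, 0, 1, 2, 0, 1),
      (1, 2, 0, 1, 2, 1, 0), (1, 2, 1, 0, 1, 0, 2), (2, 2, 1, 0, 1, 1, 1), (1, 2, 1, 0, 1, 2, 0),
      (1, 2, 1, 1, 1, 0, 1), (1, 2, 1, 1, 1, 1, 0)],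
    [(1, 3, 0, 0, 1, 0, 2), (2, 3, 0, 0, 1, 1, 1), (1, 3, 0, 0, 1, 2, 0), (1, 3, 0, 1, 1, 0, 1),
      (1, 3, 0, 1, 1, 1, 0)]]

/-- Exchanging the two diagonal entries, or the two adjugate entries, does not change the product;
modulo this, the type determines the orbit, as a finite check confirms. -/
theorem exists_perm_quad (i k j l : Fin 3) : ∃ σ : Equiv.Perm (Fin 3),
    (σ (quadRep (quadType i k j l)).1 = i ∧ σ (quadRep (quadType i k j l)).2.1 = k ∨
      σ (quadRep (quadType i k j l)).1 = k ∧ σ (quadRep (quadType i k j l)).2.1 = i) ∧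
    (σ (quadRep (quadType i k j l)).2.2.1 = j ∧ σ (quadRep (quadType i k j l)).2.2.2 = l ∨
      σ (quadRep (quadType i k j l)).2.2.1 = l ∧ σ (quadRep (quadType i k j l)).2.2.2 = j) := by
  revert i k j l
  decide +kernel

theorem continuous_dg_apply (i : Fin 3) :
    Continuous fun M : Matrix (Fin 3) (Fin 3) ℝ => dg M i := continuous_pi_iff.1 continuous_dg i

theorem continuous_ad_apply (i : Fin 3) :
    Continuous fun M : Matrix (Fin 3) (Fin 3) ℝ => ad M i := continuous_pi_iff.1 continuous_ad i

/-- All representatives use adjugate indices 1 and 2 only, so no odd powers of the Gaussian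
variables appear. -/
theorem hasInt_wish_quadRep {κ : ℝ} (hκ : -1 < κ) (x : Fin 8) :
    HasInt (wish ℝ κ) (fun p => dg (hmat p) (quadRep x).1 * dg (hmat p) (quadRep x).2.1
      * (ad (hmat p) (quadRep x).2.2.1 * ad (hmat p) (quadRep x).2.2.2))
      (chiMass ℝ κ * listVal κ (quadPoly x)) := by
  refine hasInt_wish_list hκ (f := fun M => dg M (quadRep x).1 * dg M (quadRep x).2.1
      * (ad M (quadRep x).2.2.1 * ad M (quadRep x).2.2.2))
    (((continuous_dg_apply _).mul (continuous_dg_apply _)).mul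
      ((continuous_ad_apply _).mul (continuous_ad_apply _))) _ fun p h1 h2 h3 => ?_
  fin_cases x <;> simp [quadRep, quadPoly, ad_two_chol h1, ad_one_chol h1, dg_chol p, chiMono] <;>
    ring

theorem hasInt_wish_quad {κ : ℝ} (hκ : -1 < κ) (i k j l : Fin 3) :
    HasInt (wish ℝ κ) (fun p => dg (hmat p) i * dg (hmat p) k * (ad (hmat p) j * ad (hmat p) l))
      (chiMass ℝ κ * listVal κ (quadPoly (quadType i k j l))) := by
  obtain ⟨σ, h1, h2⟩ := exists_perm_quad i k j l
  set r := quadRep (quadType i k j l) with hr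
  refine (hasInt_wish_perm hκ σ (f := fun d a _ => d r.1 * d r.2.1 * (a r.2.2.1 * a r.2.2.2))
    (by fun_prop) (hasInt_wish_quadRep hκ (quadType i k j l))).congr (fun p => ?_) rfl
  simp only [Function.comp_apply]
  congr 1
  · rcases h1 with ⟨h, h'⟩ | ⟨h, h'⟩ <;> rw [h, h']
    exact mul_comm _ _
  · rcases h2 with ⟨h, h'⟩ | ⟨h, h'⟩ <;> rw [h, h']
    exact mul_comm _ _

/-- The coincidence type of three indices. -/
def tripType (i j k : Fin 3) : Fin 3 :=
  if i = j ∧ j = k then 0 else if i = j ∨ j = k ∨ i = k then 1 else 2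

theorem exists_perm_trip {r : Fin 3 → Fin 3 × Fin 3 × Fin 3}
    (hr : ∀ x, tripType (r x).1 (r x).2.1 (r x).2.2 = x) (h1 : (r 1).1 = (r 1).2.1)
    (i j k : Fin 3) : ∃ σ : Equiv.Perm (Fin 3), ∀ a : Fin 3 → ℝ,
      a (σ (r (tripType i j k)).1) * a (σ (r (tripType i j k)).2.1)
        * a (σ (r (tripType i j k)).2.2) = a i * a j * a k := by
  have key : ∀ x y z i j k : Fin 3, tripType x y z = tripType i j k → (tripType x y z = 1 → x = y) →
      ∃ σ : Equiv.Perm (Fin 3), (σ x = i ∧ σ y = j ∧ σ z = k) ∨ (σ x = i ∧ σ y = k ∧ σ z = j) ∨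
        (σ x = j ∧ σ y = k ∧ σ z = i) := by
    decide +kernel
  obtain ⟨σ, h⟩ := key _ _ _ i j k (hr (tripType i j k)) (by
    rw [hr]
    intro h
    rw [h, h1])
  refine ⟨σ, fun a => ?_⟩
  rcases h with ⟨e1, e2, e3⟩ | ⟨e1, e2, e3⟩ | ⟨e1, e2, e3⟩ <;> rw [e1, e2, e3] <;> ring

/-- The products of three diagonal entries and the determinant. -/
def dgPoly : Fin 3 → List (ℝ × ℕ × ℕ × ℕ × ℕ × ℕ × ℕ) :=
  ![[(1, 4, 0, 0, 1, 0, 1)], [(1, 3, 0, 0, 2, 0, 1), (1, 3, 1, 0, 1, 0, 1)],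
    [(1, 2, 0, 0, 2, 0, 2), (1, 2, 0, 1, 2, 0, 1), (1, 2, 0, 0, 2, 1, 1), (1, 2, 1, 0, 1, 0, 2),
      (1, 2, 1, 1, 1, 0, 1), (1, 2, 1, 0, 1, 1, 1)]]

/-- The products of three diagonal entries of the adjugate, up to odd terms. -/
def adPoly : Fin 3 → List (ℝ × ℕ × ℕ × ℕ × ℕ × ℕ × ℕ) :=
  ![[(1, 3, 0, 0, 3, 0, 0)], [(1, 3, 0, 0, 2, 0, 1), (1, 3, 0, 0, 2, 1, 0)],
    [(1, 2, 0, 0, 2, 0, 2), (1, 2, 0, 0, 2, 1, 1), (1, 2, 0, 1, 2, 0, 1), (1, 2, 0, 1, 2, 1, 0),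
      (1, 2, 1, 0, 1, 0, 2), (2, 2, 1, 0, 1, 1, 1), (1, 2, 1, 0, 1, 2, 0)]]

theorem hasInt_wish_dg_trip {κ : ℝ} (hκ : -1 < κ) (i j k : Fin 3) :
    HasInt (wish ℝ κ) (fun p => dg (hmat p) i * dg (hmat p) j * dg (hmat p) k * rdet (hmat p))
      (chiMass ℝ κ * listVal κ (dgPoly (tripType i j k))) := by
  set r : Fin 3 → Fin 3 × Fin 3 × Fin 3 := ![(0, 0, 0), (0, 0, 1), (0, 1, 2)] with hr
  obtain ⟨σ, h⟩ := exists_perm_trip (r := r) (by decide) (by decide) i j k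
  generalize tripType i j k = x at h ⊢
  refine (hasInt_wish_perm hκ σ (f := fun d _ t => d (r x).1 * d (r x).2.1 * d (r x).2.2 * t)
    (by fun_prop) (v := chiMass ℝ κ * listVal κ (dgPoly x)) ?_).congr
    (fun p => by simp only [Function.comp_apply, h]) rfl
  refine hasInt_wish_list hκ
    (f := fun M => dg M (r x).1 * dg M (r x).2.1 * dg M (r x).2.2 * rdet M)
    ((((continuous_dg_apply _).mul (continuous_dg_apply _)).mul (continuous_dg_apply _)).mul
      continuous_rdet) _ fun p h1 h2 h3 => ?_
  fin_cases x <;> simp [hr, dgPoly, rdet_chol h1 h2, dg_chol p, chiMono] <;> ring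

/-- This adjugate entry cannot be avoided when all three indices differ, and it brings a term odd in
the off-diagonal Cholesky variables. -/
theorem ad_zero_chol {p : HermCoord ℝ} (h2 : 0 < p.2.2.2.1) :
    ad (hmat (cholCoord p)) 0 = p.2.2.2.1 * p.2.2.2.2.2 + p.2.2.2.1 * p.2.2.1 ^ 2
      + p.2.1 ^ 2 * p.2.2.2.2.2 + p.2.1 ^ 2 * p.2.2.2.2.1 ^ 2
      - 2 * (√p.2.2.2.1 * p.2.1 * p.2.2.1 * p.2.2.2.2.1) := by
  rw [ad, adjugate_fin_three]
  simp [hmat, cholCoord]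
  linear_combination (-p.2.2.2.2.1 ^ 2) * Real.sq_sqrt h2.le

/-- The first two off-diagonal variables appear to the first power, and each has mean zero. -/
theorem hasInt_chi_odd {κ : ℝ} (hκ : -1 < κ) (n : ℕ) (j : ℕ) :
    HasInt (chi ℝ κ) (fun p => p.1 ^ 2 * (p.2.1 ^ 1 * (p.2.2.1 ^ 1 * (p.2.2.2.1 ^ (3 / 2 : ℝ)
      * (p.2.2.2.2.1 ^ n * p.2.2.2.2.2 ^ j))))) 0 := by
  have h : 0 < κ + 1 := by linarith
  have h0 := hasInt_gau_real 1
  simp only [normalMoment, Int.cast_zero, zero_mul, mul_zero] at h0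
  exact (hasInt_chi_prod (𝕜 := ℝ) (κ := κ) (hasInt_gam (by positivity) 2)
    (hasInt_gam_rpow (r := 3 / 2) (by positivity)) (hasInt_gam h j) h0 h0
    (hasInt_gau_real n)).congr (fun _ => rfl) (by simp)

theorem hasInt_wish_ad_zero_one_two {κ : ℝ} (hκ : -1 < κ) :
    HasInt (wish ℝ κ) (fun p => ad (hmat p) 0 * ad (hmat p) 1 * ad (hmat p) 2)
      (chiMass ℝ κ * listVal κ (adPoly 2)) := by
  refine hasInt_wish_of_chi (f := fun M => ad M 0 * ad M 1 * ad M 2)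
    (((continuous_ad_apply _).mul (continuous_ad_apply _)).mul (continuous_ad_apply _))
    (((hasInt_chi_list hκ (adPoly 2)).sub ((hasInt_chi_odd hκ 1 1).const_mul 2)).sub
      ((hasInt_chi_odd hκ 3 0).const_mul 2) |>.congr (fun _ => rfl)
        (by rw [listVal, mul_zero, sub_zero, sub_zero])) fun p h1 h2 h3 => ?_
  have e : p.2.2.2.1 ^ (3 / 2 : ℝ) = p.2.2.2.1 * √p.2.2.2.1 := by
    rw [Real.sqrt_eq_rpow, show (3 / 2 : ℝ) = 1 + 1 / 2 by norm_num, Real.rpow_add h2,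
      Real.rpow_one]
  simp [adPoly, ad_two_chol h1, ad_one_chol h1, ad_zero_chol h2, chiMono, e]
  ring

theorem hasInt_wish_ad_trip {κ : ℝ} (hκ : -1 < κ) (i j k : Fin 3) :
    HasInt (wish ℝ κ) (fun p => ad (hmat p) i * ad (hmat p) j * ad (hmat p) k)
      (chiMass ℝ κ * listVal κ (adPoly (tripType i j k))) := by
  set r : Fin 3 → Fin 3 × Fin 3 × Fin 3 := ![(2, 2, 2), (2, 2, 1), (0, 1, 2)] with hr
  obtain ⟨σ, h⟩ := exists_perm_trip (r := r) (by decide) (by decide) i j k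
  generalize tripType i j k = x at h ⊢
  refine (hasInt_wish_perm hκ σ (f := fun _ d _ => d (r x).1 * d (r x).2.1 * d (r x).2.2)
    (by fun_prop) (v := chiMass ℝ κ * listVal κ (adPoly x)) ?_).congr
    (fun p => by simp only [Function.comp_apply, h]) rfl
  have hc : Continuous fun M : Matrix (Fin 3) (Fin 3) ℝ => ad M (r x).1 * ad M (r x).2.1
      * ad M (r x).2.2 :=
    ((continuous_ad_apply _).mul (continuous_ad_apply _)).mul (continuous_ad_apply _)
  fin_cases x
  · refine hasInt_wish_list hκ hc _ fun p h1 h2 h3 => ?_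
    simp [hr, adPoly, ad_two_chol h1, chiMono]
    ring
  · refine hasInt_wish_list hκ hc _ fun p h1 h2 h3 => ?_
    simp [hr, adPoly, ad_two_chol h1, ad_one_chol h1, chiMono]
    ring
  · exact hasInt_wish_ad_zero_one_two hκ

variable {κ : ℝ} (hκ : -1 < κ) {C : Matrix (Fin 3) (Fin 3) ℝ} (hC : C.IsHermitian)

/-- Integrals of symmetric functions of degree six in terms of those of monomials. -/
noncomputable def quadVal (κ a b c : ℝ) : ℝ :=
  listVal κ (quadPoly 0) * (3 * c ^ 2)
  + listVal κ (quadPoly 1) * ((b ^ 2 - 2 * a * c) * (a ^ 2 - 2 * b) - 3 * c ^ 2)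
  + (listVal κ (quadPoly 2) + listVal κ (quadPoly 4)) * (2 * c * (a * b - 3 * c))
  + listVal κ (quadPoly 3) * (2 * b * (b ^ 2 - 2 * a * c) - 2 * c * (a * b - 3 * c))
  + listVal κ (quadPoly 5) * (2 * a * c * (a ^ 2 - 2 * b) - 2 * c * (a * b - 3 * c))
  + listVal κ (quadPoly 6) * (12 * c ^ 2)
  + listVal κ (quadPoly 7) * (4 * a * b * c - 12 * c ^ 2)

/-- Integrals of symmetric functions of degree three in terms of those of monomials. -/
noncomputable def tripVal (κ : ℝ) (P : Fin 3 → List (ℝ × ℕ × ℕ × ℕ × ℕ × ℕ × ℕ)) (a b c : ℝ) : ℝ :=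
  listVal κ (P 0) * (a ^ 3 - 3 * a * b + 3 * c) + 3 * listVal κ (P 1) * (a * b - 3 * c)
    + 6 * listVal κ (P 2) * c

include hκ hC

/-- For C = diag(c) this is a cubic form in the diagonal of A whose weights are the cofactors of c;
their elementary symmetric functions are e₂, e₁ e₃ and e₃². -/
theorem hasInt_wish_mixOne_cube : HasInt (wish ℝ κ)
    (fun p => mixOne (hmat p) C ^ 3 * rdet (hmat p))
    (chiMass ℝ κ * tripVal κ dgPoly (etwo C) (rtr C * rdet C) (rdet C ^ 2)) := by
  refine hasInt_wish_mix hκ (F := fun x _ z => x ^ 3 * z) (V := fun a b c =>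
    chiMass ℝ κ * tripVal κ dgPoly b (a * c) (c ^ 2)) (by fun_prop) (fun c => ?_) hC
  refine (HasInt.sum Finset.univ fun i _ => HasInt.sum Finset.univ fun j _ =>
    HasInt.sum Finset.univ fun k _ => (hasInt_wish_dg_trip hκ i j k).const_mul
      (cofac c i * cofac c j * cofac c k)).congr (fun p => ?_) ?_
  · simp [Fin.sum_univ_three, cofac]
    ring
  · simp [Fin.sum_univ_three, cofac, tripType, tripVal]
    ring

theorem hasInt_wish_mixTwo_cube : HasInt (wish ℝ κ)
    (fun p => mixTwo (hmat p) C ^ 3)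
    (chiMass ℝ κ * tripVal κ adPoly (rtr C) (etwo C) (rdet C)) := by
  refine hasInt_wish_mix hκ (F := fun _ y _ => y ^ 3) (V := fun a b c =>
    chiMass ℝ κ * tripVal κ adPoly a b c) (by fun_prop) (fun c => ?_) hC
  refine (HasInt.sum Finset.univ fun i _ => HasInt.sum Finset.univ fun j _ =>
    HasInt.sum Finset.univ fun k _ => (hasInt_wish_ad_trip hκ i j k).const_mul
      (c i * c j * c k)).congr (fun p => ?_) ?_
  · simp [Fin.sum_univ_three]
    ring
  · simp [Fin.sum_univ_three, tripType, tripVal]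
    ring

/-- The expansion has 81 terms. Grouping them by orbit type leaves eight moments, each weighted by a
symmetric polynomial in c. -/
theorem hasInt_wish_mix_sq : HasInt (wish ℝ κ)
    (fun p => (mixOne (hmat p) C * mixTwo (hmat p) C) ^ 2)
    (chiMass ℝ κ * quadVal κ (rtr C) (etwo C) (rdet C)) := by
  refine hasInt_wish_mix hκ (F := fun x y _ => (x * y) ^ 2) (V := fun a b c =>
    chiMass ℝ κ * quadVal κ a b c) (by fun_prop) (fun c => ?_) hC
  refine (HasInt.sum Finset.univ fun i _ => HasInt.sum Finset.univ fun k _ =>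
    HasInt.sum Finset.univ fun j _ => HasInt.sum Finset.univ fun l _ =>
      (hasInt_wish_quad hκ i k j l).const_mul
      (cofac c i * cofac c k * (c j * c l))).congr (fun p => ?_) ?_
  · simp only [Fin.sum_univ_three]
    simp [cofac]
    ring
  · simp only [Fin.sum_univ_three]
    simp [cofac, quadType, quadVal]
    ring

end QuarticMoments

open Matrix Module
open scoped ENNReal Kronecker

/-! ### Averaging over the two diagonal blocks over ℝ -/

section SecondMoment

variable {κ : ℝ}

theorem symm_one : rtr (1 : Matrix (Fin 3) (Fin 3) ℝ) = 3 ∧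
    etwo (1 : Matrix (Fin 3) (Fin 3) ℝ) = 3 ∧ rdet (1 : Matrix (Fin 3) (Fin 3) ℝ) = 1 := by
  have h := symm_diag (𝕜 := ℝ) (fun _ => 1)
  simp only [RCLike.ofReal_one, diagonal_one] at h
  norm_num at h
  exact h

theorem mix_one (A : Matrix (Fin 3) (Fin 3) ℝ) : mixOne A 1 = rtr A ∧ mixTwo A 1 = etwo A := by
  simp [mixOne, mixTwo, rtr, etwo]

theorem hasInt_wish_rtr_cube (hκ : -1 < κ) : HasInt (wish ℝ κ)
    (fun p => rtr (hmat p) ^ 3 * rdet (hmat p)) (chiMass ℝ κ * tripVal κ dgPoly 3 3 1) := by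
  have := hasInt_wish_mixOne_cube hκ isHermitian_one
  simpa [symm_one, mix_one] using this

theorem hasInt_wish_etwo_cube (hκ : -1 < κ) : HasInt (wish ℝ κ)
    (fun p => etwo (hmat p) ^ 3) (chiMass ℝ κ * tripVal κ adPoly 3 3 1) := by
  have := hasInt_wish_mixTwo_cube hκ isHermitian_one
  simpa [symm_one, mix_one] using this

theorem hasInt_wish_rtr_etwo_sq (hκ : -1 < κ) : HasInt (wish ℝ κ)
    (fun p => (rtr (hmat p) * etwo (hmat p)) ^ 2) (chiMass ℝ κ * quadVal κ 3 3 1) := by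
  have := hasInt_wish_mix_sq hκ isHermitian_one
  simpa [symm_one, mix_one] using this

/-- The integral of a symmetric polynomial with the given coefficients of `e₁²e₂²`, `e₂³`, `e₁³e₃`,
`e₁e₂e₃` and `e₃²`. -/
noncomputable def symmVal (κ : ℝ) (p : Fin 5 → ℝ) : ℝ :=
  p 0 * quadVal κ 3 3 1 + p 1 * tripVal κ adPoly 3 3 1 + p 2 * tripVal κ dgPoly 3 3 1
    + p 3 * (3 * pairVal ℝ κ 1 0 0 + 6 * pairVal ℝ κ 1 0 1) + p 4 * detVal ℝ κ 2

theorem hasInt_wish_symm (hκ : -1 < κ) (p : Fin 5 → ℝ) : HasInt (wish ℝ κ)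
    (fun x => p 0 * (rtr (hmat x) * etwo (hmat x)) ^ 2 + p 1 * etwo (hmat x) ^ 3
      + p 2 * (rtr (hmat x) ^ 3 * rdet (hmat x)) + p 3 * (rtr (hmat x) * etwo (hmat x)
        * rdet (hmat x)) + p 4 * rdet (hmat x) ^ 2) (chiMass ℝ κ * symmVal κ p) :=
  (((((hasInt_wish_rtr_etwo_sq hκ).const_mul (p 0)).add
    ((hasInt_wish_etwo_cube hκ).const_mul (p 1))).add
    ((hasInt_wish_rtr_cube hκ).const_mul (p 2))).add
    ((hasInt_wish_tr_etwo (𝕜 := ℝ) hκ 1).const_mul (p 3))).add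
    ((hasInt_wish_det (𝕜 := ℝ) hκ 2).const_mul (p 4)) |>.congr (fun x => by simp)
    (by unfold symmVal; ring)

/-- The coefficients of `quadVal`. -/
noncomputable def quadCoeff (κ : ℝ) : Fin 5 → ℝ :=
  let T := fun x => listVal κ (quadPoly x)
  ![T 1, 2 * T 3 - 2 * T 1, 2 * T 5 - 2 * T 1,
    4 * T 1 + 2 * T 2 - 6 * T 3 + 2 * T 4 - 6 * T 5 + 4 * T 7,
    3 * T 0 - 3 * T 1 - 6 * T 2 + 6 * T 3 - 6 * T 4 + 6 * T 5 + 12 * T 6 - 12 * T 7]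

/-- The coefficients of the average over the first diagonal block. -/
noncomputable def blockCoeff (κ : ℝ) (s : Fin 4 → ℝ) : Fin 5 → ℝ :=
  fun i => s 2 * quadCoeff κ i
    + ![0, s 3 * listVal κ (dgPoly 0), s 3 * listVal κ (adPoly 0),
      s 1 * pairVal ℝ κ 1 0 1 + s 3 * (3 * listVal κ (dgPoly 1) - 3 * listVal κ (dgPoly 0)
        + 3 * listVal κ (adPoly 1) - 3 * listVal κ (adPoly 0)),
      s 0 * detVal ℝ κ 2 + s 1 * (3 * pairVal ℝ κ 1 0 0 - 3 * pairVal ℝ κ 1 0 1)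
        + s 3 * (3 * listVal κ (dgPoly 0) - 9 * listVal κ (dgPoly 1) + 6 * listVal κ (dgPoly 2)
          + 3 * listVal κ (adPoly 0) - 9 * listVal κ (adPoly 1) + 6 * listVal κ (adPoly 2))] i

/-- After scaling by det(C)⁴ the X-average is a polynomial in the mixed invariants. The A-average
yields a combination of e₁²e₂², e₂³, e₁³e₃, e₁e₂e₃ and e₃² of C, which `symmVal` then integrates. -/
theorem coneInt_real_two (k : ℕ) : coneInt ℝ k 2 / coneInt ℝ k 0
    = symmVal (k + 3 / 2) (blockCoeff (k + 3 / 2) (sqCoeff k)) := by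
  have hκ : (k + 3 * (finrank ℝ ℝ : ℕ) / 2 : ℝ) = k + 3 / 2 := by
    rw [finrank_real_real]
    norm_num
  have hκ1 := neg_one_lt_add_half k
  have hm := chiMass_pos (𝕜 := ℝ) hκ1
  have hM := muMass_pos (𝕜 := ℝ) k
  rw [coneInt_zero, hκ]
  generalize (k + 3 / 2 : ℝ) = κ at *
  set s := sqCoeff k with hs
  have key : coneInt ℝ k 2 = muMass ℝ k * chiMass ℝ κ ^ 2 * symmVal κ (blockCoeff κ s) := by
    refine integral_parVol (integrable_cone k 2) (G := fun A C => muMass ℝ k *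
        (s 0 * (rdet A * rdet C) ^ 2 + s 1 * (mixOne A C * mixTwo A C * (rdet A * rdet C))
          + s 2 * (mixOne A C * mixTwo A C) ^ 2
          + s 3 * (mixTwo A C ^ 3 * rdet C + mixOne A C ^ 3 * rdet A)))
      (fun A C f h1 h2 h3 => ?_)
      (H := fun C => muMass ℝ k * chiMass ℝ κ * (blockCoeff κ s 0 * (rtr C * etwo C) ^ 2
        + blockCoeff κ s 1 * etwo C ^ 3 + blockCoeff κ s 2 * (rtr C ^ 3 * rdet C)
        + blockCoeff κ s 3 * (rtr C * etwo C * rdet C) + blockCoeff κ s 4 * rdet C ^ 2))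
      (fun C hC => ?_) ?_
    · rw [integral_cDet_sq, ← h1, ← h2, ← h3]
      ring
    · rw [hκ]
      refine (((((hasInt_wish_det (𝕜 := ℝ) hκ1 2).const_mul (s 0 * rdet C ^ 2)).add
        ((hasInt_wish_mix_pair (𝕜 := ℝ) hκ1 1 hC).const_mul (s 1 * rdet C))).add
        ((hasInt_wish_mix_sq hκ1 hC).const_mul (s 2))).add
        (((hasInt_wish_mixTwo_cube hκ1 hC).const_mul (s 3 * rdet C)).add
          ((hasInt_wish_mixOne_cube hκ1 hC).const_mul (s 3)))).const_mul (muMass ℝ k) |>.congr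
        (fun p => ?_) ?_
      · ring
      · simp [blockCoeff, quadCoeff, quadVal, tripVal]
        ring
    · rw [hκ]
      exact ((hasInt_wish_symm hκ1 (blockCoeff κ s)).const_mul (muMass ℝ k * chiMass ℝ κ)).congr
        (fun p => rfl) (by ring)
  rw [key]
  field_simp

end SecondMoment

open Matrix Module
open scoped ENNReal Kronecker

/-! ### Closed form of the second moment -/

section SecondMomentValue

/-- Factored values of the individual moments keep the final rational identity manageable. -/
theorem listVal_quadPoly (k : ℝ) :
    listVal (k + 3 / 2) (quadPoly 0) =
      (2 * k + 9) * (2 * k + 9) * (k + 4) * (2 * k + 7) * (2 * k + 7) * (k + 3) / 16 ∧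
    listVal (k + 3 / 2) (quadPoly 1) =
      (2 * k + 11) * (2 * k + 9) * (k + 4) * (2 * k + 7) * (k + 3) * (2 * k + 13) / 16 ∧
    listVal (k + 3 / 2) (quadPoly 2) =
      (2 * k + 11) * (2 * k + 9) * (2 * k + 9) * (2 * k + 7) * (k + 3) * (k + 3) / 16 ∧
    listVal (k + 3 / 2) (quadPoly 3) =
      (2 * k + 11) * (2 * k + 9) * (2 * k + 7) * (k + 3) * (k + 3) * (2 * k + 13) / 16 ∧
    listVal (k + 3 / 2) (quadPoly 4) =
      (2 * k + 11) * (2 * k + 9) * (k + 4) * (2 * k + 7) * (2 * k + 7) * (k + 3) / 16 ∧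
    listVal (k + 3 / 2) (quadPoly 5) =
      (2 * k + 11) * (2 * k + 11) * (2 * k + 9) * (k + 4) * (2 * k + 7) * (k + 3) / 16 ∧
    listVal (k + 3 / 2) (quadPoly 6) =
      (2 * k + 9) * (2 * k + 9) * (2 * k + 9) * (2 * k + 7) * (k + 3) * (k + 3) / 16 ∧
    listVal (k + 3 / 2) (quadPoly 7) =
      (2 * k + 11) * (2 * k + 9) * (2 * k + 9) * (2 * k + 7) * (k + 3) * (k + 3) / 16 := by
  refine ⟨?_, ?_, ?_, ?_, ?_, ?_, ?_, ?_⟩ <;>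
  · simp [quadPoly, listVal, chiVal, rising, Finset.prod_range_succ]
    ring

theorem listVal_dgPoly (k : ℝ) :
    listVal (k + 3 / 2) (dgPoly 0) =
      (2 * k + 11) * (2 * k + 9) * (2 * k + 7) * (k + 3) * (2 * k + 5) * (2 * k + 13) / 32 ∧
    listVal (k + 3 / 2) (dgPoly 1) =
      (2 * k + 11) * (2 * k + 9) * (2 * k + 9) * (2 * k + 7) * (k + 3) * (2 * k + 5) / 32 ∧
    listVal (k + 3 / 2) (dgPoly 2) =
      (2 * k + 9) * (2 * k + 9) * (2 * k + 9) * (2 * k + 7) * (k + 3) * (2 * k + 5) / 32 := by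
  refine ⟨?_, ?_, ?_⟩ <;>
  · simp [dgPoly, listVal, chiVal, rising, Finset.prod_range_succ]
    ring

theorem listVal_adPoly (k : ℝ) :
    listVal (k + 3 / 2) (adPoly 0) =
      (2 * k + 11) * (k + 5) * (2 * k + 9) * (k + 4) * (2 * k + 7) * (k + 3) / 8 ∧
    listVal (k + 3 / 2) (adPoly 1) =
      (2 * k + 11) * (2 * k + 9) * (k + 4) * (2 * k + 7) * (k + 3) * (k + 3) / 8 ∧
    listVal (k + 3 / 2) (adPoly 2) =
      (2 * k + 9) * (k + 4) * (2 * k + 7) * (k + 3) * (2 * k ^ 2 + 15 * k + 26) / 8 := by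
  refine ⟨?_, ?_, ?_⟩ <;>
  · simp [adPoly, listVal, chiVal, rising, Finset.prod_range_succ]
    ring

theorem pairVal_real_one (k : ℝ) :
    pairVal ℝ (k + 3 / 2) 1 0 0 =
      (2 * k + 9) * (2 * k + 9) * (k + 4) * (2 * k + 7) * (k + 3) * (2 * k + 5) / 16 ∧
    pairVal ℝ (k + 3 / 2) 1 0 1 =
      (2 * k + 11) * (2 * k + 9) * (k + 4) * (2 * k + 7) * (k + 3) * (2 * k + 5) / 16 ∧
    detVal ℝ (k + 3 / 2) 2 =
      (2 * k + 9) * (k + 4) * (2 * k + 7) * (2 * k + 7) * (k + 3) * (2 * k + 5) / 16 := by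
  refine ⟨?_, ?_, ?_⟩ <;>
  · simp [pairVal, detVal, chiVal, rising, Finset.prod_range_succ]
    ring

theorem rawMoment_real_two (k : ℕ) : rawMoment ℝ k 2 =
    (16 * (k : ℝ) ^ 9 + 336 * (k : ℝ) ^ 8 + 2616 * (k : ℝ) ^ 7 + 8496 * (k : ℝ) ^ 6
      + 12069 * (k : ℝ) ^ 5 + 101979 * (k : ℝ) ^ 4 + 903539 * (k : ℝ) ^ 3
      + 3316809 * (k : ℝ) ^ 2 + 5620320 * (k : ℝ) + 3715740) /
    (331776 * ((k : ℝ) + 5) * (3 * (k : ℝ) + 11) * (3 * (k : ℝ) + 13) * (3 * (k : ℝ) + 14)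
      * (3 * (k : ℝ) + 16) * (6 * (k : ℝ) + 23) * (6 * (k : ℝ) + 25) * (6 * (k : ℝ) + 29)
      * (6 * (k : ℝ) + 31)) * rawMoment ℝ k 0 := by
  rw [rawMoment_eq k 2, coneInt_real_two, finrank_real_real]
  congr 1
  simp only [symmVal, blockCoeff, quadCoeff, quadVal, tripVal, listVal_quadPoly, listVal_dgPoly,
    listVal_adPoly, pairVal_real_one, sqCoeff, rising, Finset.prod_range_succ, Finset.prod_range_zero,
    cons_val_zero, cons_val_one, cons_val]
  norm_num
  field_simp
  ring

end SecondMomentValue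

open Matrix Module
open scoped ENNReal Kronecker

/-! ### Dimensions 20 and 35, and the main theorem -/

theorem finrank_traceless_real : ((finrank ℝ (traceless ℝ) : ℕ) : ℝ) = 20 := by
  rw [finrank_traceless, finrank_real_real]
  norm_num

theorem finrank_traceless_complex : ((finrank ℝ (traceless ℂ) : ℕ) : ℝ) = 35 := by
  rw [finrank_traceless, Complex.finrank_real_complex]
  norm_num

theorem mainTheorem3 :
    (IsProbabilityMeasure (hsMeasure ℝ 20) ∧
      ∀ k : ℕ, moment (hsMeasure ℝ 20) k 0 ≠ 0 ∧
        moment (hsMeasure ℝ 20) k 1 =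
          (4 * (k : ℝ) ^ 5 + 40 * (k : ℝ) ^ 4 + 95 * (k : ℝ) ^ 3 - 220 * (k : ℝ) ^ 2
              - 1149 * (k : ℝ) - 1170) /
            (576 * ((k : ℝ) + 4) * (3 * (k : ℝ) + 11) * (3 * (k : ℝ) + 13) * (6 * (k : ℝ) + 23)
              * (6 * (k : ℝ) + 25)) *
            moment (hsMeasure ℝ 20) k 0 ∧
        moment (hsMeasure ℝ 20) k 2 =
          (16 * (k : ℝ) ^ 9 + 336 * (k : ℝ) ^ 8 + 2616 * (k : ℝ) ^ 7 + 8496 * (k : ℝ) ^ 6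
              + 12069 * (k : ℝ) ^ 5 + 101979 * (k : ℝ) ^ 4 + 903539 * (k : ℝ) ^ 3
              + 3316809 * (k : ℝ) ^ 2 + 5620320 * (k : ℝ) + 3715740) /
            (331776 * ((k : ℝ) + 5) * (3 * (k : ℝ) + 11) * (3 * (k : ℝ) + 13) * (3 * (k : ℝ) + 14)
              * (3 * (k : ℝ) + 16) * (6 * (k : ℝ) + 23) * (6 * (k : ℝ) + 25) * (6 * (k : ℝ) + 29)
              * (6 * (k : ℝ) + 31)) *
            moment (hsMeasure ℝ 20) k 0) ∧
    (IsProbabilityMeasure (hsMeasure ℂ 35) ∧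
      ∀ k : ℕ, moment (hsMeasure ℂ 35) k 0 ≠ 0 ∧
        moment (hsMeasure ℂ 35) k 1 =
          ((k : ℂ) ^ 5 + 15 * (k : ℂ) ^ 4 + 37 * (k : ℂ) ^ 3 - 423 * (k : ℂ) ^ 2
              - 2558 * (k : ℂ) - 3840) /
            (72 * (2 * (k : ℂ) + 13) * (3 * (k : ℂ) + 19) * (3 * (k : ℂ) + 20) * (6 * (k : ℂ) + 37)
              * (6 * (k : ℂ) + 41)) *
            moment (hsMeasure ℂ 35) k 0) := by

  have hr0 : rawMoment ℝ 0 0 ≠ 0 := (rawMoment_zero_pos 0).ne'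
  have hc0 : rawMoment ℂ 0 0 ≠ 0 := (rawMoment_zero_pos 0).ne'
  have hr := moment_hsMeasure finrank_traceless_real (rawMoment_zero_pos 0)
  have hc := moment_hsMeasure finrank_traceless_complex (rawMoment_zero_pos 0)
  refine ⟨⟨isProbabilityMeasure_hsMeasure finrank_traceless_real (rawMoment_zero_pos 0),
    fun k => ⟨?_, ?_, ?_⟩⟩,
    isProbabilityMeasure_hsMeasure finrank_traceless_complex (rawMoment_zero_pos 0),
    fun k => ⟨?_, ?_⟩⟩
  · rw [hr]
    exact RCLike.ofReal_ne_zero.2 (div_ne_zero (rawMoment_zero_pos k).ne' hr0)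
  · rw [hr, hr, rawMoment_real_one]
    simp only [RCLike.ofReal_real_eq_id, id_eq]
    ring
  · rw [hr, hr, rawMoment_real_two]
    simp only [RCLike.ofReal_real_eq_id, id_eq]
    ring
  · rw [hc]
    exact RCLike.ofReal_ne_zero.2 (div_ne_zero (rawMoment_zero_pos k).ne' hc0)
  · rw [hc, hc, rawMoment_complex_one]
    simp only [Complex.coe_algebraMap]
    push_cast
    ring
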